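/- **Theorem 2 (shuffled DP Gaussian KDE).** For a dataset $X=(x_1,\dots,x_n)\in(\mathbb{R}^d)^n$ let $KDE_X(y)=\frac1n\sum_{u=1}^n\exp(-\|x_u-y\|_2^2)$. In a shuffled protocol, each of $n\ge1$ users holds one point of $\mathbb{R}^d$, $d\ge1$, and runs a randomizer on it, with private and with shared public randomness; the resulting messages of all users are put in a uniformly random order and passed to an analyzer, which publishes a description of a function $\widetilde K:\mathbb{R}^d\to\mathbb{R}$. The protocol is $(\varepsilon,\delta)$-DP in the communication-threat model if, for all datasets $X,X'$ that differ on at most one coordinate and every event $T$, the view $V(X)$ that consists of the public randomness and the shuffled messages satisfies $\Pr[V(X)\in T]\le e^{\varepsilon}\Pr[V(X')\in T]+\delta$. There are constants $C,C'>0$ such that the following holds. Let $\delta\in(0,1)$ and $0<\varepsilon\le C\log(1/\delta)$. For every $\alpha\ge C'\sqrt{\log(1/\delta)}/(\varepsilon n)$ there is a shuffled protocol that is $(\varepsilon,\delta)$-DP in the communication-threat model, and that has - supRMSE at most $\alpha$, that is, $\sup_{y\in\mathbb{R}^d}\sqrt{\mathbb{E}[(\widetilde K(y)-KDE_X(y))^2]}\le\alpha$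 for every $X\in(\mathbb{R}^d)^n$; - user running time at most $\min(O(d/\alpha^2),\tilde O(d+1/\alpha^4))$; - bit-width $1$: each message consists of a one-bit value and the label of one of $O(1/\alpha^2)$ protocol instances; - expected communication of $\tilde O(1/\alpha^2)$ bits per user (labels included); - expected analyzer running time $O(n/\alpha^2)$; - time at most $\min(O(d/\alpha^2),\tilde O(d+1/\alpha^4))$ to evaluate $\widetilde K(y)$ at a query point $y$ from the published output and the public randomness. The constants, including those in $O(\cdot)$ and $\tilde O(\cdot)$, are absolute, and $\tilde O(f)$ means $O(f\cdot\log^{p}(2+f))$ with an absolute $p$. Running times are step counts on a real RAM with unit-cost arithmetic and elementary functions, on which the protocol is given by three fixed programs that receive $n,d,\varepsilon,\delta,\alpha$ as parameters; if $\alpha>1$, so that an $O(\cdot)$ time bound may be less than $1$, it is read as $O(1+\cdot)$. -/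

import Mathlib

open MeasureTheory
open scoped ENNReal

noncomputable section

namespace ShuffledKDE

/-! ### A unit-cost real RAM with counted loops -/

/-- A message sent to the shuffler: a numerical value, tagged with the label of the protocol
instance that it belongs to. -/
structure Message where
  label : ℕ
  value : ℕ

/-- Binary operations on real registers. -/
inductive BinOp where
  | add | sub | mul | div

def BinOp.eval : BinOp → ℝ → ℝ → ℝ
  | .add => fun a b => a + b
  | .sub => fun a b => a - b
  | .mul => fun a b => a * b
  | .div => fun a b => a / b

/-- Unary operations on real registers. -/
inductive UnOp where
  | cos | exp | log | sqrt

def UnOp.eval : UnOp → ℝ → ℝ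
  | .cos => Real.cos
  | .exp => Real.exp
  | .log => Real.log
  | .sqrt => Real.sqrt

/-- Machine state: registers and arrays holding natural numbers, registers and arrays holding
real numbers, the messages sent so far, the real numbers published so far, and the number of
steps executed so far. -/
structure State where
  nreg : ℕ → ℕ
  rreg : ℕ → ℝ
  nmem : ℕ → ℕ → ℕ
  rmem : ℕ → ℕ → ℝ
  sent : List Message
  published : List ℝ
  time : ℕ

/-- Programs. All register names and array names are constants of the program; array cells are
addressed through natural-number registers. The only numerical constants are natural numbers,
rational numbers and `π`. -/
inductive Cmd where
  | skip
  | natConst (dst k : ℕ)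
  | natAdd (dst a b : ℕ)
  | natSub (dst a b : ℕ)
  | natLoad (dst arr idx : ℕ)
  | natStore (arr idx src : ℕ)
  | realConst (dst : ℕ) (q : ℚ)
  | realPi (dst : ℕ)
  | realOfNat (dst src : ℕ)
  | natCeil (dst src : ℕ)
  | realBin (op : BinOp) (dst a b : ℕ)
  | realUn (op : UnOp) (dst a : ℕ)
  | realLoad (dst arr idx : ℕ)
  | realStore (arr idx src : ℕ)
  | send (label value : ℕ)
  | publish (src : ℕ)
  | seq (c₁ c₂ : Cmd)
  | ifNatLt (a b : ℕ) (c₁ c₂ : Cmd)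
  | ifRealLt (a b : ℕ) (c₁ c₂ : Cmd)
  | loop (count : ℕ) (body : Cmd)

namespace State

/-- Count one step. -/
def tick (s : State) : State := { s with time := s.time + 1 }

def setNat (s : State) (dst v : ℕ) : State :=
  { s with nreg := Function.update s.nreg dst v }

def setReal (s : State) (dst : ℕ) (v : ℝ) : State :=
  { s with rreg := Function.update s.rreg dst v }

def storeNat (s : State) (arr i v : ℕ) : State :=
  { s with nmem := Function.update s.nmem arr (Function.update (s.nmem arr) i v) }

def storeReal (s : State) (arr i : ℕ) (v : ℝ) : State :=
  { s with rmem := Function.update s.rmem arr (Function.update (s.rmem arr) i v) }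

end State

/-- Execution. Every elementary operation, every test and every loop iteration takes one step.
The number of iterations of a loop is the content of its count register when the loop is
entered. Rounding a real number up to a natural number `k` takes `k + 1` steps, as it would by
counting up to it, so that rounding adds no power to the machine. -/
def Cmd.exec : Cmd → State → State
  | .skip, s => s
  | .natConst dst k, s => (s.setNat dst k).tick
  | .natAdd dst a b, s => (s.setNat dst (s.nreg a + s.nreg b)).tick
  | .natSub dst a b, s => (s.setNat dst (s.nreg a - s.nreg b)).tick
  | .natLoad dst arr idx, s => (s.setNat dst (s.nmem arr (s.nreg idx))).tick
  | .natStore arr idx src, s => (s.storeNat arr (s.nreg idx) (s.nreg src)).tick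
  | .realConst dst q, s => (s.setReal dst (q : ℝ)).tick
  | .realPi dst, s => (s.setReal dst Real.pi).tick
  | .realOfNat dst src, s => (s.setReal dst (s.nreg src : ℝ)).tick
  | .natCeil dst src, s =>
      State.tick { s.setNat dst ⌈s.rreg src⌉₊ with time := s.time + ⌈s.rreg src⌉₊ }
  | .realBin op dst a b, s => (s.setReal dst (op.eval (s.rreg a) (s.rreg b))).tick
  | .realUn op dst a, s => (s.setReal dst (op.eval (s.rreg a))).tick
  | .realLoad dst arr idx, s => (s.setReal dst (s.rmem arr (s.nreg idx))).tick
  | .realStore arr idx src, s => (s.storeReal arr (s.nreg idx) (s.rreg src)).tick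
  | .send label value, s =>
      State.tick { s with sent := s.sent ++ [⟨s.nreg label, s.nreg value⟩] }
  | .publish src, s => State.tick { s with published := s.published ++ [s.rreg src] }
  | .seq c₁ c₂, s => c₂.exec (c₁.exec s)
  | .ifNatLt a b c₁ c₂, s => if s.nreg a < s.nreg b then c₁.exec s.tick else c₂.exec s.tick
  | .ifRealLt a b c₁ c₂, s =>
      open Classical in if s.rreg a < s.rreg b then c₁.exec s.tick else c₂.exec s.tick
  | .loop count body, s => (fun t => body.exec (State.tick t))^[s.nreg count] s.tick

/-! ### Shuffled protocols for kernel density estimation -/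

/-- The target privacy parameters and the target error, known to all parties. -/
structure Params where
  eps : ℝ
  delta : ℝ
  alpha : ℝ

abbrev Point (d : ℕ) := EuclideanSpace ℝ (Fin d)

/-- A source of randomness: an infinite sequence of elements of `[0,1]`. -/
abbrev Tape := ℕ → unitInterval

/-- The law of an i.i.d. sequence of uniform elements of `[0,1]`. -/
def tapeLaw : Measure Tape := Measure.infinitePi fun _ => (volume : Measure unitInterval)

/-- Initial state. The parameters are in registers, and the inputs are in arrays:
real array 0 is the public randomness, real array 1 the private randomness, real array 2 a point
of `ℝ^d`, real array 3 a published description, natural arrays 0 and 1 are the labels and the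
values of a sequence of messages; natural register 2 is the length of the variable-length
input. Everything else is zero. -/
def initState (n d : ℕ) (θ : Params) (pub coins : ℕ → ℝ) (point : ℕ → ℝ)
    (desc : List ℝ) (msgs : List Message) (len : ℕ) : State where
  nreg := fun
    | 0 => n
    | 1 => d
    | 2 => len
    | _ => 0
  rreg := fun
    | 1 => θ.eps
    | 2 => θ.delta
    | 3 => θ.alpha
    | _ => 0
  nmem := fun
    | 0 => fun j => (msgs.map Message.label).getD j 0
    | 1 => fun j => (msgs.map Message.value).getD j 0
    | _ => fun _ => 0
  rmem := fun
    | 0 => pub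
    | 1 => coins
    | 2 => point
    | 3 => fun j => desc.getD j 0
    | _ => fun _ => 0
  sent := []
  published := []
  time := 0

/-- The coordinates of a point, as an array. -/
def pointArray {d : ℕ} (x : Point d) : ℕ → ℝ := fun j => if h : j < d then x ⟨j, h⟩ else 0

/-- The real numbers on a tape, as an array. -/
def tapeArray (r : Tape) : ℕ → ℝ := fun j => (r j : ℝ)

/-- A shuffled protocol is given by the programs of its randomizer and of its analyzer, and by
the program that evaluates the function described by the analyzer's published output. -/
structure Protocol where
  randomizer : Cmd
  analyzer : Cmd
  query : Cmd

namespace Protocol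

/-- The run of a user with point `x`, public randomness `pub` and private randomness `r`. -/
def userRun (P : Protocol) (n : ℕ) {d : ℕ} (θ : Params) (pub r : Tape) (x : Point d) : State :=
  P.randomizer.exec (initState n d θ (tapeArray pub) (tapeArray r) (pointArray x) [] [] 0)

/-- The run of the analyzer on the sequence of messages received from the shuffler, with private
randomness `r`. -/
def analyzerRun (P : Protocol) (n d : ℕ) (θ : Params) (pub r : Tape) (msgs : List Message) :
    State :=
  P.analyzer.exec
    (initState n d θ (tapeArray pub) (tapeArray r) (fun _ => 0) [] msgs msgs.length)

/-- The (deterministic) evaluation, at the query point `y`, of the function described by the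
published real numbers `desc` and the public randomness. The result is in real register 0. -/
def queryRun (P : Protocol) (n : ℕ) {d : ℕ} (θ : Params) (pub : Tape) (desc : List ℝ)
    (y : Point d) : State :=
  P.query.exec (initState n d θ (tapeArray pub) (fun _ => 0) (pointArray y) desc [] desc.length)

/-- The messages of all users, before shuffling. -/
def allMessages (P : Protocol) {n d : ℕ} (θ : Params) (pub : Tape) (r : Fin n → Tape)
    (X : Fin n → Point d) : List Message :=
  (List.ofFn fun u => (P.userRun n θ pub (r u) (X u)).sent).flatten

end Protocol

/-- The shuffler: the expectation of `F` at a uniformly random reordering of the list `l`. -/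
def shuffleMean (l : List Message) (F : List Message → ℝ≥0∞) : ℝ≥0∞ :=
  (∑ σ : Equiv.Perm (Fin l.length), F (List.ofFn fun i => l.get (σ i))) / (l.length.factorial : ℕ)

namespace Protocol

/-- The expectation of a function `F` of the public randomness and of the output of the shuffler,
when the users hold the dataset `X`. Public randomness and the private randomness of the users
are independent. -/
def viewMean (P : Protocol) {n d : ℕ} (θ : Params) (X : Fin n → Point d)
    (F : Tape → List Message → ℝ≥0∞) : ℝ≥0∞ :=
  ∫⁻ pub, ∫⁻ r, shuffleMean (P.allMessages θ pub r X) (F pub)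
    ∂(Measure.pi fun _ : Fin n => tapeLaw) ∂tapeLaw

/-- The probability that the public randomness together with the output of the shuffler lies
in `T`. -/
def viewProb (P : Protocol) {n d : ℕ} (θ : Params) (X : Fin n → Point d)
    (T : Set (Tape × List Message)) : ℝ≥0∞ :=
  P.viewMean θ X fun pub l => T.indicator 1 (pub, l)

end Protocol

/-- Two datasets are neighbouring if they differ on at most one coordinate. -/
def Neighbouring {n d : ℕ} (X X' : Fin n → Point d) : Prop := ∃ u, ∀ v, v ≠ u → X v = X' v

namespace Protocol

/-- `(ε, δ)`-differential privacy in the shuffled model, under the communication-threat model: the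
adversary sees the output of the shuffler, and the public randomness. (There are countably many
lists of messages, so that `T` is measurable when its sections are.) -/
def IsShuffledDP (P : Protocol) (n d : ℕ) (θ : Params) : Prop :=
  ∀ X X' : Fin n → Point d, Neighbouring X X' →
    ∀ T : Set (Tape × List Message), (∀ l, MeasurableSet {pub | (pub, l) ∈ T}) →
      P.viewProb θ X T
        ≤ ENNReal.ofReal (Real.exp θ.eps) * P.viewProb θ X' T + ENNReal.ofReal θ.delta

end Protocol

/-- The Gaussian kernel density estimate at `y` of the dataset `X`. -/
def gaussianKDE {n d : ℕ} (X : Fin n → Point d) (y : Point d) : ℝ :=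
  (∑ u, Real.exp (-‖X u - y‖ ^ 2)) / n

namespace Protocol

/-- The supremum over all query points of the root mean square error. -/
def supRMSE (P : Protocol) {n d : ℕ} (θ : Params) (X : Fin n → Point d) : ℝ≥0∞ :=
  ⨆ y : Point d,
    (P.viewMean θ X fun pub l =>
      ∫⁻ r, ENNReal.ofReal
        (((P.queryRun n θ pub (P.analyzerRun n d θ pub r l).published y).rreg 0
          - gaussianKDE X y) ^ 2) ∂tapeLaw) ^ (1 / 2 : ℝ)

/-- The expected running time of the analyzer. -/
def meanAnalyzerTime (P : Protocol) {n d : ℕ} (θ : Params) (X : Fin n → Point d) : ℝ≥0∞ :=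
  P.viewMean θ X fun pub l => ∫⁻ r, ((P.analyzerRun n d θ pub r l).time : ℝ≥0∞) ∂tapeLaw

/-- All messages carry one of `I` labels, and values of bit-width `w`. -/
def HasMessageFormat (P : Protocol) (n d : ℕ) (θ : Params) (I w : ℕ) : Prop :=
  ∀ (pub r : Tape) (x : Point d), ∀ m ∈ (P.userRun n θ pub r x).sent, m.label < I ∧ m.value < 2 ^ w

/-- The expected number of bits that a user with point `x` sends to the shuffler, when each message
is written as a label among `I` labels and a value of bit-width `w`. -/
def meanUserBits (P : Protocol) (n : ℕ) {d : ℕ} (θ : Params) (I w : ℕ) (x : Point d) : ℝ≥0∞ :=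
  ∫⁻ pub, ∫⁻ r, (((P.userRun n θ pub r x).sent.length * (Nat.clog 2 I + w) : ℕ) : ℝ≥0∞)
    ∂tapeLaw ∂tapeLaw

end Protocol

/-- The bound `Õ(f)`, namely `K f polylog(f)` with a polylogarithmic factor of degree `p`. -/
def softO (K : ℝ) (p : ℕ) (f : ℝ) : ℝ := K * f * (1 + Real.log (1 + f)) ^ p

/-- The bound `O(f)` on a number of steps; a program that does anything takes at least one step,
hence the additive `1`, which only matters for `f < 1`. -/
def stepsO (K : ℝ) (f : ℝ) : ℝ := K * (1 + f)

end ShuffledKDE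

end

/-! Take `I = 2 ^ l` instances, with `I` of order `1/α²`. Public randomness fixes random Fourier
features `f_j(x) = cos(⟨g_j, Sx⟩ + 2πβ_j)` with Gaussian `g_j` of variance 2 and `β_j` uniform, so
that `2 f_j(x) f_j(y)` has conditional mean `exp(-‖Sx - Sy‖²)` given `S`. If `d > I`, then `S` is a
count sketch into `I` cells; otherwise it only flips signs and is an isometry. The sketch is what
replaces `d/α²` by `d` times a logarithm plus `1/α⁴` in the running time. In instance `j` a user
sends a bit that is 1 with probability `1/2 + f_j(x)/(4√n)`. The analyzer counts the votes and
rescales them; a query at `y` averages the rescaled counts against `2 f_j(y)`.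

Accuracy. The noise of the bits contributes `16/I` to the mean squared error, independently of `n`,
because the rescaling by `√n` is balanced by averaging over `n` users (`lintegral_error_le`). The
features and the sketch contribute `34/I` (`integral_kernel_sub_sq_le`). The relative variance of
`‖Sz‖²` is at most `2/I`; the decay of the exponential turns this into an error bound that is
uniform in `‖z‖` (`integral_exp_sketchNorm_sub_sq_le`). The sum `50/I` is below `α²`.

Privacy. Fix the public tape. The shuffled view depends on the bits only through the number of ones
in each instance (`messagesOf_perm`), and the instances are independent. Changing one user changes
the likelihood of a count by a factor `1 + D · E[c_{u₀} - p_{u₀} | count]`, where `D` is of order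
`1/√n` because all biases are. By exchanging the bits of `u₀` and `u`, the conditional expectation
equals that of an average over all users `u` (`sum_count_swapStat`), which fluctuates by only
`1/√n`. Hence the ratio minus 1 is subgaussian at scale `1/n` (`sum_exp_ratio_le`). Multiplying over
`I` instances gives the scale `√I/n`, of order `1/(αn)`, and a Chernoff bound gives `(ε, δ)`-privacy
as soon as `αεn` is at least a constant times `√log(1/δ)` (`sum_colWeight_le`).

The programs are verified with loop invariants and a syntactic frame rule (`Cmd.frame_exec`,
`Cmd.exec_loop_induction`), which identify each run with a closed formula and a step count. -/

noncomputable section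

namespace ShuffledKDE

/-! ### Reasoning about programs -/

namespace Cmd

/-- Sequential composition of a list of programs. -/
def block : List Cmd → Cmd
  | [] => skip
  | [c] => c
  | c :: c' :: cs => seq c (block (c' :: cs))

/-- The natural-number registers that a program may write. -/
def natWrites : Cmd → List ℕ
  | natConst dst _ | natAdd dst _ _ | natSub dst _ _ | natLoad dst _ _ | natCeil dst _ => [dst]
  | seq c₁ c₂ | ifNatLt _ _ c₁ c₂ | ifRealLt _ _ c₁ c₂ => c₁.natWrites ++ c₂.natWrites
  | loop _ c => c.natWrites
  | _ => []

/-- The real registers that a program may write. -/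
def realWrites : Cmd → List ℕ
  | realConst dst _ | realPi dst | realOfNat dst _ | realBin _ dst _ _ | realUn _ dst _
  | realLoad dst _ _ => [dst]
  | seq c₁ c₂ | ifNatLt _ _ c₁ c₂ | ifRealLt _ _ c₁ c₂ => c₁.realWrites ++ c₂.realWrites
  | loop _ c => c.realWrites
  | _ => []

/-- The real arrays that a program may write. -/
def arrayWrites : Cmd → List ℕ
  | realStore arr _ _ => [arr]
  | seq c₁ c₂ | ifNatLt _ _ c₁ c₂ | ifRealLt _ _ c₁ c₂ => c₁.arrayWrites ++ c₂.arrayWrites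
  | loop _ c => c.arrayWrites
  | _ => []

/-- The program contains no output instruction and no write to an array of natural numbers. -/
def isQuiet : Cmd → Bool
  | natStore _ _ _ | send _ _ | publish _ => false
  | seq c₁ c₂ | ifNatLt _ _ c₁ c₂ | ifRealLt _ _ c₁ c₂ => c₁.isQuiet && c₂.isQuiet
  | loop _ c => c.isQuiet
  | _ => true

/-- The state `t` agrees with `s` wherever the program `c` does not write. -/
structure Frame (c : Cmd) (s t : State) : Prop where
  nreg : ∀ x, x ∉ c.natWrites → t.nreg x = s.nreg x
  rreg : ∀ x, x ∉ c.realWrites → t.rreg x = s.rreg x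
  rmem : ∀ a, a ∉ c.arrayWrites → t.rmem a = s.rmem a
  nmem : c.isQuiet → t.nmem = s.nmem
  sent : c.isQuiet → t.sent = s.sent
  published : c.isQuiet → t.published = s.published

theorem Frame.refl (c : Cmd) (s : State) : Frame c s s :=
  ⟨fun _ _ => rfl, fun _ _ => rfl, fun _ _ => rfl, fun _ => rfl, fun _ => rfl, fun _ => rfl⟩

theorem Frame.trans {c : Cmd} {s t u : State} (h : Frame c s t) (h' : Frame c t u) :
    Frame c s u :=
  ⟨fun x hx => (h'.nreg x hx).trans (h.nreg x hx), fun x hx => (h'.rreg x hx).trans (h.rreg x hx),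
    fun x hx => (h'.rmem x hx).trans (h.rmem x hx), fun hx => (h'.nmem hx).trans (h.nmem hx),
    fun hx => (h'.sent hx).trans (h.sent hx), fun hx => (h'.published hx).trans (h.published hx)⟩

theorem Frame.tick {c : Cmd} {s t : State} (h : Frame c s t) : Frame c s t.tick :=
  ⟨h.nreg, h.rreg, h.rmem, h.nmem, h.sent, h.published⟩

theorem Frame.of_tick {c : Cmd} {s t : State} (h : Frame c s.tick t) : Frame c s t :=
  ⟨h.nreg, h.rreg, h.rmem, h.nmem, h.sent, h.published⟩

theorem Frame.mono {c c' : Cmd} {s t : State} (h : Frame c s t)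
    (h₁ : c.natWrites ⊆ c'.natWrites) (h₂ : c.realWrites ⊆ c'.realWrites)
    (h₃ : c.arrayWrites ⊆ c'.arrayWrites) (h₄ : c'.isQuiet → c.isQuiet) : Frame c' s t :=
  ⟨fun x hx => h.nreg x fun h' => hx (h₁ h'), fun x hx => h.rreg x fun h' => hx (h₂ h'),
    fun x hx => h.rmem x fun h' => hx (h₃ h'), fun hx => h.nmem (h₄ hx),
    fun hx => h.sent (h₄ hx), fun hx => h.published (h₄ hx)⟩

/-- The write sets are computable lists of constants, so that later every "this register is
unchanged" is closed by `decide`, without unfolding the program. -/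
theorem frame_exec (c : Cmd) (s : State) : Frame c s (c.exec s) := by
  induction c generalizing s with
  | seq c₁ c₂ h₁ h₂ =>
    refine Frame.trans (t := c₁.exec s) ((h₁ s).mono ?_ ?_ ?_ ?_) ((h₂ _).mono ?_ ?_ ?_ ?_) <;>
      simp +contextual [natWrites, realWrites, arrayWrites, isQuiet]
  | ifNatLt a b c₁ c₂ h₁ h₂ =>
    simp only [exec]
    split_ifs
    · refine Frame.of_tick ((h₁ _).mono ?_ ?_ ?_ ?_) <;>
        simp +contextual [natWrites, realWrites, arrayWrites, isQuiet]
    · refine Frame.of_tick ((h₂ _).mono ?_ ?_ ?_ ?_) <;>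
        simp +contextual [natWrites, realWrites, arrayWrites, isQuiet]
  | ifRealLt a b c₁ c₂ h₁ h₂ =>
    simp only [exec]
    split_ifs
    · refine Frame.of_tick ((h₁ _).mono ?_ ?_ ?_ ?_) <;>
        simp +contextual [natWrites, realWrites, arrayWrites, isQuiet]
    · refine Frame.of_tick ((h₂ _).mono ?_ ?_ ?_ ?_) <;>
        simp +contextual [natWrites, realWrites, arrayWrites, isQuiet]
  | loop count body h =>
    simp only [exec]
    generalize s.nreg count = k
    have key : ∀ t, Frame body t ((fun t => body.exec (State.tick t))^[k] t) := by
      induction k with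
      | zero => exact fun t => Frame.refl _ _
      | succ k ih =>
        intro t
        rw [Function.iterate_succ_apply']
        exact (ih t).trans ((h _).of_tick)
    exact (key s.tick).of_tick.mono (by simp [natWrites]) (by simp [realWrites])
      (by simp [arrayWrites]) (by simp [isQuiet])
  | _ =>
    refine ⟨?_, ?_, ?_, ?_, ?_, ?_⟩ <;>
      simp +contextual [exec, natWrites, realWrites, arrayWrites, isQuiet, State.tick, State.setNat,
        State.setReal, State.storeNat, State.storeReal, Function.update_of_ne]

/-- Reasoning about a loop by an invariant. -/
theorem exec_loop_induction {count : ℕ} {body : Cmd} {s : State} (P : ℕ → State → Prop)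
    (h₀ : P 0 s.tick)
    (hs : ∀ i t, i < s.nreg count → Frame body s t → P i t → P (i + 1) (body.exec t.tick)) :
    P (s.nreg count) ((loop count body).exec s) := by
  have key : ∀ k, k ≤ s.nreg count →
      Frame body s ((fun t => body.exec (State.tick t))^[k] s.tick) ∧
        P k ((fun t => body.exec (State.tick t))^[k] s.tick) := by
    intro k
    -- The frame is carried along with the invariant, so an invariant need only mention what the
    -- body changes.
    induction k with
    | zero => exact fun _ => ⟨(Frame.refl _ s).tick, h₀⟩
    | succ k ih =>
      intro hk
      obtain ⟨ih₁, ih₂⟩ := ih (by omega)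
      rw [Function.iterate_succ_apply']
      exact ⟨ih₁.trans (frame_exec _ _).of_tick, hs k _ (by omega) ih₁ ih₂⟩
  exact (key _ le_rfl).2

theorem exec_seq (c₁ c₂ : Cmd) (s : State) : (seq c₁ c₂).exec s = c₂.exec (c₁.exec s) := rfl

theorem exec_ifNatLt_pos {a b : ℕ} {s : State} (h : s.nreg a < s.nreg b) (c₁ c₂ : Cmd) :
    (ifNatLt a b c₁ c₂).exec s = c₁.exec s.tick := if_pos h

theorem exec_ifNatLt_neg {a b : ℕ} {s : State} (h : ¬ s.nreg a < s.nreg b) (c₁ c₂ : Cmd) :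
    (ifNatLt a b c₁ c₂).exec s = c₂.exec s.tick := if_neg h

theorem exec_ifRealLt_pos {a b : ℕ} {s : State} (h : s.rreg a < s.rreg b) (c₁ c₂ : Cmd) :
    (ifRealLt a b c₁ c₂).exec s = c₁.exec s.tick := if_pos h

theorem exec_ifRealLt_neg {a b : ℕ} {s : State} (h : ¬ s.rreg a < s.rreg b) (c₁ c₂ : Cmd) :
    (ifRealLt a b c₁ c₂).exec s = c₂.exec s.tick := if_neg h

end Cmd

/-! ### Fields of updated states -/

@[simp] theorem State.tick_nreg (s : State) : s.tick.nreg = s.nreg := rfl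
@[simp] theorem State.tick_rreg (s : State) : s.tick.rreg = s.rreg := rfl
@[simp] theorem State.tick_nmem (s : State) : s.tick.nmem = s.nmem := rfl
@[simp] theorem State.tick_rmem (s : State) : s.tick.rmem = s.rmem := rfl
@[simp] theorem State.tick_sent (s : State) : s.tick.sent = s.sent := rfl
@[simp] theorem State.tick_published (s : State) : s.tick.published = s.published := rfl
@[simp] theorem State.tick_time (s : State) : s.tick.time = s.time + 1 := rfl

@[simp] theorem State.setNat_nreg (s : State) (x v : ℕ) :
    (s.setNat x v).nreg = Function.update s.nreg x v := rfl
@[simp] theorem State.setNat_rreg (s : State) (x v : ℕ) : (s.setNat x v).rreg = s.rreg := rfl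
@[simp] theorem State.setNat_nmem (s : State) (x v : ℕ) : (s.setNat x v).nmem = s.nmem := rfl
@[simp] theorem State.setNat_rmem (s : State) (x v : ℕ) : (s.setNat x v).rmem = s.rmem := rfl
@[simp] theorem State.setNat_sent (s : State) (x v : ℕ) : (s.setNat x v).sent = s.sent := rfl
@[simp] theorem State.setNat_published (s : State) (x v : ℕ) :
    (s.setNat x v).published = s.published := rfl
@[simp] theorem State.setNat_time (s : State) (x v : ℕ) : (s.setNat x v).time = s.time := rfl

@[simp] theorem State.setReal_nreg (s : State) (x : ℕ) (v : ℝ) :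
    (s.setReal x v).nreg = s.nreg := rfl
@[simp] theorem State.setReal_rreg (s : State) (x : ℕ) (v : ℝ) :
    (s.setReal x v).rreg = Function.update s.rreg x v := rfl
@[simp] theorem State.setReal_nmem (s : State) (x : ℕ) (v : ℝ) :
    (s.setReal x v).nmem = s.nmem := rfl
@[simp] theorem State.setReal_rmem (s : State) (x : ℕ) (v : ℝ) :
    (s.setReal x v).rmem = s.rmem := rfl
@[simp] theorem State.setReal_sent (s : State) (x : ℕ) (v : ℝ) :
    (s.setReal x v).sent = s.sent := rfl
@[simp] theorem State.setReal_published (s : State) (x : ℕ) (v : ℝ) :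
    (s.setReal x v).published = s.published := rfl
@[simp] theorem State.setReal_time (s : State) (x : ℕ) (v : ℝ) :
    (s.setReal x v).time = s.time := rfl

@[simp] theorem State.storeReal_nreg (s : State) (a i : ℕ) (v : ℝ) :
    (s.storeReal a i v).nreg = s.nreg := rfl
@[simp] theorem State.storeReal_rreg (s : State) (a i : ℕ) (v : ℝ) :
    (s.storeReal a i v).rreg = s.rreg := rfl
@[simp] theorem State.storeReal_nmem (s : State) (a i : ℕ) (v : ℝ) :
    (s.storeReal a i v).nmem = s.nmem := rfl
@[simp] theorem State.storeReal_rmem (s : State) (a i : ℕ) (v : ℝ) :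
    (s.storeReal a i v).rmem = Function.update s.rmem a (Function.update (s.rmem a) i v) := rfl
@[simp] theorem State.storeReal_sent (s : State) (a i : ℕ) (v : ℝ) :
    (s.storeReal a i v).sent = s.sent := rfl
@[simp] theorem State.storeReal_published (s : State) (a i : ℕ) (v : ℝ) :
    (s.storeReal a i v).published = s.published := rfl
@[simp] theorem State.storeReal_time (s : State) (a i : ℕ) (v : ℝ) :
    (s.storeReal a i v).time = s.time := rfl

/-! ### The number of protocol instances -/

/-- The binary logarithm of the number of instances: the least `l` with `100 / α² ≤ 2 ^ l`. -/
def levels (α : ℝ) : ℕ := Nat.clog 2 ⌈100 / (α * α)⌉₊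

/-- The number of protocol instances for target error `α < 1`. -/
def instances (α : ℝ) : ℕ := 2 ^ levels α

/-- Register 5 holds the bound to be reached and register 6 the constant 1. -/
def doubleStep : Cmd := .ifNatLt 3 5 (.block [.natAdd 3 3 3, .natAdd 4 4 6]) .skip

/-- Computes the number of instances in natural register 3 and its logarithm in register 4. -/
def countInstances : Cmd := .block
  [.realConst 5 100, .realBin .mul 6 3 3, .realBin .div 5 5 6, .natCeil 5 5, .natConst 3 1,
    .natConst 4 0, .loop 5 doubleStep]

/-- There are only counted loops, so the doubling is attempted as many times as the bound itself,
which is more than enough; it saturates after `Nat.clog` rounds, hence the `min` in the invariant.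
The superfluous rounds cost `O(1/α²)` steps, which is affordable. -/
theorem exec_doubleStep_loop (s : State) (h₃ : s.nreg 3 = 1) (h₄ : s.nreg 4 = 0)
    (h₆ : s.nreg 6 = 1) :
    ((Cmd.loop 5 doubleStep).exec s).nreg 3 = 2 ^ Nat.clog 2 (s.nreg 5) ∧
      ((Cmd.loop 5 doubleStep).exec s).nreg 4 = Nat.clog 2 (s.nreg 5) ∧
      ((Cmd.loop 5 doubleStep).exec s).time ≤ s.time + 1 + s.nreg 5 * 4 := by
  have key := Cmd.exec_loop_induction (count := 5) (body := doubleStep) (s := s)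
    (fun i t => t.nreg 3 = 2 ^ min i (Nat.clog 2 (s.nreg 5)) ∧
      t.nreg 4 = min i (Nat.clog 2 (s.nreg 5)) ∧ t.time ≤ s.time + 1 + i * 4)
    (by simp [h₃, h₄]) (by
      rintro i t hi hF ⟨g₃, g₄, gt⟩
      have g₅ : t.nreg 5 = s.nreg 5 := hF.nreg 5 (by decide)
      have g₆ : t.nreg 6 = 1 := (hF.nreg 6 (by decide)).trans h₆
      have hlt : t.nreg 3 < t.nreg 5 ↔ i < Nat.clog 2 (s.nreg 5) := by
        rw [g₃, g₅, ← Nat.lt_clog_iff_pow_lt (by norm_num)]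
        simp
      by_cases h : t.nreg 3 < t.nreg 5
      · have h' := hlt.1 h
        have e₁ : min i (Nat.clog 2 (s.nreg 5)) = i := by omega
        have e₂ : min (i + 1) (Nat.clog 2 (s.nreg 5)) = i + 1 := by omega
        rw [e₁] at g₃ g₄
        rw [doubleStep, Cmd.exec_ifNatLt_pos (s := t.tick) h]
        simp [Cmd.exec, Cmd.block, e₂, g₃, g₄, g₆]
        exact ⟨by rw [pow_succ]; ring, by omega⟩
      · have h' := mt hlt.2 h
        have e₂ : min (i + 1) (Nat.clog 2 (s.nreg 5)) = min i (Nat.clog 2 (s.nreg 5)) := by omega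
        rw [doubleStep, Cmd.exec_ifNatLt_neg (s := t.tick) h]
        simp [Cmd.exec, e₂, g₃, g₄]
        omega)
  have hc : Nat.clog 2 (s.nreg 5) ≤ s.nreg 5 :=
    Nat.clog_le_of_le_pow (Nat.lt_two_pow_self).le
  simpa [Nat.min_eq_right hc] using key

theorem exec_countInstances (s : State) (h₆ : s.nreg 6 = 1) :
    (countInstances.exec s).nreg 3 = instances (s.rreg 3) ∧
      (countInstances.exec s).nreg 4 = levels (s.rreg 3) ∧
      (countInstances.exec s).time ≤ s.time + 7 + 5 * ⌈100 / (s.rreg 3 * s.rreg 3)⌉₊ := by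
  simp only [countInstances, Cmd.block, Cmd.exec_seq]
  have key := exec_doubleStep_loop ((Cmd.natConst 4 0).exec ((Cmd.natConst 3 1).exec
    ((Cmd.natCeil 5 5).exec ((Cmd.realBin .div 5 5 6).exec ((Cmd.realBin .mul 6 3 3).exec
      ((Cmd.realConst 5 100).exec s)))))) (by simp [Cmd.exec])
      (by simp [Cmd.exec]) (by simp [Cmd.exec, h₆])
  refine ⟨key.1.trans ?_, key.2.1.trans ?_, key.2.2.trans ?_⟩
  · simp [Cmd.exec, BinOp.eval, instances, levels]
  · simp [Cmd.exec, BinOp.eval, levels]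
  · simp [Cmd.exec, BinOp.eval]
    omega

/-! ### Random Fourier features of a count sketch -/

/-- One step of the binary expansion of the first component. -/
def hashStep (p : ℝ × ℕ) : ℝ × ℕ :=
  open Classical in
  if p.1 + p.1 < 1 then (p.1 + p.1, p.2 + p.2) else (p.1 + p.1 - 1, p.2 + p.2 + 1)

/-- The number formed by the first `l` binary digits of `u`. -/
def bucket (l : ℕ) (u : ℝ) : ℕ := (hashStep^[l] (u, 0)).2

/-- The cell of the sketch to which coordinate `k` is added, given the random number `u`. -/
def sketchCell (I l d k : ℕ) (u : ℝ) : ℕ := if I < d then bucket l u else k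

/-- `x` with a sign that depends on the random number `v`. -/
def signed (v x : ℝ) : ℝ := open Classical in if v < 1 / 2 then x else -x

/-- The sketch of the first `k` coordinates of `x`. -/
def sketch (I l d : ℕ) (pub x : ℕ → ℝ) : ℕ → ℕ → ℝ
  | 0 => fun _ => 0
  | k + 1 =>
    Function.update (sketch I l d pub x k) (sketchCell I l d k (pub (2 * k)))
      (sketch I l d pub x k (sketchCell I l d k (pub (2 * k))) + signed (pub (2 * k + 1)) (x k))

/-- The dimension of the sketch. -/
def sketchDim (I d : ℕ) : ℕ := if I < d then I else d

/-- The Box–Muller transform, scaled to variance `2`. -/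
def boxMuller (u v : ℝ) : ℝ := 2 * (√(-Real.log u) * Real.cos (2 * Real.pi * v))

/-- The place on the public tape where the randomness of instance `j` starts. -/
def blockStart (I d j : ℕ) : ℕ := 2 * d + j * (2 * sketchDim I d + 1)

/-- The value of the `j`-th random Fourier feature at the point `x`. -/
def feature (I l d : ℕ) (pub x : ℕ → ℝ) (j : ℕ) : ℝ :=
  Real.cos (∑ i ∈ Finset.range (sketchDim I d),
    boxMuller (pub (blockStart I d j + 2 * i)) (pub (blockStart I d j + 2 * i + 1))
      * sketch I l d pub x d i
    + 2 * Real.pi * pub (blockStart I d j + 2 * sketchDim I d))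

/-! ### The program that computes the features -/

/-- Register conventions from here on. Natural registers: 3 is the number of instances, 4 its
logarithm, 6 the constant 1, 8 the position on the public tape, 9 a running index, 13 is never
written and stays 0. Real registers: 4 is the constant 1, 11 is 1/2, 13 is 2π, 14 is 2, 17 is never
written and stays 0. Real array 4 holds the sketch and array 5 the features. -/
def hashBody : Cmd := .block
  [.realBin .add 7 7 7, .natAdd 10 10 10,
    .ifRealLt 7 4 .skip (.block [.realBin .sub 7 7 4, .natAdd 10 10 6])]

def readPair : Cmd := .block
  [.realLoad 7 0 8, .natAdd 8 8 6, .realLoad 8 0 8, .natAdd 8 8 6]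

/-- Adding register 13, which is 0, is a copy. Hashing is skipped when the dimension is at most the
number of instances. -/
def computeCell : Cmd :=
  .ifNatLt 3 1 (.seq (.natConst 10 0) (.loop 4 hashBody)) (.natAdd 10 9 13)

def addToCell : Cmd := .block
  [.realLoad 10 2 9, .realLoad 9 4 10,
    .ifRealLt 8 11 (.realBin .add 9 9 10) (.realBin .sub 9 9 10), .realStore 4 10 9,
    .natAdd 9 9 6]

def sketchBody : Cmd := .seq readPair (.seq computeCell addToCell)

/-- Subtracting from real register 17, which is 0, negates the logarithm; real register 12
accumulates the inner product. -/
def gaussBody : Cmd := .block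
  [.realLoad 7 0 8, .natAdd 8 8 6, .realLoad 8 0 8, .natAdd 8 8 6, .realUn .log 7 7,
    .realBin .sub 7 17 7, .realUn .sqrt 7 7, .realBin .mul 8 13 8, .realUn .cos 8 8,
    .realBin .mul 7 7 8, .realBin .mul 7 14 7, .realLoad 9 4 11, .realBin .mul 7 7 9,
    .realBin .add 12 12 7, .natAdd 11 11 6]

def featureEnd : Cmd := .block
  [.realLoad 7 0 8, .natAdd 8 8 6, .realBin .mul 7 13 7, .realBin .add 12 12 7,
    .realUn .cos 12 12, .realStore 5 9 12, .natAdd 9 9 6]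

def featureBody : Cmd :=
  .seq (.block [.natConst 11 0, .realConst 12 0]) (.seq (.loop 7 gaussBody) featureEnd)

def featureSetup : Cmd := .block
  [.natConst 8 0, .natConst 9 0, .realConst 11 (1 / 2), .realPi 13, .realConst 14 2,
    .realBin .mul 13 14 13, .ifNatLt 3 1 (.natAdd 7 3 13) (.natAdd 7 1 13)]

/-- Stores the features of the point in array 2 into array 5. -/
def computeFeatures : Cmd :=
  .seq featureSetup (.seq (.loop 1 sketchBody) (.seq (.natConst 9 0) (.loop 3 featureBody)))

/-- Real register 7 and natural register 10 together form the pair on which `hashStep` acts. -/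
theorem exec_hash_loop (s : State) (h₄ : s.rreg 4 = 1) (h₆ : s.nreg 6 = 1)
    (h₁₀ : s.nreg 10 = 0) :
    ((Cmd.loop 4 hashBody).exec s).nreg 10 = bucket (s.nreg 4) (s.rreg 7) ∧
      ((Cmd.loop 4 hashBody).exec s).time ≤ s.time + 1 + s.nreg 4 * 6 := by
  have key := Cmd.exec_loop_induction (count := 4) (body := hashBody) (s := s)
    (fun i t => (t.rreg 7, t.nreg 10) = hashStep^[i] (s.rreg 7, 0) ∧ t.time ≤ s.time + 1 + i * 6)
    (by simp [h₁₀]) (by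
      rintro i t hi hF ⟨g, gt⟩
      have g₄ : t.rreg 4 = 1 := (hF.rreg 4 (by decide)).trans h₄
      have g₆ : t.nreg 6 = 1 := (hF.nreg 6 (by decide)).trans h₆
      rw [Function.iterate_succ_apply', ← g]
      by_cases h : t.rreg 7 + t.rreg 7 < 1
      · simp only [hashBody, Cmd.block, Cmd.exec_seq]
        rw [Cmd.exec_ifRealLt_pos (by simpa [Cmd.exec, BinOp.eval, g₄] using h)]
        simp [Cmd.exec, BinOp.eval, hashStep, h]
        omega
      · simp only [hashBody, Cmd.block, Cmd.exec_seq]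
        rw [Cmd.exec_ifRealLt_neg (by simpa [Cmd.exec, BinOp.eval, g₄] using h)]
        simp [Cmd.exec, BinOp.eval, hashStep, h, g₄, g₆]
        omega)
  exact ⟨congrArg Prod.snd key.1, key.2⟩

theorem exec_readPair (s : State) (h₆ : s.nreg 6 = 1) :
    (readPair.exec s).rreg 7 = s.rmem 0 (s.nreg 8) ∧
      (readPair.exec s).rreg 8 = s.rmem 0 (s.nreg 8 + 1) ∧
      (readPair.exec s).nreg 8 = s.nreg 8 + 2 ∧ (readPair.exec s).time = s.time + 4 := by
  simp [readPair, Cmd.block, Cmd.exec, h₆]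

theorem exec_computeCell (s : State) (h₄ : s.rreg 4 = 1) (h₆ : s.nreg 6 = 1)
    (h₁₃ : s.nreg 13 = 0) :
    (computeCell.exec s).nreg 10
        = sketchCell (s.nreg 3) (s.nreg 4) (s.nreg 1) (s.nreg 9) (s.rreg 7) ∧
      (computeCell.exec s).time ≤ s.time + 3 + (if s.nreg 3 < s.nreg 1 then s.nreg 4 * 6 else 0)
      := by
  by_cases h : s.nreg 3 < s.nreg 1
  · rw [computeCell, Cmd.exec_ifNatLt_pos h, Cmd.exec_seq]
    have key := exec_hash_loop ((Cmd.natConst 10 0).exec s.tick) (by simp [Cmd.exec, h₄])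
      (by simp [Cmd.exec, h₆]) (by simp [Cmd.exec])
    refine ⟨key.1.trans ?_, key.2.trans ?_⟩
    · simp [Cmd.exec, sketchCell, h]
    · simp [Cmd.exec, h]
  · rw [computeCell, Cmd.exec_ifNatLt_neg h]
    simp [Cmd.exec, sketchCell, h, h₁₃]

theorem exec_addToCell (s : State) (h₆ : s.nreg 6 = 1) (h₁₁ : s.rreg 11 = 1 / 2) :
    (addToCell.exec s).rmem 4 = Function.update (s.rmem 4) (s.nreg 10)
        (s.rmem 4 (s.nreg 10) + signed (s.rreg 8) (s.rmem 2 (s.nreg 9))) ∧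
      (addToCell.exec s).nreg 9 = s.nreg 9 + 1 ∧ (addToCell.exec s).time = s.time + 6 := by
  simp only [addToCell, Cmd.block, Cmd.exec_seq]
  by_cases h : s.rreg 8 < 1 / 2
  · rw [Cmd.exec_ifRealLt_pos (by simpa [Cmd.exec, h₁₁] using h)]
    simp only [one_div] at h
    simp [Cmd.exec, BinOp.eval, signed, h, h₆]
  · rw [Cmd.exec_ifRealLt_neg (by simpa [Cmd.exec, h₁₁] using h)]
    simp only [one_div] at h
    simp [Cmd.exec, BinOp.eval, signed, h, h₆, sub_eq_add_neg]

theorem exec_sketch_loop (s : State) (h₄ : s.rreg 4 = 1) (h₆ : s.nreg 6 = 1)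
    (h₈ : s.nreg 8 = 0) (h₉ : s.nreg 9 = 0) (h₁₁ : s.rreg 11 = 1 / 2) (h₁₃ : s.nreg 13 = 0)
    (hm : s.rmem 4 = fun _ => 0) :
    ((Cmd.loop 1 sketchBody).exec s).rmem 4 =
        sketch (s.nreg 3) (s.nreg 4) (s.nreg 1) (s.rmem 0) (s.rmem 2) (s.nreg 1) ∧
      ((Cmd.loop 1 sketchBody).exec s).nreg 8 = 2 * s.nreg 1 ∧
      ((Cmd.loop 1 sketchBody).exec s).time ≤ s.time + 1 +
        s.nreg 1 * (14 + if s.nreg 3 < s.nreg 1 then s.nreg 4 * 6 else 0) := by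
  have key := Cmd.exec_loop_induction (count := 1) (body := sketchBody) (s := s)
    (fun k t => t.rmem 4 = sketch (s.nreg 3) (s.nreg 4) (s.nreg 1) (s.rmem 0) (s.rmem 2) k ∧
      t.nreg 8 = 2 * k ∧ t.nreg 9 = k ∧ t.time ≤ s.time + 1 +
        k * (14 + if s.nreg 3 < s.nreg 1 then s.nreg 4 * 6 else 0))
    (by simp [h₈, h₉, hm, sketch]) (by
      rintro k t hk hF ⟨gm, g₈, g₉, gt⟩
      have f₁ : t.nreg 1 = s.nreg 1 := hF.nreg 1 (by decide)
      have f₃ : t.nreg 3 = s.nreg 3 := hF.nreg 3 (by decide)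
      have f₄ : t.nreg 4 = s.nreg 4 := hF.nreg 4 (by decide)
      have f₆ : t.nreg 6 = 1 := (hF.nreg 6 (by decide)).trans h₆
      have f₁₃ : t.nreg 13 = 0 := (hF.nreg 13 (by decide)).trans h₁₃
      have fr₄ : t.rreg 4 = 1 := (hF.rreg 4 (by decide)).trans h₄
      have fr₁₁ : t.rreg 11 = 1 / 2 := (hF.rreg 11 (by decide)).trans h₁₁
      have fm₀ : t.rmem 0 = s.rmem 0 := hF.rmem 0 (by decide)
      have fm₂ : t.rmem 2 = s.rmem 2 := hF.rmem 2 (by decide)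
      simp only [sketchBody, Cmd.exec_seq]
      -- Each intermediate state is replaced by a variable once its specification and its frame are
      -- known, which keeps the terms small.
      obtain ⟨a₁, a₂, a₃, a₄⟩ := exec_readPair t.tick f₆
      have F₁ := Cmd.frame_exec readPair t.tick
      generalize readPair.exec t.tick = t₁ at *
      obtain ⟨b₁, b₂⟩ := exec_computeCell t₁ ((F₁.rreg 4 (by decide)).trans fr₄)
        ((F₁.nreg 6 (by decide)).trans f₆) ((F₁.nreg 13 (by decide)).trans f₁₃)
      have F₂ := Cmd.frame_exec computeCell t₁
      generalize computeCell.exec t₁ = t₂ at *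
      obtain ⟨c₁, c₂, c₃⟩ := exec_addToCell t₂
        ((F₂.nreg 6 (by decide)).trans ((F₁.nreg 6 (by decide)).trans f₆))
        ((F₂.rreg 11 (by decide)).trans ((F₁.rreg 11 (by decide)).trans fr₁₁))
      have F₃ := Cmd.frame_exec addToCell t₂
      have e₉ : t₂.nreg 9 = k :=
        (F₂.nreg 9 (by decide)).trans ((F₁.nreg 9 (by decide)).trans g₉)
      have e₃ : t₁.nreg 3 = s.nreg 3 := (F₁.nreg 3 (by decide)).trans f₃
      have e₁ : t₁.nreg 1 = s.nreg 1 := (F₁.nreg 1 (by decide)).trans f₁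
      have e₄ : t₁.nreg 4 = s.nreg 4 := (F₁.nreg 4 (by decide)).trans f₄
      have e₉' : t₁.nreg 9 = k := (F₁.nreg 9 (by decide)).trans g₉
      have e₈ : t₂.rreg 8 = s.rmem 0 (2 * k + 1) := by
        rw [F₂.rreg 8 (by decide), a₂]; simp [fm₀, g₈]
      have e₇ : t₁.rreg 7 = s.rmem 0 (2 * k) := by rw [a₁]; simp [fm₀, g₈]
      have em₄ : t₂.rmem 4 = t.rmem 4 := (F₂.rmem 4 (by decide)).trans (F₁.rmem 4 (by decide))
      have em₂ : t₂.rmem 2 = s.rmem 2 :=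
        (F₂.rmem 2 (by decide)).trans ((F₁.rmem 2 (by decide)).trans fm₂)
      refine ⟨?_, ?_, ?_, ?_⟩
      · rw [c₁, b₁, em₄, em₂, e₉, e₈, e₃, e₁, e₄, e₉', e₇, gm, sketch]
      · rw [F₃.nreg 8 (by decide), F₂.nreg 8 (by decide), a₃]; simp [g₈]; ring
      · rw [c₂, e₉]
      · rw [e₃, e₁, e₄] at b₂
        simp only [State.tick_time] at a₄
        rw [c₃, add_mul, one_mul]
        omega)
  exact ⟨key.1, key.2.1, key.2.2.2⟩

theorem exec_gaussBody (s : State) (h₆ : s.nreg 6 = 1) (h₁₃ : s.rreg 13 = 2 * Real.pi)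
    (h₁₄ : s.rreg 14 = 2) (h₁₇ : s.rreg 17 = 0) :
    (gaussBody.exec s).rreg 12 = s.rreg 12 +
        boxMuller (s.rmem 0 (s.nreg 8)) (s.rmem 0 (s.nreg 8 + 1)) * s.rmem 4 (s.nreg 11) ∧
      (gaussBody.exec s).nreg 8 = s.nreg 8 + 2 ∧ (gaussBody.exec s).nreg 11 = s.nreg 11 + 1 ∧
      (gaussBody.exec s).time = s.time + 15 := by
  simp [gaussBody, Cmd.block, Cmd.exec, BinOp.eval, UnOp.eval, h₆, h₁₃, h₁₄, h₁₇, boxMuller]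

theorem exec_gauss_loop (s : State) (h₆ : s.nreg 6 = 1) (h₁₁ : s.nreg 11 = 0)
    (h₁₂ : s.rreg 12 = 0) (h₁₃ : s.rreg 13 = 2 * Real.pi) (h₁₄ : s.rreg 14 = 2)
    (h₁₇ : s.rreg 17 = 0) :
    ((Cmd.loop 7 gaussBody).exec s).rreg 12 = ∑ i ∈ Finset.range (s.nreg 7),
        boxMuller (s.rmem 0 (s.nreg 8 + 2 * i)) (s.rmem 0 (s.nreg 8 + 2 * i + 1)) * s.rmem 4 i ∧
      ((Cmd.loop 7 gaussBody).exec s).nreg 8 = s.nreg 8 + 2 * s.nreg 7 ∧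
      ((Cmd.loop 7 gaussBody).exec s).time ≤ s.time + 1 + s.nreg 7 * 16 := by
  have key := Cmd.exec_loop_induction (count := 7) (body := gaussBody) (s := s)
    (fun k t => t.rreg 12 = ∑ i ∈ Finset.range k,
        boxMuller (s.rmem 0 (s.nreg 8 + 2 * i)) (s.rmem 0 (s.nreg 8 + 2 * i + 1)) * s.rmem 4 i ∧
      t.nreg 8 = s.nreg 8 + 2 * k ∧ t.nreg 11 = k ∧ t.time ≤ s.time + 1 + k * 16)
    (by simp [h₁₁, h₁₂]) (by
      rintro k t hk hF ⟨g₁₂, g₈, g₁₁, gt⟩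
      obtain ⟨a₁, a₂, a₃, a₄⟩ := exec_gaussBody t.tick ((hF.nreg 6 (by decide)).trans h₆)
        ((hF.rreg 13 (by decide)).trans h₁₃) ((hF.rreg 14 (by decide)).trans h₁₄)
        ((hF.rreg 17 (by decide)).trans h₁₇)
      have fm₀ : t.rmem 0 = s.rmem 0 := hF.rmem 0 (by decide)
      have fm₄ : t.rmem 4 = s.rmem 4 := hF.rmem 4 (by decide)
      refine ⟨?_, ?_, ?_, ?_⟩
      · rw [a₁, Finset.sum_range_succ]; simp [g₁₂, fm₀, fm₄, g₈, g₁₁]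
      · rw [a₂]; simp [g₈]; ring
      · rw [a₃]; simp [g₁₁]
      · rw [a₄]; simp; omega)
  exact ⟨key.1, key.2.1, key.2.2.2⟩

theorem exec_featureEnd (s : State) (h₆ : s.nreg 6 = 1) (h₁₃ : s.rreg 13 = 2 * Real.pi) :
    (featureEnd.exec s).rmem 5 = Function.update (s.rmem 5) (s.nreg 9)
        (Real.cos (s.rreg 12 + 2 * Real.pi * s.rmem 0 (s.nreg 8))) ∧
      (featureEnd.exec s).nreg 8 = s.nreg 8 + 1 ∧ (featureEnd.exec s).nreg 9 = s.nreg 9 + 1 ∧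
      (featureEnd.exec s).time = s.time + 7 := by
  simp [featureEnd, Cmd.block, Cmd.exec, BinOp.eval, UnOp.eval, h₆, h₁₃]

theorem exec_featureBody (s : State) (h₆ : s.nreg 6 = 1) (h₁₃ : s.rreg 13 = 2 * Real.pi)
    (h₁₄ : s.rreg 14 = 2) (h₁₇ : s.rreg 17 = 0) :
    (featureBody.exec s).rmem 5 = Function.update (s.rmem 5) (s.nreg 9)
        (Real.cos (∑ i ∈ Finset.range (s.nreg 7),
          boxMuller (s.rmem 0 (s.nreg 8 + 2 * i)) (s.rmem 0 (s.nreg 8 + 2 * i + 1)) * s.rmem 4 i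
          + 2 * Real.pi * s.rmem 0 (s.nreg 8 + 2 * s.nreg 7))) ∧
      (featureBody.exec s).nreg 8 = s.nreg 8 + (2 * s.nreg 7 + 1) ∧
      (featureBody.exec s).nreg 9 = s.nreg 9 + 1 ∧
      (featureBody.exec s).time ≤ s.time + 10 + s.nreg 7 * 16 := by
  simp only [featureBody, Cmd.exec_seq]
  set t := (Cmd.block [.natConst 11 0, .realConst 12 0]).exec s with ht
  have F := Cmd.frame_exec (Cmd.block [.natConst 11 0, .realConst 12 0]) s
  rw [← ht] at F
  have t₁₁ : t.nreg 11 = 0 := by simp [ht, Cmd.block, Cmd.exec]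
  have t₁₂ : t.rreg 12 = 0 := by simp [ht, Cmd.block, Cmd.exec]
  have tt : t.time = s.time + 2 := by simp [ht, Cmd.block, Cmd.exec]
  clear_value t
  have t₆ : t.nreg 6 = 1 := (F.nreg 6 (by decide)).trans h₆
  have t₁₃ : t.rreg 13 = 2 * Real.pi := (F.rreg 13 (by decide)).trans h₁₃
  obtain ⟨a₁, a₂, a₃⟩ := exec_gauss_loop t t₆ t₁₁ t₁₂ t₁₃
    ((F.rreg 14 (by decide)).trans h₁₄) ((F.rreg 17 (by decide)).trans h₁₇)
  have F' := Cmd.frame_exec (.loop 7 gaussBody) t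
  generalize (Cmd.loop 7 gaussBody).exec t = t' at *
  obtain ⟨b₁, b₂, b₃, b₄⟩ := exec_featureEnd t' ((F'.nreg 6 (by decide)).trans t₆)
    ((F'.rreg 13 (by decide)).trans t₁₃)
  have e₀ : t.rmem 0 = s.rmem 0 := F.rmem 0 (by decide)
  have e₄ : t.rmem 4 = s.rmem 4 := F.rmem 4 (by decide)
  have e₅ : t'.rmem 5 = s.rmem 5 := (F'.rmem 5 (by decide)).trans (F.rmem 5 (by decide))
  have e₀' : t'.rmem 0 = s.rmem 0 := (F'.rmem 0 (by decide)).trans e₀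
  have e₇ : t.nreg 7 = s.nreg 7 := F.nreg 7 (by decide)
  have e₈ : t.nreg 8 = s.nreg 8 := F.nreg 8 (by decide)
  have e₉ : t'.nreg 9 = s.nreg 9 := (F'.nreg 9 (by decide)).trans (F.nreg 9 (by decide))
  rw [e₀, e₄, e₇, e₈] at a₁
  rw [e₇, e₈] at a₂
  refine ⟨?_, ?_, ?_, ?_⟩
  · rw [b₁, a₁, a₂, e₅, e₀', e₉]
  · rw [b₂, a₂]; ring
  · rw [b₃, e₉]
  · rw [e₇] at a₃; omega

theorem exec_feature_loop (s : State) (h₆ : s.nreg 6 = 1) (h₉ : s.nreg 9 = 0)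
    (h₁₃ : s.rreg 13 = 2 * Real.pi) (h₁₄ : s.rreg 14 = 2) (h₁₇ : s.rreg 17 = 0) :
    (∀ j < s.nreg 3, ((Cmd.loop 3 featureBody).exec s).rmem 5 j =
        Real.cos (∑ i ∈ Finset.range (s.nreg 7),
          boxMuller (s.rmem 0 (s.nreg 8 + j * (2 * s.nreg 7 + 1) + 2 * i))
            (s.rmem 0 (s.nreg 8 + j * (2 * s.nreg 7 + 1) + 2 * i + 1)) * s.rmem 4 i
          + 2 * Real.pi * s.rmem 0 (s.nreg 8 + j * (2 * s.nreg 7 + 1) + 2 * s.nreg 7))) ∧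
      ((Cmd.loop 3 featureBody).exec s).time ≤ s.time + 1 + s.nreg 3 * (11 + s.nreg 7 * 16) := by
  have key := Cmd.exec_loop_induction (count := 3) (body := featureBody) (s := s)
    (fun k t => (∀ j < k, t.rmem 5 j =
        Real.cos (∑ i ∈ Finset.range (s.nreg 7),
          boxMuller (s.rmem 0 (s.nreg 8 + j * (2 * s.nreg 7 + 1) + 2 * i))
            (s.rmem 0 (s.nreg 8 + j * (2 * s.nreg 7 + 1) + 2 * i + 1)) * s.rmem 4 i
          + 2 * Real.pi * s.rmem 0 (s.nreg 8 + j * (2 * s.nreg 7 + 1) + 2 * s.nreg 7))) ∧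
      t.nreg 8 = s.nreg 8 + k * (2 * s.nreg 7 + 1) ∧ t.nreg 9 = k ∧
      t.time ≤ s.time + 1 + k * (11 + s.nreg 7 * 16))
    (by simp [h₉]) (by
      rintro k t hk hF ⟨gm, g₈, g₉, gt⟩
      obtain ⟨a₁, a₂, a₃, a₄⟩ := exec_featureBody t.tick ((hF.nreg 6 (by decide)).trans h₆)
        ((hF.rreg 13 (by decide)).trans h₁₃) ((hF.rreg 14 (by decide)).trans h₁₄)
        ((hF.rreg 17 (by decide)).trans h₁₇)
      have f₇ : t.nreg 7 = s.nreg 7 := hF.nreg 7 (by decide)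
      have fm₀ : t.rmem 0 = s.rmem 0 := hF.rmem 0 (by decide)
      have fm₄ : t.rmem 4 = s.rmem 4 := hF.rmem 4 (by decide)
      refine ⟨fun j hj => ?_, ?_, ?_, ?_⟩
      · rw [a₁]
        simp only [State.tick_nreg, State.tick_rmem, g₉]
        rcases Nat.lt_succ_iff_lt_or_eq.1 hj with h | rfl
        · rw [Function.update_of_ne h.ne, gm j h]
        · rw [Function.update_self, f₇, fm₀, fm₄, g₈]
      · rw [a₂]; simp only [State.tick_nreg, g₈, f₇]; ring
      · rw [a₃]; simp [g₉]
      · simp only [State.tick_nreg, State.tick_time, f₇] at a₄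
        rw [add_mul, one_mul]; omega)
  exact ⟨key.1, key.2.2.2⟩

theorem exec_featureSetup (s : State) (h₁₃ : s.nreg 13 = 0) :
    (featureSetup.exec s).nreg 7 = sketchDim (s.nreg 3) (s.nreg 1) ∧
      (featureSetup.exec s).nreg 8 = 0 ∧ (featureSetup.exec s).nreg 9 = 0 ∧
      (featureSetup.exec s).rreg 11 = 1 / 2 ∧ (featureSetup.exec s).rreg 13 = 2 * Real.pi ∧
      (featureSetup.exec s).rreg 14 = 2 ∧ (featureSetup.exec s).time = s.time + 8 := by
  simp only [featureSetup, Cmd.block, Cmd.exec_seq]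
  by_cases h : s.nreg 3 < s.nreg 1
  · rw [Cmd.exec_ifNatLt_pos (by simpa [Cmd.exec] using h)]
    simp [Cmd.exec, sketchDim, h, BinOp.eval, h₁₃]
  · rw [Cmd.exec_ifNatLt_neg (by simpa [Cmd.exec] using h)]
    simp [Cmd.exec, sketchDim, h, BinOp.eval, h₁₃]

/-- A bound on the number of steps of `computeFeatures`. -/
def featureTime (I l d : ℕ) : ℕ :=
  11 + d * (14 + if I < d then l * 6 else 0) + I * (11 + sketchDim I d * 16)

theorem exec_computeFeatures (s : State) (h₄ : s.rreg 4 = 1) (h₆ : s.nreg 6 = 1)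
    (h₁₃ : s.nreg 13 = 0) (h₁₇ : s.rreg 17 = 0) (hm : s.rmem 4 = fun _ => 0) :
    (∀ j < s.nreg 3, (computeFeatures.exec s).rmem 5 j =
        feature (s.nreg 3) (s.nreg 4) (s.nreg 1) (s.rmem 0) (s.rmem 2) j) ∧
      (computeFeatures.exec s).time ≤
        s.time + featureTime (s.nreg 3) (s.nreg 4) (s.nreg 1) := by
  simp only [computeFeatures, Cmd.exec_seq]
  obtain ⟨a₇, a₈, a₉, a₁₁, a₁₃, a₁₄, at'⟩ := exec_featureSetup s h₁₃
  have F := Cmd.frame_exec featureSetup s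
  generalize featureSetup.exec s = t at *
  have t₆ : t.nreg 6 = 1 := (F.nreg 6 (by decide)).trans h₆
  have t₃ : t.nreg 3 = s.nreg 3 := F.nreg 3 (by decide)
  have t₁ : t.nreg 1 = s.nreg 1 := F.nreg 1 (by decide)
  have t₄ : t.nreg 4 = s.nreg 4 := F.nreg 4 (by decide)
  have tm₀ : t.rmem 0 = s.rmem 0 := F.rmem 0 (by decide)
  have tm₂ : t.rmem 2 = s.rmem 2 := F.rmem 2 (by decide)
  obtain ⟨b₁, b₂, b₃⟩ := exec_sketch_loop t ((F.rreg 4 (by decide)).trans h₄) t₆ a₈ a₉ a₁₁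
    ((F.nreg 13 (by decide)).trans h₁₃) ((F.rmem 4 (by decide)).trans hm)
  rw [t₃, t₄, t₁, tm₀, tm₂] at b₁
  rw [t₁] at b₂
  rw [t₃, t₁, t₄] at b₃
  have G := Cmd.frame_exec (.loop 1 sketchBody) t
  generalize (Cmd.loop 1 sketchBody).exec t = u at *
  have H := Cmd.frame_exec (.natConst 9 0) u
  have hv₉ : ((Cmd.natConst 9 0).exec u).nreg 9 = 0 := by simp [Cmd.exec]
  have hvt : ((Cmd.natConst 9 0).exec u).time = u.time + 1 := by simp [Cmd.exec]
  generalize (Cmd.natConst 9 0).exec u = v at *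
  have v₃ : v.nreg 3 = s.nreg 3 :=
    (H.nreg 3 (by decide)).trans ((G.nreg 3 (by decide)).trans t₃)
  have v₇ : v.nreg 7 = sketchDim (s.nreg 3) (s.nreg 1) :=
    (H.nreg 7 (by decide)).trans ((G.nreg 7 (by decide)).trans a₇)
  have v₈ : v.nreg 8 = 2 * s.nreg 1 := (H.nreg 8 (by decide)).trans b₂
  have vm₀ : v.rmem 0 = s.rmem 0 :=
    (H.rmem 0 (by decide)).trans ((G.rmem 0 (by decide)).trans tm₀)
  have vm₄ := (H.rmem 4 (by decide)).trans b₁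
  obtain ⟨c₁, c₂⟩ := exec_feature_loop v
    ((H.nreg 6 (by decide)).trans ((G.nreg 6 (by decide)).trans t₆)) hv₉
    ((H.rreg 13 (by decide)).trans ((G.rreg 13 (by decide)).trans a₁₃))
    ((H.rreg 14 (by decide)).trans ((G.rreg 14 (by decide)).trans a₁₄))
    ((H.rreg 17 (by decide)).trans ((G.rreg 17 (by decide)).trans
      ((F.rreg 17 (by decide)).trans h₁₇)))
  rw [v₃, v₇] at c₂
  refine ⟨fun j hj => ?_, ?_⟩
  · rw [c₁ j (by rwa [v₃]), v₇, v₈, vm₀, vm₄]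
    rfl
  · simp only [featureTime]
    omega

/-! ### The protocol -/

/-- Runs `c` with the number of instances in register 3, but only if the target error is less
than `1`: otherwise the zero function is accurate enough. -/
def withInstances (c : Cmd) : Cmd := .block
  [.realConst 4 1, .natConst 6 1, .ifRealLt 3 4 (.seq countInstances c) .skip]

/-- Real register 12 is the probability of a one, natural register 12 the bit; real register 16
holds `4√n`, and the private coin of instance `j` is cell `j` of the private tape. -/
def sendBody : Cmd := .block
  [.realLoad 12 5 9, .realBin .div 12 12 16, .realBin .add 12 11 12, .realLoad 15 1 9,
    .ifRealLt 15 12 (.natConst 12 1) (.natConst 12 0), .send 9 12, .natAdd 9 9 6]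

/-- Randomized response for every feature. -/
def sendBits : Cmd :=
  .seq (.block [.realOfNat 16 0, .realUn .sqrt 16 16, .realConst 6 4, .realBin .mul 16 6 16,
    .natConst 9 0]) (.loop 3 sendBody)

def answerBody : Cmd := .block
  [.realLoad 12 5 9, .realLoad 15 3 9, .realBin .mul 12 12 15, .realBin .add 0 0 12,
    .natAdd 9 9 6]

/-- The final factor 2 (real register 14) is there because the product of two cosine features has
half the kernel as its mean. -/
def answer : Cmd :=
  .seq (.natConst 9 0) (.seq (.loop 3 answerBody)
    (.block [.realOfNat 16 3, .realBin .div 0 0 16, .realBin .mul 0 14 0]))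

/-- Votes count as `±1` (real register 4 is 1). The analyzer computes no sketch, so array 4 is free
for the tallies. -/
def tallyBody : Cmd := .block
  [.natLoad 10 0 9, .natLoad 12 1 9, .realLoad 12 4 10,
    .ifNatLt 13 12 (.realBin .add 12 12 4) (.realBin .sub 12 12 4), .realStore 4 10 12,
    .natAdd 9 9 6]

def publishBody : Cmd := .block
  [.realLoad 15 4 9, .realBin .mul 15 15 12, .publish 15, .natAdd 9 9 6]

/-- A user with feature `c` has the mean vote `c/(2√n)`, so the factor `2√n/n` turns a tally into an
unbiased estimate of the users' average feature. -/
def analyze : Cmd :=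
  .seq (.natConst 9 0) (.seq (.loop 2 tallyBody)
    (.seq (.block [.realOfNat 16 0, .realUn .sqrt 12 16, .realConst 14 2, .realBin .mul 12 14 12,
      .realBin .div 12 12 16, .natConst 9 0]) (.loop 3 publishBody)))

/-- Shuffled Gaussian kernel density estimation by random Fourier features of a count sketch and
randomized response. -/
def kdeProtocol : Protocol where
  randomizer := withInstances (.seq computeFeatures sendBits)
  analyzer := withInstances analyze
  query := withInstances (.seq computeFeatures answer)

/-- The probability with which a user with feature `c` sends the bit `1`. -/
def responseProb (n : ℕ) (c : ℝ) : ℝ := 1 / 2 + c / (4 * √n)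

/-- The contribution of a message to the tally of instance `j`. -/
def voteOf (j : ℕ) (m : Message) : ℝ := if m.label = j then if 0 < m.value then 1 else -1 else 0

/-- The state `t` is the one in which `c` is entered; its frame shows that the inputs and the zero
registers are still intact there. -/
theorem exec_withInstances_of_lt (c : Cmd) (s : State) (h : s.rreg 3 < 1) :
    ∃ t, (withInstances c).exec s = c.exec t ∧
      Cmd.Frame (.block [.realConst 4 1, .natConst 6 1, countInstances]) s t ∧
      t.nreg 3 = instances (s.rreg 3) ∧ t.nreg 4 = levels (s.rreg 3) ∧ t.nreg 6 = 1 ∧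
      t.rreg 4 = 1 ∧ t.time ≤ s.time + 10 + 5 * ⌈100 / (s.rreg 3 * s.rreg 3)⌉₊ := by
  set s₁ := (Cmd.natConst 6 1).exec ((Cmd.realConst 4 1).exec s) with hs₁
  refine ⟨countInstances.exec s₁.tick, ?_, ?_, ?_⟩
  · simp only [withInstances, Cmd.block, Cmd.exec_seq]
    rw [Cmd.exec_ifRealLt_pos (by simpa [Cmd.exec] using h), Cmd.exec_seq]
  · have F₁ : Cmd.Frame (.block [.realConst 4 1, .natConst 6 1, countInstances]) s s₁.tick := by
      have := Cmd.frame_exec (Cmd.block [.realConst 4 1, .natConst 6 1]) s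
      exact (this.mono (by decide) (by decide) (by decide) (by decide)).tick
    exact F₁.trans ((Cmd.frame_exec countInstances s₁.tick).mono (by decide) (by decide)
      (by decide) (by decide))
  · have h₆ : s₁.tick.nreg 6 = 1 := by simp [hs₁, Cmd.exec]
    have h₃ : s₁.tick.rreg 3 = s.rreg 3 := by simp [hs₁, Cmd.exec]
    have h₄ : s₁.tick.rreg 4 = 1 := by simp [hs₁, Cmd.exec]
    have ht : s₁.tick.time = s.time + 3 := by simp [hs₁, Cmd.exec]
    have F := Cmd.frame_exec countInstances s₁.tick
    obtain ⟨a, b, c⟩ := exec_countInstances s₁.tick h₆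
    rw [h₃] at a b c
    refine ⟨a, b, (F.nreg 6 (by decide)).trans h₆, (F.rreg 4 (by decide)).trans h₄, by omega⟩

theorem exec_withInstances_of_le (c : Cmd) (s : State) (h : 1 ≤ s.rreg 3) :
    ((withInstances c).exec s).sent = s.sent ∧ ((withInstances c).exec s).published = s.published ∧
      ((withInstances c).exec s).rreg 0 = s.rreg 0 ∧
      ((withInstances c).exec s).time = s.time + 3 := by
  simp only [withInstances, Cmd.block, Cmd.exec_seq]
  rw [Cmd.exec_ifRealLt_neg (by simp [Cmd.exec, h])]
  simp [Cmd.exec]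

theorem exec_sendBody (s : State) (h₆ : s.nreg 6 = 1) (h₁₁ : s.rreg 11 = 1 / 2) (n : ℕ)
    (h₁₆ : s.rreg 16 = 4 * √n) :
    (sendBody.exec s).sent = s.sent ++ [⟨s.nreg 9,
        open Classical in
        if s.rmem 1 (s.nreg 9) < responseProb n (s.rmem 5 (s.nreg 9)) then 1 else 0⟩] ∧
      (sendBody.exec s).nreg 9 = s.nreg 9 + 1 ∧ (sendBody.exec s).time = s.time + 8 := by
  simp only [sendBody, Cmd.block, Cmd.exec_seq]
  by_cases h : s.rmem 1 (s.nreg 9) < responseProb n (s.rmem 5 (s.nreg 9))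
  · rw [Cmd.exec_ifRealLt_pos
      (by simpa [Cmd.exec, BinOp.eval, h₁₁, h₁₆, responseProb] using h)]
    simp [Cmd.exec, h, h₆]
  · rw [Cmd.exec_ifRealLt_neg
      (by simpa [Cmd.exec, BinOp.eval, h₁₁, h₁₆, responseProb] using h)]
    simp [Cmd.exec, h, h₆]

theorem exec_sendBits (s : State) (h₆ : s.nreg 6 = 1) (h₁₁ : s.rreg 11 = 1 / 2) :
    (sendBits.exec s).sent = s.sent ++ (List.range (s.nreg 3)).map (fun j => ⟨j,
        open Classical in
        if s.rmem 1 j < responseProb (s.nreg 0) (s.rmem 5 j) then 1 else 0⟩) ∧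
      (sendBits.exec s).time ≤ s.time + 6 + s.nreg 3 * 9 := by
  simp only [sendBits, Cmd.exec_seq]
  set p := Cmd.block [.realOfNat 16 0, .realUn .sqrt 16 16, .realConst 6 4, .realBin .mul 16 6 16,
    .natConst 9 0] with hp
  have F := Cmd.frame_exec p s
  have t₁₆ : (p.exec s).rreg 16 = 4 * √(s.nreg 0) := by
    simp [hp, Cmd.block, Cmd.exec, BinOp.eval, UnOp.eval]
  have t₉ : (p.exec s).nreg 9 = 0 := by simp [hp, Cmd.block, Cmd.exec]
  have tt : (p.exec s).time = s.time + 5 := by simp [hp, Cmd.block, Cmd.exec]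
  generalize p.exec s = t at *
  have t₃ : t.nreg 3 = s.nreg 3 := F.nreg 3 (by decide)
  have key := Cmd.exec_loop_induction (count := 3) (body := sendBody) (s := t)
    (fun k u => u.sent = s.sent ++ (List.range k).map (fun j => ⟨j,
        open Classical in
        if s.rmem 1 j < responseProb (s.nreg 0) (s.rmem 5 j) then 1 else 0⟩) ∧
      u.nreg 9 = k ∧ u.time ≤ t.time + 1 + k * 9)
    (by simp [t₉, F.sent (by decide)]) (by
      rintro k u hk hF ⟨gs, g₉, gt⟩
      obtain ⟨a₁, a₂, a₃⟩ := exec_sendBody u.tick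
        ((hF.nreg 6 (by decide)).trans ((F.nreg 6 (by decide)).trans h₆))
        ((hF.rreg 11 (by decide)).trans ((F.rreg 11 (by decide)).trans h₁₁)) (s.nreg 0)
        ((hF.rreg 16 (by decide)).trans t₁₆)
      have m₁ : u.rmem 1 = s.rmem 1 := (hF.rmem 1 (by decide)).trans (F.rmem 1 (by decide))
      have m₅ : u.rmem 5 = s.rmem 5 := (hF.rmem 5 (by decide)).trans (F.rmem 5 (by decide))
      refine ⟨?_, ?_, ?_⟩
      · rw [a₁, List.range_succ]; simp [gs, g₉, m₁, m₅]
      · rw [a₂]; simp [g₉]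
      · rw [a₃]; simp; omega)
  rw [t₃] at key
  exact ⟨key.1, by have := key.2.2; omega⟩

theorem exec_answer (s : State) (h₀ : s.rreg 0 = 0) (h₆ : s.nreg 6 = 1) (h₁₄ : s.rreg 14 = 2) :
    (answer.exec s).rreg 0
        = 2 * ((∑ j ∈ Finset.range (s.nreg 3), s.rmem 5 j * s.rmem 3 j) / s.nreg 3) ∧
      (answer.exec s).time ≤ s.time + 5 + s.nreg 3 * 6 := by
  simp only [answer, Cmd.exec_seq]
  have F := Cmd.frame_exec (.natConst 9 0) s
  have t₉ : ((Cmd.natConst 9 0).exec s).nreg 9 = 0 := by simp [Cmd.exec]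
  have tt : ((Cmd.natConst 9 0).exec s).time = s.time + 1 := by simp [Cmd.exec]
  generalize (Cmd.natConst 9 0).exec s = t at *
  have t₃ : t.nreg 3 = s.nreg 3 := F.nreg 3 (by decide)
  have key := Cmd.exec_loop_induction (count := 3) (body := answerBody) (s := t)
    (fun k u => u.rreg 0 = ∑ j ∈ Finset.range k, s.rmem 5 j * s.rmem 3 j ∧
      u.nreg 9 = k ∧ u.time ≤ t.time + 1 + k * 6)
    (by simp [t₉, (F.rreg 0 (by decide)).trans h₀]) (by
      rintro k u hk hF ⟨gs, g₉, gt⟩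
      have m₃ : u.rmem 3 = s.rmem 3 := (hF.rmem 3 (by decide)).trans (F.rmem 3 (by decide))
      have m₅ : u.rmem 5 = s.rmem 5 := (hF.rmem 5 (by decide)).trans (F.rmem 5 (by decide))
      have f₆ : u.nreg 6 = 1 := (hF.nreg 6 (by decide)).trans ((F.nreg 6 (by decide)).trans h₆)
      rw [Finset.sum_range_succ, ← gs]
      simp [answerBody, Cmd.block, Cmd.exec, BinOp.eval, m₃, m₅, f₆, g₉]
      omega)
  have G := Cmd.frame_exec (.loop 3 answerBody) t
  rw [t₃] at key
  generalize (Cmd.loop 3 answerBody).exec t = u at *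
  have u₃ : u.nreg 3 = s.nreg 3 := (G.nreg 3 (by decide)).trans t₃
  have u₁₄ : u.rreg 14 = 2 :=
    (G.rreg 14 (by decide)).trans ((F.rreg 14 (by decide)).trans h₁₄)
  simp [Cmd.block, Cmd.exec, BinOp.eval, u₁₄, u₃, key.1]
  omega

theorem exec_tallyBody (s : State) (h₆ : s.nreg 6 = 1) (h₄ : s.rreg 4 = 1) (h₁₃ : s.nreg 13 = 0) :
    (tallyBody.exec s).rmem 4 = Function.update (s.rmem 4) (s.nmem 0 (s.nreg 9))
        (s.rmem 4 (s.nmem 0 (s.nreg 9)) + if 0 < s.nmem 1 (s.nreg 9) then 1 else -1) ∧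
      (tallyBody.exec s).nreg 9 = s.nreg 9 + 1 ∧ (tallyBody.exec s).time = s.time + 7 := by
  simp only [tallyBody, Cmd.block, Cmd.exec_seq]
  by_cases h : 0 < s.nmem 1 (s.nreg 9)
  · rw [Cmd.exec_ifNatLt_pos (by simpa [Cmd.exec, h₁₃] using h)]
    simp [Cmd.exec, BinOp.eval, h, h₆, h₄]
  · rw [Cmd.exec_ifNatLt_neg (by simpa [Cmd.exec, h₁₃] using h)]
    simp [Cmd.exec, BinOp.eval, h, h₆, h₄, sub_eq_add_neg]

/-- The tally is a sum over the messages, hence independent of the order that the shuffler chose. -/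
theorem exec_tally_loop (s : State) (msgs : List Message) (h₂ : s.nreg 2 = msgs.length)
    (h₀ : s.nmem 0 = fun j => (msgs.map Message.label).getD j 0)
    (h₁ : s.nmem 1 = fun j => (msgs.map Message.value).getD j 0)
    (h₆ : s.nreg 6 = 1) (h₄ : s.rreg 4 = 1) (h₉ : s.nreg 9 = 0) (h₁₃ : s.nreg 13 = 0)
    (hm : s.rmem 4 = fun _ => 0) :
    ((Cmd.loop 2 tallyBody).exec s).rmem 4 = (fun j => (msgs.map (voteOf j)).sum) ∧
      ((Cmd.loop 2 tallyBody).exec s).time ≤ s.time + 1 + msgs.length * 8 := by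
  have key := Cmd.exec_loop_induction (count := 2) (body := tallyBody) (s := s)
    (fun k t => t.rmem 4 = (fun j => ((msgs.take k).map (voteOf j)).sum) ∧ t.nreg 9 = k ∧
      t.time ≤ s.time + 1 + k * 8)
    (by simp [h₉, hm]) (by
      rintro k t hk hF ⟨gm, g₉, gt⟩
      rw [h₂] at hk
      obtain ⟨a₁, a₂, a₃⟩ := exec_tallyBody t.tick ((hF.nreg 6 (by decide)).trans h₆)
        ((hF.rreg 4 (by decide)).trans h₄) ((hF.nreg 13 (by decide)).trans h₁₃)
      have m : t.nmem = s.nmem := hF.nmem (by decide)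
      have hget : msgs.take (k + 1) = msgs.take k ++ [msgs[k]] := by simp
      refine ⟨?_, ?_, ?_⟩
      · rw [a₁]
        funext j
        rw [hget]
        by_cases hj : msgs[k].label = j
        · simp [m, h₀, h₁, g₉, gm, hk, hj, voteOf]
        · simp [m, h₀, h₁, g₉, gm, hk, hj, voteOf, Function.update_of_ne (Ne.symm hj)]
      · rw [a₂]; simp [g₉]
      · rw [a₃]; simp; omega)
  rw [h₂] at key
  exact ⟨by simpa using key.1, key.2.2⟩

theorem exec_publish_loop (s : State) (h₆ : s.nreg 6 = 1) (h₉ : s.nreg 9 = 0) :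
    ((Cmd.loop 3 publishBody).exec s).published =
        s.published ++ (List.range (s.nreg 3)).map (fun j => s.rmem 4 j * s.rreg 12) ∧
      ((Cmd.loop 3 publishBody).exec s).time ≤ s.time + 1 + s.nreg 3 * 5 := by
  have key := Cmd.exec_loop_induction (count := 3) (body := publishBody) (s := s)
    (fun k t => t.published = s.published ++ (List.range k).map (fun j => s.rmem 4 j * s.rreg 12) ∧
      t.nreg 9 = k ∧ t.time ≤ s.time + 1 + k * 5)
    (by simp [h₉]) (by
      rintro k t hk hF ⟨gp, g₉, gt⟩
      have m₄ : t.rmem 4 = s.rmem 4 := hF.rmem 4 (by decide)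
      have f₆ : t.nreg 6 = 1 := (hF.nreg 6 (by decide)).trans h₆
      have f₁₂ : t.rreg 12 = s.rreg 12 := hF.rreg 12 (by decide)
      rw [List.range_succ]
      simp [publishBody, Cmd.block, Cmd.exec, BinOp.eval, m₄, f₆, f₁₂, g₉, gp]
      omega)
  exact ⟨key.1, key.2.2⟩

theorem exec_analyze (s : State) (msgs : List Message) (h₂ : s.nreg 2 = msgs.length)
    (h₀ : s.nmem 0 = fun j => (msgs.map Message.label).getD j 0)
    (h₁ : s.nmem 1 = fun j => (msgs.map Message.value).getD j 0)
    (h₆ : s.nreg 6 = 1) (h₄ : s.rreg 4 = 1) (h₁₃ : s.nreg 13 = 0)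
    (hm : s.rmem 4 = fun _ => 0) :
    (analyze.exec s).published = s.published ++ (List.range (s.nreg 3)).map
        (fun j => (msgs.map (voteOf j)).sum * (2 * √(s.nreg 0) / s.nreg 0)) ∧
      (analyze.exec s).time ≤ s.time + 9 + msgs.length * 8 + s.nreg 3 * 5 := by
  simp only [analyze, Cmd.exec_seq]
  have F := Cmd.frame_exec (.natConst 9 0) s
  have t₉ : ((Cmd.natConst 9 0).exec s).nreg 9 = 0 := by simp [Cmd.exec]
  have tt : ((Cmd.natConst 9 0).exec s).time = s.time + 1 := by simp [Cmd.exec]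
  generalize (Cmd.natConst 9 0).exec s = t at *
  have tn : t.nmem = s.nmem := F.nmem (by decide)
  obtain ⟨a₁, a₂⟩ := exec_tally_loop t msgs ((F.nreg 2 (by decide)).trans h₂) (by rw [tn, h₀])
    (by rw [tn, h₁]) ((F.nreg 6 (by decide)).trans h₆) ((F.rreg 4 (by decide)).trans h₄) t₉
    ((F.nreg 13 (by decide)).trans h₁₃) ((F.rmem 4 (by decide)).trans hm)
  have G := Cmd.frame_exec (.loop 2 tallyBody) t
  generalize (Cmd.loop 2 tallyBody).exec t = u at *
  set p := Cmd.block [.realOfNat 16 0, .realUn .sqrt 12 16, .realConst 14 2, .realBin .mul 12 14 12,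
      .realBin .div 12 12 16, .natConst 9 0] with hp
  have u₀ : u.nreg 0 = s.nreg 0 := (G.nreg 0 (by decide)).trans (F.nreg 0 (by decide))
  have H := Cmd.frame_exec p u
  have v₁₂ : (p.exec u).rreg 12 = 2 * √(s.nreg 0) / s.nreg 0 := by
    simp [hp, Cmd.block, Cmd.exec, BinOp.eval, UnOp.eval, u₀]
  have v₉ : (p.exec u).nreg 9 = 0 := by simp [hp, Cmd.block, Cmd.exec]
  have vt : (p.exec u).time = u.time + 6 := by simp [hp, Cmd.block, Cmd.exec]
  generalize p.exec u = v at *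
  obtain ⟨b₁, b₂⟩ := exec_publish_loop v ((H.nreg 6 (by decide)).trans
    ((G.nreg 6 (by decide)).trans ((F.nreg 6 (by decide)).trans h₆))) v₉
  have v₃ : v.nreg 3 = s.nreg 3 := (H.nreg 3 (by decide)).trans
    ((G.nreg 3 (by decide)).trans (F.nreg 3 (by decide)))
  have v₄ : v.rmem 4 = u.rmem 4 := H.rmem 4 (by decide)
  have vp : v.published = s.published := (H.published (by decide)).trans
    ((G.published (by decide)).trans (F.published (by decide)))
  rw [v₃] at b₁ b₂
  exact ⟨by rw [b₁, vp, v₄, a₁, v₁₂], by omega⟩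

/-! ### The runs of the protocol -/

/-- The features of a point, for the protocol's choice of the number of instances. -/
def featureAt {d : ℕ} (α : ℝ) (pub : Tape) (x : Point d) (j : ℕ) : ℝ :=
  feature (instances α) (levels α) d (tapeArray pub) (pointArray x) j

/-- The bit that a user with point `x` sends in instance `j`. -/
def bitOf {d : ℕ} (n : ℕ) (α : ℝ) (pub r : Tape) (x : Point d) (j : ℕ) : Bool :=
  open Classical in decide ((r j : ℝ) < responseProb n (featureAt α pub x j))

/-- A bound on the number of steps of a user, and of a query. -/
def runTime (α : ℝ) (d : ℕ) : ℕ :=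
  16 + 5 * ⌈100 / (α * α)⌉₊ + featureTime (instances α) (levels α) d + instances α * 9

theorem userRun_of_lt {n d : ℕ} {θ : Params} (h : θ.alpha < 1) (pub r : Tape) (x : Point d) :
    (kdeProtocol.userRun n θ pub r x).sent = (List.range (instances θ.alpha)).map
        (fun j => ⟨j, (bitOf n θ.alpha pub r x j).toNat⟩) ∧
      (kdeProtocol.userRun n θ pub r x).time ≤ runTime θ.alpha d := by
  rw [Protocol.userRun, kdeProtocol]
  set s := initState n d θ (tapeArray pub) (tapeArray r) (pointArray x) [] [] 0 with hs
  obtain ⟨t, ht, F, t₃, t₄, t₆, tr₄, tt⟩ :=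
    exec_withInstances_of_lt (.seq computeFeatures sendBits) s h
  have h₃ : s.rreg 3 = θ.alpha := rfl
  rw [h₃] at t₃ t₄ tt
  rw [ht, Cmd.exec_seq]
  obtain ⟨a₁, a₂⟩ := exec_computeFeatures t tr₄ t₆ (F.nreg 13 (by decide))
    (F.rreg 17 (by decide)) (F.rmem 4 (by decide))
  have G := Cmd.frame_exec computeFeatures t
  -- This register is written by `featureSetup`, so the frame of the whole program says nothing
  -- about it; it survives the three later stages.
  have h₁₁ : (computeFeatures.exec t).rreg 11 = 1 / 2 := by
    simp only [computeFeatures, Cmd.exec_seq]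
    rw [(Cmd.frame_exec (.loop 3 featureBody) _).rreg 11 (by decide),
      (Cmd.frame_exec (.natConst 9 0) _).rreg 11 (by decide),
      (Cmd.frame_exec (.loop 1 sketchBody) _).rreg 11 (by decide)]
    exact (exec_featureSetup t (F.nreg 13 (by decide))).2.2.2.1
  generalize computeFeatures.exec t = u at *
  obtain ⟨b₁, b₂⟩ := exec_sendBits u ((G.nreg 6 (by decide)).trans t₆) h₁₁
  have u₃ : u.nreg 3 = instances θ.alpha := (G.nreg 3 (by decide)).trans t₃
  have u₀ : u.nreg 0 = n := (G.nreg 0 (by decide)).trans (F.nreg 0 (by decide))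
  have t₁ : t.nreg 1 = d := F.nreg 1 (by decide)
  have tm₀ : t.rmem 0 = tapeArray pub := F.rmem 0 (by decide)
  have tm₂ : t.rmem 2 = pointArray x := F.rmem 2 (by decide)
  have um₁ : u.rmem 1 = tapeArray r := (G.rmem 1 (by decide)).trans (F.rmem 1 (by decide))
  have us : u.sent = [] := (G.sent (by decide)).trans (F.sent (by decide))
  rw [t₃, t₄, t₁, tm₀, tm₂] at a₁
  refine ⟨?_, ?_⟩
  · rw [b₁, us, List.nil_append, u₃]
    refine List.map_congr_left fun j hj => ?_
    rw [a₁ j (by simpa using hj), um₁, u₀]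
    simp only [bitOf, featureAt, tapeArray]
    congr 1
    split_ifs with hlt <;> simp [hlt]
  · rw [t₃, t₄, t₁] at a₂
    rw [u₃] at b₂
    have h₀ : s.time = 0 := rfl
    rw [h₀] at tt
    simp only [runTime]
    omega

theorem userRun_of_le {n d : ℕ} {θ : Params} (h : 1 ≤ θ.alpha) (pub r : Tape) (x : Point d) :
    (kdeProtocol.userRun n θ pub r x).sent = [] ∧
      (kdeProtocol.userRun n θ pub r x).time = 3 := by
  have := exec_withInstances_of_le (.seq computeFeatures sendBits)
    (initState n d θ (tapeArray pub) (tapeArray r) (pointArray x) [] [] 0) h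
  exact ⟨this.1, this.2.2.2⟩

theorem analyzerRun_of_lt {n d : ℕ} {θ : Params} (h : θ.alpha < 1) (pub r : Tape)
    (msgs : List Message) :
    (kdeProtocol.analyzerRun n d θ pub r msgs).published = (List.range (instances θ.alpha)).map
        (fun j => (msgs.map (voteOf j)).sum * (2 * √n / n)) ∧
      (kdeProtocol.analyzerRun n d θ pub r msgs).time ≤
        19 + 5 * ⌈100 / (θ.alpha * θ.alpha)⌉₊ + msgs.length * 8 + instances θ.alpha * 5 := by
  rw [Protocol.analyzerRun, kdeProtocol]
  set s := initState n d θ (tapeArray pub) (tapeArray r) (fun _ => 0) [] msgs msgs.length with hs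
  obtain ⟨t, ht, F, t₃, t₄, t₆, tr₄, tt⟩ := exec_withInstances_of_lt analyze s h
  rw [ht]
  have tn : t.nmem = s.nmem := F.nmem (by decide)
  obtain ⟨a₁, a₂⟩ := exec_analyze t msgs (F.nreg 2 (by decide)) (by rw [tn]; rfl) (by rw [tn]; rfl)
    t₆ tr₄ (F.nreg 13 (by decide)) (F.rmem 4 (by decide))
  have t₀ : t.nreg 0 = n := F.nreg 0 (by decide)
  have tp : t.published = [] := F.published (by decide)
  rw [t₃, t₀, tp] at a₁
  have h₀ : s.time = 0 := rfl
  have h₃ : s.rreg 3 = θ.alpha := rfl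
  rw [h₀, h₃] at tt
  rw [t₃] at a₂
  exact ⟨a₁, by rw [h₃] at a₂; omega⟩

theorem analyzerRun_of_le {n d : ℕ} {θ : Params} (h : 1 ≤ θ.alpha) (pub r : Tape)
    (msgs : List Message) : (kdeProtocol.analyzerRun n d θ pub r msgs).time = 3 :=
  (exec_withInstances_of_le analyze
    (initState n d θ (tapeArray pub) (tapeArray r) (fun _ => 0) [] msgs msgs.length) h).2.2.2

theorem queryRun_of_lt {n d : ℕ} {θ : Params} (h : θ.alpha < 1) (pub : Tape) (desc : List ℝ)
    (y : Point d) :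
    (kdeProtocol.queryRun n θ pub desc y).rreg 0 =
        2 * ((∑ j ∈ Finset.range (instances θ.alpha),
          featureAt θ.alpha pub y j * desc.getD j 0) / instances θ.alpha) ∧
      (kdeProtocol.queryRun n θ pub desc y).time ≤ runTime θ.alpha d := by
  rw [Protocol.queryRun, kdeProtocol]
  set s := initState n d θ (tapeArray pub) (fun _ => 0) (pointArray y) desc [] desc.length with hs
  obtain ⟨t, ht, F, t₃, t₄, t₆, tr₄, tt⟩ :=
    exec_withInstances_of_lt (.seq computeFeatures answer) s h
  have h₃ : s.rreg 3 = θ.alpha := rfl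
  rw [h₃] at t₃ t₄ tt
  rw [ht, Cmd.exec_seq]
  obtain ⟨a₁, a₂⟩ := exec_computeFeatures t tr₄ t₆ (F.nreg 13 (by decide))
    (F.rreg 17 (by decide)) (F.rmem 4 (by decide))
  have G := Cmd.frame_exec computeFeatures t
  -- As for register 11 in the user's run: set by `featureSetup` and untouched afterwards.
  have h₁₄ : (computeFeatures.exec t).rreg 14 = 2 := by
    simp only [computeFeatures, Cmd.exec_seq]
    rw [(Cmd.frame_exec (.loop 3 featureBody) _).rreg 14 (by decide),
      (Cmd.frame_exec (.natConst 9 0) _).rreg 14 (by decide),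
      (Cmd.frame_exec (.loop 1 sketchBody) _).rreg 14 (by decide)]
    exact (exec_featureSetup t (F.nreg 13 (by decide))).2.2.2.2.2.1
  generalize computeFeatures.exec t = u at *
  obtain ⟨b₁, b₂⟩ := exec_answer u ((G.rreg 0 (by decide)).trans (F.rreg 0 (by decide)))
    ((G.nreg 6 (by decide)).trans t₆) h₁₄
  have u₃ : u.nreg 3 = instances θ.alpha := (G.nreg 3 (by decide)).trans t₃
  have t₁ : t.nreg 1 = d := F.nreg 1 (by decide)
  have tm₀ : t.rmem 0 = tapeArray pub := F.rmem 0 (by decide)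
  have tm₂ : t.rmem 2 = pointArray y := F.rmem 2 (by decide)
  have um₃ : u.rmem 3 = fun j => desc.getD j 0 :=
    (G.rmem 3 (by decide)).trans (F.rmem 3 (by decide))
  rw [t₃, t₄, t₁, tm₀, tm₂] at a₁
  refine ⟨?_, ?_⟩
  · rw [b₁, u₃, um₃]
    congr 2
    exact Finset.sum_congr rfl fun j hj => by rw [a₁ j (by simpa using hj)]; rfl
  · rw [t₃, t₄, t₁] at a₂
    rw [u₃] at b₂
    have h₀ : s.time = 0 := rfl
    rw [h₀] at tt
    simp only [runTime]
    omega

theorem queryRun_of_le {n d : ℕ} {θ : Params} (h : 1 ≤ θ.alpha) (pub : Tape) (desc : List ℝ)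
    (y : Point d) :
    (kdeProtocol.queryRun n θ pub desc y).rreg 0 = 0 ∧
      (kdeProtocol.queryRun n θ pub desc y).time = 3 := by
  have := exec_withInstances_of_le (.seq computeFeatures answer)
    (initState n d θ (tapeArray pub) (fun _ => 0) (pointArray y) desc [] desc.length) h
  exact ⟨this.2.2.1, this.2.2.2⟩

section Bits

/-! ### Counts of independent bits -/

/-- The probabilities of a bit with bias `p`. -/
def bern (p : ℝ) (b : Bool) : ℝ := if b then p else 1 - p

/-- The real number that a bit stands for. -/
def bitVal (b : Bool) : ℝ := if b then 1 else 0

@[simp] theorem bern_true (p : ℝ) : bern p true = p := rfl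
@[simp] theorem bern_false (p : ℝ) : bern p false = 1 - p := rfl
@[simp] theorem bitVal_true : bitVal true = 1 := rfl
@[simp] theorem bitVal_false : bitVal false = 0 := rfl

theorem bern_nonneg {p : ℝ} (h₀ : 0 ≤ p) (h₁ : p ≤ 1) (b : Bool) : 0 ≤ bern p b := by
  cases b <;> simp [h₀, h₁]

/-- Hoeffding's lemma for two points. -/
theorem two_point_exp_le {p : ℝ} (h₀ : 0 ≤ p) (h₁ : p ≤ 1) (a b : ℝ) :
    p * Real.exp a + (1 - p) * Real.exp b
      ≤ Real.exp (p * a + (1 - p) * b + (a - b) ^ 2 / 8) := by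
  set μ : Measure Bool :=
    ENNReal.ofReal p • Measure.dirac true + ENNReal.ofReal (1 - p) • Measure.dirac false with hμ
  have : IsProbabilityMeasure μ := ⟨by
    simp [hμ, ← ENNReal.ofReal_add h₀ (sub_nonneg.2 h₁)]⟩
  set X : Bool → ℝ := fun c => if c then a else b with hX
  have hint : ∀ f : Bool → ℝ, ∫ c, f c ∂μ = p * f true + (1 - p) * f false := by
    intro f
    rw [hμ, integral_add_measure (Integrable.of_finite.smul_measure ENNReal.ofReal_ne_top)
      (Integrable.of_finite.smul_measure ENNReal.ofReal_ne_top)]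
    simp [ENNReal.toReal_ofReal h₀, ENNReal.toReal_ofReal (sub_nonneg.2 h₁)]
  have key := (ProbabilityTheory.hasSubgaussianMGF_of_mem_Icc (μ := μ) (X := X) (a := min a b)
    (b := max a b) (measurable_of_finite X).aemeasurable
    (Filter.Eventually.of_forall fun c => by cases c <;> simp [hX])).mgf_le 1
  rw [ProbabilityTheory.mgf, hint, hint] at key
  simp only [hX, if_true, Bool.false_eq_true, if_false, one_mul] at key
  set m := p * a + (1 - p) * b
  rw [Real.exp_sub, Real.exp_sub, ← mul_div_assoc, ← mul_div_assoc, ← add_div,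
    div_le_iff₀ (Real.exp_pos _), ← Real.exp_add] at key
  refine key.trans (le_of_eq ?_)
  congr 1
  push_cast
  have : ‖max a b - min a b‖ = |a - b| := by
    rw [Real.norm_eq_abs, abs_of_nonneg (by simp), max_sub_min_eq_abs']
  rw [this]
  have := sq_abs (a - b)
  nlinarith

variable {ι : Type*} [Fintype ι]

/-- The probability of a family of independent bits with biases `p`. -/
def colWeight (p : ι → ℝ) (c : ι → Bool) : ℝ := ∏ u, bern (p u) (c u)

/-- The number of ones. -/
def ones (c : ι → Bool) : ℕ := ∑ u, (c u).toNat

theorem ones_le (c : ι → Bool) : ones c ≤ Fintype.card ι := by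
  refine (Finset.sum_le_card_nsmul Finset.univ _ 1 fun u _ => Bool.toNat_le _).trans ?_
  simp

theorem colWeight_pos {p : ι → ℝ} (h₀ : ∀ u, 0 < p u) (h₁ : ∀ u, p u < 1) (c : ι → Bool) :
    0 < colWeight p c :=
  Finset.prod_pos fun u _ => by cases c u <;> simp [h₀, h₁]

variable [DecidableEq ι]

/-- The law of the number of ones of independent bits with biases `p`. -/
def countWeight (p : ι → ℝ) (k : ℕ) : ℝ := ∑ c with ones c = k, colWeight p c

theorem countWeight_nonneg {p : ι → ℝ} (h₀ : ∀ u, 0 < p u) (h₁ : ∀ u, p u < 1) (k : ℕ) :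
    0 ≤ countWeight p k :=
  Finset.sum_nonneg fun c _ => (colWeight_pos h₀ h₁ c).le

theorem sum_prod_bool (g : ι → Bool → ℝ) :
    ∑ c : ι → Bool, ∏ u, g u (c u) = ∏ u, ∑ b, g u b := by
  rw [Finset.prod_univ_sum, Fintype.piFinset_univ]

/-- The correction by which the bits of the users `u₀` and `u` have the same conditional
expectation given their sum. -/
def swapBias (p₀ p : ℝ) : ℝ := (p₀ - p) / (p₀ * (1 - p) + p * (1 - p₀))

theorem abs_swapBias_le_one {p₀ p : ℝ} (h₀ : 0 < p₀) (h₀' : p₀ < 1) (h : 0 < p) (h' : p < 1) :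
    |swapBias p₀ p| ≤ 1 := by
  have hD : 0 < p₀ * (1 - p) + p * (1 - p₀) := by
    have := mul_pos h₀ (sub_pos.2 h'); have := mul_pos h (sub_pos.2 h₀'); linarith
  rw [swapBias, abs_div, abs_of_pos hD, div_le_one hD, abs_le]
  constructor <;> nlinarith [mul_pos h₀ (sub_pos.2 h'), mul_pos h (sub_pos.2 h₀')]

/-- Exchanging the bits of `u₀` and `u` preserves the count. On a pair of configurations with
unequal bits, the weights are in the ratio `p₀(1-p) : p(1-p₀)`, so the difference of the two bits
has the conditional mean `swapBias p₀ p`; when the bits are equal the difference is 0. Hence the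
summands cancel in pairs. -/
theorem sum_count_swap {p : ι → ℝ} (h₀ : ∀ u, 0 < p u) (h₁ : ∀ u, p u < 1) (u₀ u : ι) (k : ℕ) :
    ∑ c with ones c = k, colWeight p c * (bitVal (c u₀) - (bitVal (c u)
      + swapBias (p u₀) (p u) * if c u₀ = c u then 0 else 1)) = 0 := by
  rcases eq_or_ne u u₀ with rfl | hu
  · simp
  set f : (ι → Bool) → ℝ := fun c => colWeight p c * (bitVal (c u₀) - (bitVal (c u)
      + swapBias (p u₀) (p u) * if c u₀ = c u then 0 else 1)) with hf
  set φ : (ι → Bool) ≃ (ι → Bool) := (Equiv.swap u₀ u).arrowCongr (Equiv.refl Bool) with hφ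
  have hφa : ∀ c v, φ c v = c (Equiv.swap u₀ u v) := fun c v => by
    simp [hφ, Equiv.arrowCongr]
  have hones : ∀ c, ones (φ c) = ones c := fun c => by
    simp only [ones, hφa]
    exact Equiv.sum_comp (Equiv.swap u₀ u) fun v => (c v).toNat
  have hsplit : ∀ c, colWeight p c = bern (p u₀) (c u₀) * (bern (p u) (c u) *
      ∏ v ∈ (Finset.univ.erase u₀).erase u, bern (p v) (c v)) := fun c => by
    rw [Finset.mul_prod_erase (Finset.univ.erase u₀) (fun v => bern (p v) (c v))
      (by simp [hu]), Finset.mul_prod_erase _ (fun v => bern (p v) (c v)) (by simp), colWeight]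
  have hsum : ∑ c with ones c = k, f c = ∑ c with ones c = k, f (φ c) := by
    refine (Finset.sum_equiv φ (fun c => ?_) fun _ _ => rfl).symm
    simp [hones]
  have hzero : ∀ c, f c + f (φ c) = 0 := fun c => by
    have hrest : ∏ v ∈ (Finset.univ.erase u₀).erase u, bern (p v) (φ c v) =
        ∏ v ∈ (Finset.univ.erase u₀).erase u, bern (p v) (c v) :=
      Finset.prod_congr rfl fun v hv => by
        simp only [Finset.mem_erase, Finset.mem_univ, and_true] at hv
        rw [hφa, Equiv.swap_apply_of_ne_of_ne hv.2 hv.1]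
    simp only [hf]
    rw [hsplit c, hsplit (φ c), hrest, hφa, hφa, Equiv.swap_apply_left, Equiv.swap_apply_right]
    have hD : p u₀ * (1 - p u) + p u * (1 - p u₀) ≠ 0 := by
      have := mul_pos (h₀ u₀) (sub_pos.2 (h₁ u)); have := mul_pos (h₀ u) (sub_pos.2 (h₁ u₀))
      positivity
    generalize ∏ v ∈ (Finset.univ.erase u₀).erase u, bern (p v) (c v) = R
    have hκ : swapBias (p u₀) (p u) * (p u₀ * (1 - p u) + p u * (1 - p u₀)) = p u₀ - p u :=
      div_mul_cancel₀ _ hD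
    generalize swapBias (p u₀) (p u) = κ at hκ
    cases c u₀ <;> cases c u <;> simp
    · linear_combination -R * hκ
    · linear_combination -R * hκ
  have : ∑ c with ones c = k, f c + ∑ c with ones c = k, f c = 0 := by
    nth_rewrite 2 [hsum]
    rw [← Finset.sum_add_distrib]
    exact Finset.sum_eq_zero fun c _ => hzero c
  linarith

/-- A linear statistic that has the same conditional expectation, given the number of ones, as the
centred bit of `u₀`. -/
def swapStat (p : ι → ℝ) (u₀ : ι) (c : ι → Bool) : ℝ :=
  (∑ u, (bitVal (c u) + swapBias (p u₀) (p u) * if c u₀ = c u then 0 else 1)) / Fintype.card ι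
    - p u₀

/-- Averaging `sum_count_swap` over `u`. The gain is that a single bit, of constant size, is
replaced by an average of `n` nearly independent terms. -/
theorem sum_count_swapStat {p : ι → ℝ} (h₀ : ∀ u, 0 < p u) (h₁ : ∀ u, p u < 1) (u₀ : ι)
    (k : ℕ) :
    ∑ c with ones c = k, colWeight p c * swapStat p u₀ c =
      ∑ c with ones c = k, colWeight p c * (bitVal (c u₀) - p u₀) := by
  have : Nonempty ι := ⟨u₀⟩
  have hn : (Fintype.card ι : ℝ) ≠ 0 := by exact_mod_cast Fintype.card_ne_zero
  rw [← sub_eq_zero, ← Finset.sum_sub_distrib]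
  have : ∀ c : ι → Bool, colWeight p c * swapStat p u₀ c
      - colWeight p c * (bitVal (c u₀) - p u₀) =
      (-1 / Fintype.card ι) * ∑ u, colWeight p c * (bitVal (c u₀) - (bitVal (c u)
      + swapBias (p u₀) (p u) * if c u₀ = c u then 0 else 1)) := fun c => by
    rw [← Finset.mul_sum, Finset.sum_sub_distrib, Finset.sum_const, Finset.card_univ,
      nsmul_eq_mul, swapStat]
    field_simp
    ring
  rw [Finset.sum_congr rfl fun c _ => this c, ← Finset.mul_sum, Finset.sum_comm,
    Finset.sum_eq_zero fun u _ => sum_count_swap h₀ h₁ u₀ u k, mul_zero]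

/-- Given the bit `β` of `u₀`, the terms of the average are independent, and Hoeffding's lemma
bounds each by range 2, for a total of `s²/(2n)`. The remaining dependence on `β` is a two-point
variable of mean 0 and spread at most `2s/n`, and Hoeffding's lemma applies once more. The small
bias is needed for that spread. -/
theorem sum_exp_swapStat_le {p : ι → ℝ} {η : ℝ} (hη : 16 * Fintype.card ι * η ^ 2 ≤ 1)
    (hη₀ : 0 ≤ η) (hη₁ : η ≤ 1 / 4) (hp : ∀ u, |p u - 1 / 2| ≤ η) (u₀ : ι) (s : ℝ) :
    ∑ c, colWeight p c * Real.exp (s * swapStat p u₀ c)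
      ≤ Real.exp (s ^ 2 / Fintype.card ι) := by
  have : Nonempty ι := ⟨u₀⟩
  set n : ℝ := ((Fintype.card ι : ℕ) : ℝ) with hn
  have hn₁ : 1 ≤ n := by rw [hn]; exact_mod_cast Fintype.card_pos (α := ι)
  have hp₀ : ∀ u, 1 / 4 ≤ p u := fun u => by have := abs_le.1 (hp u); linarith
  have hp₁ : ∀ u, p u ≤ 3 / 4 := fun u => by have := abs_le.1 (hp u); linarith
  set κ : ι → ℝ := fun u => swapBias (p u₀) (p u) with hκ
  have hκ₁ : ∀ u, |κ u| ≤ 1 := fun u => abs_swapBias_le_one (by linarith [hp₀ u₀])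
    (by linarith [hp₁ u₀]) (by linarith [hp₀ u]) (by linarith [hp₁ u])
  -- the value and the mean of the summand of user `u` when the bit of `u₀` is `β`
  set val : Bool → ι → Bool → ℝ :=
    fun β u b => bitVal b + κ u * if β = b then 0 else 1 with hval
  set m : Bool → ι → ℝ := fun β u => p u * val β u true + (1 - p u) * val β u false with hm
  -- Summing over `β` with a factor that vanishes unless the bit of `u₀` is `β` turns the
  -- exponential into products over users.
  have hfac : ∀ c : ι → Bool, colWeight p c * Real.exp (s * swapStat p u₀ c) =
      ∑ β : Bool, Real.exp (-(s * p u₀)) * ∏ u, (if u = u₀ ∧ c u ≠ β then 0 else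
        bern (p u) (c u) * Real.exp (s / n * val β u (c u))) := by
    intro c
    rw [Finset.sum_eq_single (c u₀)]
    · have : ∀ u, (if u = u₀ ∧ c u ≠ c u₀ then 0 else
          bern (p u) (c u) * Real.exp (s / n * val (c u₀) u (c u))) =
          bern (p u) (c u) * Real.exp (s / n * val (c u₀) u (c u)) := fun u =>
        if_neg fun h => h.2 (by rw [h.1])
      simp only [this]
      rw [Finset.prod_mul_distrib, ← Real.exp_sum, ← Finset.mul_sum, mul_left_comm,
        ← Real.exp_add, colWeight]
      congr 2
      simp only [swapStat, hval, hκ, ← hn]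
      ring
    · intro β _ hβ
      rw [Finset.prod_eq_zero (Finset.mem_univ u₀), mul_zero]
      simp [hβ.symm]
    · simp
  have hsum : ∀ β u, ∑ b, (if u = u₀ ∧ b ≠ β then 0 else
      bern (p u) b * Real.exp (s / n * val β u b)) ≤
      if u = u₀ then bern (p u₀) β * Real.exp (s / n * bitVal β) else
        Real.exp (s / n * m β u + (s / n) ^ 2 / 2) := by
    intro β u
    by_cases hu : u = u₀
    · subst hu
      have hκ0 : κ u = 0 := by simp [hκ, swapBias]
      cases β <;> simp [hval, hκ0]
    · simp only [hu, false_and, if_false]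
      have h2 := two_point_exp_le (by linarith [hp₀ u] : 0 ≤ p u) (by linarith [hp₁ u])
        (s / n * val β u true) (s / n * val β u false)
      simp only [Fintype.sum_bool, bern_true, bern_false]
      refine h2.trans (Real.exp_le_exp.2 ?_)
      -- The difference is `1 ± κ u`, and `|κ u| ≤ 1`.
      have hd : (val β u true - val β u false) ^ 2 ≤ 4 := by
        have := abs_le.1 (hκ₁ u)
        cases β <;> simp [hval] <;> nlinarith
      have : (s / n * val β u true - s / n * val β u false) ^ 2 / 8 ≤ (s / n) ^ 2 / 2 := by
        rw [← mul_sub, mul_pow]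
        nlinarith [sq_nonneg (s / n)]
      simp only [hm]
      linarith
  have hnn : ∀ β u, 0 ≤ ∑ b, (if u = u₀ ∧ b ≠ β then 0 else
      bern (p u) b * Real.exp (s / n * val β u b)) := fun β u =>
    Finset.sum_nonneg fun b _ => by
      split_ifs
      · exact le_rfl
      · exact mul_nonneg (bern_nonneg (by linarith [hp₀ u]) (by linarith [hp₁ u]) _)
          (Real.exp_pos _).le
  set A : Bool → ℝ := fun β =>
    s / n * (bitVal β + ∑ u ∈ Finset.univ.erase u₀, m β u) - s * p u₀ with hA
  have hcard : ((Finset.univ.erase u₀).card : ℝ) = n - 1 := by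
    rw [Finset.card_erase_of_mem (Finset.mem_univ _), Finset.card_univ,
      Nat.cast_sub Fintype.card_pos, Nat.cast_one]
  have step : ∑ c, colWeight p c * Real.exp (s * swapStat p u₀ c) ≤
      (p u₀ * Real.exp (A true) + (1 - p u₀) * Real.exp (A false))
        * Real.exp (s ^ 2 / (2 * n)) := by
    rw [Finset.sum_congr rfl fun c _ => hfac c, Finset.sum_comm]
    have : ∀ β, ∑ c : ι → Bool, Real.exp (-(s * p u₀)) * ∏ u, (if u = u₀ ∧ c u ≠ β then 0 else
        bern (p u) (c u) * Real.exp (s / n * val β u (c u))) ≤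
        bern (p u₀) β * Real.exp (A β) * Real.exp (s ^ 2 / (2 * n)) := by
      intro β
      rw [← Finset.mul_sum, sum_prod_bool fun u b => if u = u₀ ∧ b ≠ β then 0 else
        bern (p u) b * Real.exp (s / n * val β u b)]
      refine (mul_le_mul_of_nonneg_left (Finset.prod_le_prod (fun u _ => hnn β u)
        fun u _ => hsum β u) (Real.exp_pos _).le).trans ?_
      rw [← Finset.mul_prod_erase _ _ (Finset.mem_univ u₀), if_pos rfl,
        Finset.prod_congr rfl fun u hu => if_neg (Finset.ne_of_mem_erase hu), ← Real.exp_sum,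
        Finset.sum_add_distrib, ← Finset.mul_sum, Finset.sum_const, nsmul_eq_mul, hcard]
      have hb : 0 ≤ bern (p u₀) β := bern_nonneg (by linarith [hp₀ u₀]) (by linarith [hp₁ u₀]) _
      rw [mul_assoc, mul_left_comm, mul_assoc (bern _ _)]
      refine mul_le_mul_of_nonneg_left ?_ hb
      rw [← Real.exp_add, ← Real.exp_add, ← Real.exp_add]
      refine Real.exp_le_exp.2 ?_
      have : (n - 1) * ((s / n) ^ 2 / 2) ≤ s ^ 2 / (2 * n) := by
        rw [div_pow, div_div, mul_div_assoc', div_le_div_iff₀ (by positivity) (by positivity)]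
        nlinarith [sq_nonneg s, mul_nonneg (sq_nonneg s) (by linarith : 0 ≤ n)]
      simp only [hA]
      linarith
    rw [Fintype.sum_bool]
    have h1 := this true
    have h2 := this false
    simp only [bern_true, bern_false] at h1 h2
    linarith
  refine step.trans ?_
  have htp := two_point_exp_le (by linarith [hp₀ u₀] : 0 ≤ p u₀) (by linarith [hp₁ u₀])
    (A true) (A false)
  -- The correction `κ u` makes each summand have mean `p u₀`, so the statistic is centred.
  have hmean : p u₀ * A true + (1 - p u₀) * A false = 0 := by
    have hu : ∀ u, p u₀ * m true u + (1 - p u₀) * m false u = p u₀ := fun u => by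
      have hD : p u₀ * (1 - p u) + p u * (1 - p u₀) ≠ 0 := by
        have := mul_pos (by linarith [hp₀ u₀] : 0 < p u₀) (by linarith [hp₁ u] : 0 < 1 - p u)
        have := mul_pos (by linarith [hp₀ u] : 0 < p u) (by linarith [hp₁ u₀] : 0 < 1 - p u₀)
        positivity
      simp [hm, hval, hκ, swapBias]
      field_simp
      ring
    have hs : p u₀ * ∑ u ∈ Finset.univ.erase u₀, m true u
        + (1 - p u₀) * ∑ u ∈ Finset.univ.erase u₀, m false u = (n - 1) * p u₀ := by
      rw [Finset.mul_sum, Finset.mul_sum, ← Finset.sum_add_distrib,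
        Finset.sum_congr rfl fun u _ => hu u, Finset.sum_const, nsmul_eq_mul, hcard]
    simp only [hA, bitVal_true, bitVal_false]
    have : s / n * (p u₀ + ((n - 1) * p u₀)) - s * p u₀ = 0 := by
      field_simp
      ring
    linear_combination this + s / n * hs
  -- Flipping `β` moves the term of `u₀` by 1, and the mean of the term of any other `u` by `κ u (1
  -- - 2 p u)`. Both factors are of order `η`, so with `η² ≤ 1/(16n)` the other users together
  -- contribute at most 1.
  have hdiff : (A true - A false) ^ 2 ≤ 4 * (s / n) ^ 2 := by
    have hu : ∀ u, m true u - m false u = κ u * (1 - 2 * p u) := fun u => by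
      simp [hm, hval]; ring
    have hκb : ∀ u, |κ u * (1 - 2 * p u)| ≤ 1 / n := fun u => by
      have hD : 3 / 8 ≤ p u₀ * (1 - p u) + p u * (1 - p u₀) := by
        nlinarith [mul_nonneg (sub_nonneg.2 (hp₀ u₀)) (sub_nonneg.2 (hp₁ u)),
          mul_nonneg (sub_nonneg.2 (hp₁ u₀)) (sub_nonneg.2 (hp₀ u))]
      have h1 : |p u₀ - p u| ≤ 2 * η := by
        have := abs_le.1 (hp u₀); have := abs_le.1 (hp u)
        rw [abs_le]; constructor <;> linarith
      have h2 : |1 - 2 * p u| ≤ 2 * η := by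
        have := abs_le.1 (hp u)
        rw [abs_le]; constructor <;> linarith
      have h3 : |κ u| ≤ 2 * η / (3 / 8) := by
        simp only [hκ, swapBias]
        rw [abs_div, abs_of_pos (by linarith : 0 < p u₀ * (1 - p u) + p u * (1 - p u₀))]
        exact div_le_div₀ (by positivity) h1 (by norm_num) hD
      rw [abs_mul, le_div_iff₀ (by linarith)]
      have := mul_le_mul h3 h2 (abs_nonneg _) (by positivity)
      have h4 : |κ u| * |1 - 2 * p u| ≤ 32 / 3 * η ^ 2 := by
        refine this.trans (le_of_eq ?_); ring
      nlinarith
    have hs : |∑ u ∈ Finset.univ.erase u₀, (m true u - m false u)| ≤ 1 := by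
      refine (Finset.abs_sum_le_sum_abs _ _).trans ?_
      refine (Finset.sum_le_card_nsmul _ _ (1 / n) fun u _ => by rw [hu]; exact hκb u).trans ?_
      rw [nsmul_eq_mul, hcard, mul_one_div, div_le_one (by linarith)]
      linarith
    rw [Finset.sum_sub_distrib] at hs
    have : A true - A false = s / n * (1 + (∑ u ∈ Finset.univ.erase u₀, m true u -
        ∑ u ∈ Finset.univ.erase u₀, m false u)) := by
      simp only [hA, bitVal_true, bitVal_false]; ring
    rw [this, mul_pow]
    generalize (∑ u ∈ Finset.univ.erase u₀, m true u -
        ∑ u ∈ Finset.univ.erase u₀, m false u) = x at hs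
    have := abs_le.1 hs
    have : (1 + x) ^ 2 ≤ 4 := by nlinarith
    nlinarith [sq_nonneg (s / n)]
  rw [hmean, zero_add] at htp
  refine (mul_le_mul_of_nonneg_right htp (Real.exp_pos _).le).trans ?_
  rw [← Real.exp_add]
  refine Real.exp_le_exp.2 ?_
  have : (s / n) ^ 2 ≤ s ^ 2 / n := by
    rw [div_pow, pow_two n, ← div_div]
    exact div_le_self (by positivity) hn₁
  have h2 : s ^ 2 / (2 * n) = s ^ 2 / n / 2 := by field_simp
  rw [h2]
  linarith

end Bits

/-! ### Likelihood ratios of counts, and privacy of several independent counts -/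

section Columns

variable {ι : Type*} [Fintype ι] [DecidableEq ι]

/-- The likelihood ratio of the number of ones, for two families of biases that differ in one
place, is close to `1` in a subgaussian sense. -/
theorem sum_exp_ratio_le {p p' : ι → ℝ} {η : ℝ} (hη : 16 * Fintype.card ι * η ^ 2 ≤ 1)
    (hη₀ : 0 ≤ η) (hη₁ : η ≤ 1 / 4) (hp : ∀ u, |p u - 1 / 2| ≤ η)
    (hp' : ∀ u, |p' u - 1 / 2| ≤ η) (u₀ : ι) (heq : ∀ u, u ≠ u₀ → p u = p' u) (s : ℝ) :
    ∑ k ∈ Finset.range (Fintype.card ι + 1), countWeight p' k *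
        Real.exp (s * (countWeight p k / countWeight p' k - 1))
      ≤ Real.exp (8 * s ^ 2 / (Fintype.card ι : ℝ) ^ 2) := by
  have : Nonempty ι := ⟨u₀⟩
  have hlo : ∀ u, 1 / 4 ≤ p' u := fun u => by have := abs_le.1 (hp' u); linarith
  have hhi : ∀ u, p' u ≤ 3 / 4 := fun u => by have := abs_le.1 (hp' u); linarith
  have h₀ : ∀ u, 0 < p' u := fun u => by linarith [hlo u]
  have h₁ : ∀ u, p' u < 1 := fun u => by linarith [hhi u]
  set D := p u₀ / p' u₀ - (1 - p u₀) / (1 - p' u₀) with hD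
  have hDeq : D = (p u₀ - p' u₀) / (p' u₀ * (1 - p' u₀)) := by
    have h₂ := (h₀ u₀).ne'
    have h₃ : 1 - p' u₀ ≠ 0 := by linarith [h₁ u₀]
    rw [hD]
    field_simp
    ring
  -- A change of one bias alters the likelihood by an affine function of that bit, which vanishes in
  -- mean.
  have hweight : ∀ c, colWeight p c - colWeight p' c =
      D * (colWeight p' c * (bitVal (c u₀) - p' u₀)) := by
    intro c
    have hrest : ∏ v ∈ Finset.univ.erase u₀, bern (p v) (c v) =
        ∏ v ∈ Finset.univ.erase u₀, bern (p' v) (c v) :=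
      Finset.prod_congr rfl fun v hv => by rw [heq v (Finset.ne_of_mem_erase hv)]
    rw [colWeight, colWeight, ← Finset.mul_prod_erase _ _ (Finset.mem_univ u₀),
      ← Finset.mul_prod_erase _ (fun v => bern (p' v) (c v)) (Finset.mem_univ u₀), hrest, hDeq]
    have h₂ := (h₀ u₀).ne'
    have h₃ : 1 - p' u₀ ≠ 0 := by linarith [h₁ u₀]
    cases c u₀ <;> simp <;> field_simp <;> ring
  -- Conditional Jensen: the ratio minus 1 is `D` times the conditional mean of `swapStat` given the
  -- count. The proof uses the tangent line of the exponential at that mean.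
  have hjensen : ∀ k, countWeight p' k * Real.exp (s * (countWeight p k / countWeight p' k - 1)) ≤
      ∑ c with ones c = k, colWeight p' c * Real.exp (s * D * swapStat p' u₀ c) := by
    intro k
    rcases (countWeight_nonneg h₀ h₁ k).eq_or_lt with h | h
    · rw [← h, zero_mul]
      exact Finset.sum_nonneg fun c _ => mul_nonneg (colWeight_pos h₀ h₁ c).le (Real.exp_pos _).le
    set m := s * (countWeight p k / countWeight p' k - 1) with hm
    have hmG : m * countWeight p' k = s * (countWeight p k - countWeight p' k) := by
      rw [hm]; field_simp
    have hT : s * D * ∑ c with ones c = k, colWeight p' c * swapStat p' u₀ c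
        = s * (countWeight p k - countWeight p' k) := by
      rw [sum_count_swapStat h₀ h₁, mul_assoc, Finset.mul_sum, countWeight, countWeight,
        ← Finset.sum_sub_distrib]
      exact congrArg _ (Finset.sum_congr rfl fun c _ => (hweight c).symm)
    calc countWeight p' k * Real.exp m
        = Real.exp m * (countWeight p' k
            + s * D * ∑ c with ones c = k, colWeight p' c * swapStat p' u₀ c
            - m * countWeight p' k) := by rw [hT, hmG]; ring
      _ = ∑ c with ones c = k, colWeight p' c *
            (Real.exp m * (s * D * swapStat p' u₀ c - m + 1)) := by
          rw [countWeight, Finset.mul_sum, Finset.mul_sum, ← Finset.sum_add_distrib,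
            ← Finset.sum_sub_distrib, Finset.mul_sum]
          exact Finset.sum_congr rfl fun c _ => by ring
      _ ≤ _ := Finset.sum_le_sum fun c _ => by
          refine mul_le_mul_of_nonneg_left ?_ (colWeight_pos h₀ h₁ c).le
          refine (mul_le_mul_of_nonneg_left (Real.add_one_le_exp _) (Real.exp_pos m).le).trans ?_
          rw [← Real.exp_add, add_sub_cancel]
  refine (Finset.sum_le_sum fun k _ => hjensen k).trans ?_
  rw [Finset.sum_fiberwise_of_maps_to (s := Finset.univ)
    (t := Finset.range (Fintype.card ι + 1)) (g := ones)
    (fun c _ => Finset.mem_range.2 (Nat.lt_succ_of_le (ones_le c)))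
    (fun c => colWeight p' c * Real.exp (s * D * swapStat p' u₀ c))]
  refine (sum_exp_swapStat_le hη hη₀ hη₁ hp' u₀ (s * D)).trans (Real.exp_le_exp.2 ?_)
  set n : ℝ := ((Fintype.card ι : ℕ) : ℝ) with hn
  have hn₀ : 0 < n := by rw [hn]; exact_mod_cast Fintype.card_pos (α := ι)
  have hDle : |D| ≤ 32 / 3 * η := by
    rw [hDeq, abs_div]
    have h2 : 3 / 16 ≤ p' u₀ * (1 - p' u₀) := by
      nlinarith [mul_nonneg (sub_nonneg.2 (hlo u₀)) (sub_nonneg.2 (hhi u₀))]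
    have h1 : |p u₀ - p' u₀| ≤ 2 * η := by
      have := abs_le.1 (hp u₀); have := abs_le.1 (hp' u₀)
      rw [abs_le]; constructor <;> linarith
    rw [abs_of_pos (by linarith : 0 < p' u₀ * (1 - p' u₀))]
    refine (div_le_div₀ (by positivity) h1 (by norm_num) h2).trans (le_of_eq (by ring))
  -- The square of `32/3`, divided by 16, is about 7.1.
  have hD2 : n * D ^ 2 ≤ 8 := by
    have : D ^ 2 ≤ (32 / 3 * η) ^ 2 := sq_le_sq' (by linarith [neg_abs_le D]) ((le_abs_self D).trans hDle)
    nlinarith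
  rw [div_le_div_iff₀ hn₀ (by positivity), mul_pow]
  nlinarith [mul_nonneg (sq_nonneg s) hn₀.le]

/-- Differential privacy of the numbers of ones in several independent families of bits. -/
theorem sum_colWeight_le {κ : Type*} [Fintype κ] [DecidableEq κ] {p p' : κ → ι → ℝ} {η : ℝ}
    (hη : 16 * Fintype.card ι * η ^ 2 ≤ 1)
    (hη₀ : 0 ≤ η) (hη₁ : η ≤ 1 / 4) (hp : ∀ j u, |p j u - 1 / 2| ≤ η)
    (hp' : ∀ j u, |p' j u - 1 / 2| ≤ η) (u₀ : ι) (heq : ∀ j u, u ≠ u₀ → p j u = p' j u)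
    (h : (κ → ℕ) → ℝ) (h₀ : ∀ k, 0 ≤ h k) (h₁ : ∀ k, h k ≤ 1) {s : ℝ} (hs : 1 ≤ s) (ε : ℝ) :
    ∑ b : κ → ι → Bool, (∏ j, colWeight (p j) (b j)) * h (fun j => ones (b j)) ≤
      Real.exp ε * ∑ b : κ → ι → Bool, (∏ j, colWeight (p' j) (b j)) * h (fun j => ones (b j)) +
        Real.exp (-((s - 1) * ε) + 8 * s ^ 2 * Fintype.card κ / (Fintype.card ι : ℝ) ^ 2) := by
  have : Nonempty ι := ⟨u₀⟩
  have hlo : ∀ {q : κ → ι → ℝ}, (∀ j u, |q j u - 1 / 2| ≤ η) → ∀ j u, 0 < q j u :=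
    fun hq j u => by have := abs_le.1 (hq j u); linarith
  have hhi : ∀ {q : κ → ι → ℝ}, (∀ j u, |q j u - 1 / 2| ≤ η) → ∀ j u, q j u < 1 :=
    fun hq j u => by have := abs_le.1 (hq j u); linarith
  set S : Finset (κ → ℕ) := Fintype.piFinset fun _ => Finset.range (Fintype.card ι + 1) with hS
  -- The test `h` sees only the counts, so the sum collapses to the product law of the counts.
  have hfib : ∀ q : κ → ι → ℝ,
      ∑ b : κ → ι → Bool, (∏ j, colWeight (q j) (b j)) * h (fun j => ones (b j)) =
        ∑ k ∈ S, (∏ j, countWeight (q j) (k j)) * h k := by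
    intro q
    have hk : ∀ k ∈ S, (∏ j, countWeight (q j) (k j)) * h k =
        ∑ b : κ → ι → Bool with (fun j => ones (b j)) = k,
          (∏ j, colWeight (q j) (b j)) * h (fun j => ones (b j)) := by
      intro k _
      simp only [countWeight]
      rw [Finset.prod_univ_sum, Finset.sum_mul]
      refine Finset.sum_congr ?_ fun b hb => ?_
      · ext b; simp [Fintype.mem_piFinset, funext_iff]
      · rw [show (fun j => ones (b j)) = k from (Finset.mem_filter.1 hb).2]
    rw [Finset.sum_congr rfl hk]
    refine (Finset.sum_fiberwise_of_maps_to (fun b _ => ?_) _).symm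
    simp only [hS, Fintype.mem_piFinset]
    exact fun j => Finset.mem_range.2 (Nat.lt_succ_of_le (ones_le _))
  rw [hfib p, hfib p']
  have hpos : ∀ j, ∀ k ∈ Finset.range (Fintype.card ι + 1), 0 < countWeight (p' j) k := by
    intro j k hk
    obtain ⟨A, -, hA⟩ := Finset.exists_subset_card_eq
      (s := (Finset.univ : Finset ι)) (n := k) (by
        rw [Finset.card_univ]; exact Nat.lt_succ_iff.1 (Finset.mem_range.1 hk))
    refine Finset.sum_pos (fun c _ => colWeight_pos (hlo hp' j) (hhi hp' j) c)
      ⟨fun u => decide (u ∈ A), ?_⟩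
    simp [ones, Bool.toNat, hA, Bool.cond_decide]
  have hpt : ∀ k ∈ S, (∏ j, countWeight (p j) (k j)) * h k ≤
      Real.exp ε * ((∏ j, countWeight (p' j) (k j)) * h k) + Real.exp (-((s - 1) * ε)) *
        ∏ j, countWeight (p' j) (k j) *
          Real.exp (s * (countWeight (p j) (k j) / countWeight (p' j) (k j) - 1)) := by
    intro k hk
    have hk' := Fintype.mem_piFinset.1 hk
    set w := ∑ j, (countWeight (p j) (k j) / countWeight (p' j) (k j) - 1) with hw
    set G := ∏ j, countWeight (p' j) (k j) with hG
    have hG₀ : 0 < G := Finset.prod_pos fun j _ => hpos j _ (hk' j)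
    have hprod : ∏ j, countWeight (p j) (k j) ≤ G * Real.exp w := by
      rw [hw, Real.exp_sum, hG, ← Finset.prod_mul_distrib]
      refine Finset.prod_le_prod (fun j _ => countWeight_nonneg (hlo hp j) (hhi hp j) _)
        fun j _ => ?_
      have h2 := Real.add_one_le_exp (countWeight (p j) (k j) / countWeight (p' j) (k j) - 1)
      rw [sub_add_cancel] at h2
      calc countWeight (p j) (k j)
          = countWeight (p' j) (k j) * (countWeight (p j) (k j) / countWeight (p' j) (k j)) := by
            rw [mul_div_cancel₀ _ (hpos j _ (hk' j)).ne']
        _ ≤ _ := mul_le_mul_of_nonneg_left h2 (hpos j _ (hk' j)).le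
    -- If the privacy loss bound `w` exceeds `ε`, then `(s - 1)(w - ε) ≥ 0`. The second alternative
    -- factors over the instances, and its total mass becomes the additive error.
    have hexp : Real.exp w ≤ Real.exp ε ∨ Real.exp w ≤ Real.exp (-((s - 1) * ε) + s * w) := by
      rcases le_total w ε with hle | hle
      · exact Or.inl (Real.exp_le_exp.2 hle)
      · refine Or.inr (Real.exp_le_exp.2 ?_)
        nlinarith
    have hrw : Real.exp (-((s - 1) * ε)) * ∏ j, countWeight (p' j) (k j) *
          Real.exp (s * (countWeight (p j) (k j) / countWeight (p' j) (k j) - 1)) =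
        G * Real.exp (-((s - 1) * ε) + s * w) := by
      rw [Finset.prod_mul_distrib, ← Real.exp_sum, ← Finset.mul_sum, Real.exp_add]
      ring
    rw [hrw]
    have hh₀ := h₀ k
    have hh₁ := h₁ k
    have e₁ := (Real.exp_pos ε).le
    have e₂ := (Real.exp_pos (-((s - 1) * ε) + s * w)).le
    refine (mul_le_mul_of_nonneg_right hprod hh₀).trans ?_
    rcases hexp with hle | hle
    · have := mul_le_mul_of_nonneg_left hle (mul_nonneg hG₀.le hh₀)
      have := mul_nonneg hG₀.le e₂
      linarith
    · have h3 : G * Real.exp w * h k ≤ G * Real.exp w * 1 :=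
        mul_le_mul_of_nonneg_left hh₁ (mul_nonneg hG₀.le (Real.exp_pos _).le)
      have := mul_le_mul_of_nonneg_left hle hG₀.le
      have := mul_nonneg e₁ (mul_nonneg hG₀.le hh₀)
      linarith
  refine (Finset.sum_le_sum hpt).trans ?_
  rw [Finset.sum_add_distrib, ← Finset.mul_sum, ← Finset.mul_sum]
  refine add_le_add le_rfl ?_
  rw [Real.exp_add]
  refine mul_le_mul_of_nonneg_left ?_ (Real.exp_pos _).le
  rw [hS, ← Finset.prod_univ_sum (fun _ => Finset.range (Fintype.card ι + 1))
    (fun j k => countWeight (p' j) k *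
      Real.exp (s * (countWeight (p j) k / countWeight (p' j) k - 1)))]
  refine (Finset.prod_le_prod (fun j _ => Finset.sum_nonneg fun k _ => mul_nonneg
    (countWeight_nonneg (hlo hp' j) (hhi hp' j) k) (Real.exp_pos _).le) fun j _ =>
    sum_exp_ratio_le hη hη₀ hη₁ (hp j) (hp' j) u₀ (heq j) s).trans ?_
  rw [Finset.prod_const, Finset.card_univ, ← Real.exp_nat_mul]
  exact le_of_eq (congrArg _ (by ring))

end Columns

/-! ### The shuffler -/

theorem exists_equiv_of_perm {α : Type*} {l l' : List α} (h : l.Perm l') :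
    ∃ e : Fin l.length ≃ Fin l'.length, ∀ i, l.get i = l'.get (e i) := by
  induction h with
  | nil => exact ⟨Equiv.refl _, fun _ => rfl⟩
  | @cons x l l' _ ih =>
    obtain ⟨e, he⟩ := ih
    refine ⟨(finSuccEquiv l.length).trans (e.optionCongr.trans (finSuccEquiv l'.length).symm),
      fun i => ?_⟩
    refine Fin.cases ?_ (fun i => ?_) i
    · simp
    · have := he i
      simp at this ⊢
      exact this
  | swap x y l =>
    refine ⟨Equiv.swap (0 : Fin (l.length + 2)) 1, fun i => ?_⟩
    refine Fin.cases ?_ (fun i => Fin.cases ?_ (fun i => ?_) i) i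
    · rw [Equiv.swap_apply_left]; rfl
    · rw [show Fin.succ (0 : Fin (l.length + 1)) = 1 from rfl, Equiv.swap_apply_right]; rfl
    · rw [Equiv.swap_apply_of_ne_of_ne (by simp [Fin.ext_iff]) (by simp [Fin.ext_iff])]; rfl
  | trans _ _ ih₁ ih₂ =>
    obtain ⟨e₁, h₁⟩ := ih₁
    obtain ⟨e₂, h₂⟩ := ih₂
    exact ⟨e₁.trans e₂, fun i => by rw [h₁, h₂]; rfl⟩

/-- A permutation of a list is a relabelling `e` of its positions, and composing with `e` is a
bijection of the reorderings. -/
theorem shuffleMean_perm {l l' : List Message} (h : l.Perm l') (F : List Message → ℝ≥0∞) :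
    shuffleMean l F = shuffleMean l' F := by
  obtain ⟨e, he⟩ := exists_equiv_of_perm h
  rw [shuffleMean, shuffleMean]
  refine congrArg₂ _ ?_ (by rw [h.length_eq])
  refine Fintype.sum_equiv (Equiv.equivCongr (finCongr h.length_eq) e) _ _ fun σ => ?_
  congr 1
  rw [List.ofFn_congr h.length_eq]
  congr 1
  funext i
  rw [he]
  rfl

theorem ofFn_get_perm (l : List Message) (σ : Equiv.Perm (Fin l.length)) :
    (List.ofFn fun i => l.get (σ i)).Perm l := by
  have := Equiv.Perm.ofFn_comp_perm σ l.get
  rwa [List.ofFn_get] at this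

/-- For error and time only a bound valid for every order is needed, since the analyzer's output
does not depend on the order. -/
theorem shuffleMean_le {l : List Message} {F : List Message → ℝ≥0∞} {c : ℝ≥0∞}
    (h : ∀ l', l'.Perm l → F l' ≤ c) : shuffleMean l F ≤ c := by
  rw [shuffleMean]
  refine ENNReal.div_le_of_le_mul ?_
  refine (Finset.sum_le_sum fun σ _ => h _ (ofFn_get_perm l σ)).trans ?_
  rw [Finset.sum_const, Finset.card_univ, Fintype.card_perm, Fintype.card_fin, nsmul_eq_mul,
    mul_comm]

/-- The messages of `n` users with bits `b`. -/
def messagesOf {n : ℕ} (I : ℕ) (b : Fin n → ℕ → Bool) : List Message :=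
  (List.ofFn fun u => (List.range I).map fun j => (⟨j, (b u j).toNat⟩ : Message)).flatten

theorem coe_flatten_eq_sum {α : Type*} (L : List (List α)) :
    (L.flatten : Multiset α) = (L.map Multiset.ofList).sum := by
  induction L with
  | nil => rfl
  | cons l L ih => rw [List.flatten_cons, ← Multiset.coe_add, ih, List.map_cons, List.sum_cons]

theorem coe_map_range_eq_sum {α : Type*} (f : ℕ → α) (I : ℕ) :
    (((List.range I).map f : List α) : Multiset α) = ∑ j ∈ Finset.range I, {f j} := by
  induction I with
  | zero => rfl
  | succ I ih =>
    rw [List.range_succ, List.map_append, ← Multiset.coe_add, ih, Finset.sum_range_succ]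
    rfl

/-- As a multiset, the messages consist, for each label, of as many ones as were sent and zeros for
the remaining users. This is why the shuffled view reveals only the counts. -/
theorem messagesOf_perm {n I : ℕ} {b b' : Fin n → ℕ → Bool}
    (h : ∀ j < I, ones (fun u => b u j) = ones (fun u => b' u j)) :
    (messagesOf I b).Perm (messagesOf I b') := by
  have key : ∀ b : Fin n → ℕ → Bool, (messagesOf I b : Multiset Message) =
      ∑ j ∈ Finset.range I, (ones (fun u => b u j) • {⟨j, 1⟩} +
        (n - ones (fun u => b u j)) • {⟨j, 0⟩}) := by
    intro b
    rw [messagesOf, coe_flatten_eq_sum, List.map_ofFn, List.sum_ofFn]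
    simp only [Function.comp_def, coe_map_range_eq_sum]
    rw [Finset.sum_comm]
    refine Finset.sum_congr rfl fun j _ => ?_
    have hpt : ∀ u, ({⟨j, (b u j).toNat⟩} : Multiset Message) =
        (b u j).toNat • {⟨j, 1⟩} + (!(b u j)).toNat • {⟨j, 0⟩} := fun u => by
      cases b u j <;> simp
    have hz : n - ones (fun u => b u j) = ∑ u, (!(b u j)).toNat := by
      have : ones (fun u => b u j) + ∑ u, (!(b u j)).toNat = n := by
        rw [ones, ← Finset.sum_add_distrib]
        calc _ = ∑ u : Fin n, 1 := Finset.sum_congr rfl fun u _ => by cases b u j <;> rfl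
          _ = n := by simp
      omega
    rw [Finset.sum_congr rfl fun u _ => hpt u, Finset.sum_add_distrib, Finset.sum_nsmul_assoc,
      Finset.sum_nsmul_assoc, hz, ones]
  rw [← Multiset.coe_eq_coe, key, key]
  exact Finset.sum_congr rfl fun j hj => by rw [h j (Finset.mem_range.1 hj)]

theorem length_messagesOf {n : ℕ} (I : ℕ) (b : Fin n → ℕ → Bool) :
    (messagesOf I b).length = n * I := by
  simp [messagesOf, List.length_flatten, Function.comp_def]

/-! ### The law of the bits -/

instance : IsProbabilityMeasure tapeLaw := by
  unfold tapeLaw; infer_instance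

theorem measurable_decide_lt {α : Type*} [MeasurableSpace α] (f : α → ℝ) (hf : Measurable f)
    (p : ℝ) : Measurable fun x => decide (f x < p) := by
  refine measurable_to_bool ?_
  have : (fun x => decide (f x < p)) ⁻¹' {true} = {x | f x < p} := by ext x; simp
  rw [this]
  exact measurableSet_lt hf measurable_const

theorem volume_lt_eq_bern {p : ℝ} (h₀ : 0 ≤ p) (h₁ : p ≤ 1) (b : Bool) :
    volume {x : unitInterval | decide ((x : ℝ) < p) = b} = ENNReal.ofReal (bern p b) := by
  have hIio : {x : unitInterval | (x : ℝ) < p} = Set.Iio ⟨p, h₀, h₁⟩ := by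
    ext x; simp [← Subtype.coe_lt_coe]
  cases b
  · have hIci : {x : unitInterval | decide ((x : ℝ) < p) = false} = Set.Ici ⟨p, h₀, h₁⟩ := by
      ext x; simp [← Subtype.coe_le_coe]
    rw [hIci, unitInterval.volume_Ici]; rfl
  · simp only [decide_eq_true_eq, hIio, unitInterval.volume_Iio]; rfl

/-- The set of tapes that produce a given array of bits is a cylinder, whose measure is a product of
lengths of intervals. Privacy and variance thereby become finite sums. -/
theorem lintegral_bits {n I : ℕ} {p : Fin n → Fin I → ℝ} (h₀ : ∀ u j, 0 ≤ p u j)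
    (h₁ : ∀ u j, p u j ≤ 1) (F : (Fin n → Fin I → Bool) → ℝ≥0∞) :
    ∫⁻ r, F (fun u j => decide ((r u j : ℝ) < p u j)) ∂(Measure.pi fun _ : Fin n => tapeLaw) =
      ∑ b, F b * ENNReal.ofReal (∏ u, ∏ j, bern (p u j) (b u j)) := by
  set β : (Fin n → Tape) → Fin n → Fin I → Bool := fun r u j => decide ((r u j : ℝ) < p u j)
    with hβ
  have hmeas : Measurable β := by
    refine measurable_pi_lambda _ fun u => measurable_pi_lambda _ fun j => ?_
    exact measurable_decide_lt (fun r : Fin n → Tape => ((r u j : unitInterval) : ℝ))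
      (by fun_prop) _
  have h := lintegral_map (μ := Measure.pi fun _ : Fin n => tapeLaw) (f := F) (g := β)
    (measurable_of_finite F) hmeas
  rw [← h, lintegral_fintype]
  refine Finset.sum_congr rfl fun b _ => ?_
  congr 1
  rw [Measure.map_apply hmeas (measurableSet_singleton b)]
  set A : Fin n → ℕ → Set unitInterval := fun u j =>
    if h : j < I then {x | decide ((x : ℝ) < p u ⟨j, h⟩) = b u ⟨j, h⟩} else Set.univ with hA
  have hpre : β ⁻¹' {b} = Set.pi Set.univ fun u => Set.pi (Finset.range I) (A u) := by
    ext r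
    simp only [Set.mem_preimage, Set.mem_singleton_iff, funext_iff, Set.mem_pi, Set.mem_univ,
      true_imp_iff, hβ, Finset.coe_range, Set.mem_Iio]
    refine forall_congr' fun u => ⟨fun h j hj => ?_, fun h j => ?_⟩
    · simp only [hA, hj, dif_pos, Set.mem_ofPred_eq]
      exact h ⟨j, hj⟩
    · have := h j j.2
      simpa only [hA, j.2, dif_pos, Set.mem_ofPred_eq] using this
  rw [hpre, Measure.pi_pi, ENNReal.ofReal_prod_of_nonneg fun u _ =>
    Finset.prod_nonneg fun j _ => bern_nonneg (h₀ u j) (h₁ u j) _]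
  refine Finset.prod_congr rfl fun u _ => ?_
  rw [tapeLaw, Measure.infinitePi_pi _ fun j _ => ?_, Finset.prod_range,
    ENNReal.ofReal_prod_of_nonneg fun j _ => bern_nonneg (h₀ u j) (h₁ u j) _]
  · refine Finset.prod_congr rfl fun j _ => ?_
    simp only [hA, j.2, dif_pos]
    exact volume_lt_eq_bern (h₀ u j) (h₁ u j) _
  · simp only [hA]
    split_ifs with h
    · have : Measurable fun x : unitInterval => decide ((x : ℝ) < p u ⟨j, h⟩) :=
        measurable_decide_lt _ (by fun_prop) _
      exact this (measurableSet_singleton (b u ⟨j, h⟩))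
    · exact MeasurableSet.univ

/-! ### Privacy -/

/-- Privacy of shuffled randomized response with small bias, against events about the output of
the shuffler. -/
theorem lintegral_shuffleMean_le {n I : ℕ} {p p' : Fin n → Fin I → ℝ} {η : ℝ}
    (hη : 16 * n * η ^ 2 ≤ 1) (hη₀ : 0 ≤ η) (hη₁ : η ≤ 1 / 4)
    (hp : ∀ u j, |p u j - 1 / 2| ≤ η) (hp' : ∀ u j, |p' u j - 1 / 2| ≤ η) (u₀ : Fin n)
    (heq : ∀ u, u ≠ u₀ → p u = p' u) (ext : (Fin n → Fin I → Bool) → Fin n → ℕ → Bool)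
    (hext : ∀ b u (j : Fin I), ext b u j = b u j)
    (F : List Message → ℝ≥0∞) (hF : ∀ l, F l ≤ 1) {s : ℝ} (hs : 1 ≤ s) (ε : ℝ) :
    ∫⁻ r, shuffleMean (messagesOf I (ext fun u j => decide ((r u j : ℝ) < p u j))) F
        ∂(Measure.pi fun _ : Fin n => tapeLaw) ≤
      ENNReal.ofReal (Real.exp ε) *
        ∫⁻ r, shuffleMean (messagesOf I (ext fun u j => decide ((r u j : ℝ) < p' u j))) F
          ∂(Measure.pi fun _ : Fin n => tapeLaw) +
        ENNReal.ofReal (Real.exp (-((s - 1) * ε) + 8 * s ^ 2 * I / (n : ℝ) ^ 2)) := by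
  set v : (Fin n → Fin I → Bool) → ℝ≥0∞ := fun b => shuffleMean (messagesOf I (ext b)) F with hv
  have hv₁ : ∀ b, v b ≤ 1 := fun b => shuffleMean_le fun l _ => hF l
  have hvtop : ∀ b, v b ≠ ⊤ := fun b => ne_top_of_le_ne_top ENNReal.one_ne_top (hv₁ b)
  have hvinv : ∀ b b', (∀ j, ones (fun u => b u j) = ones (fun u => b' u j)) → v b = v b' := by
    intro b b' h
    refine shuffleMean_perm (messagesOf_perm fun j hj => ?_) F
    have := h ⟨j, hj⟩
    simpa only [← hext] using this
  -- The acceptance probability as a function of the counts: choose any bits with these counts (by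
  -- `hvinv` the choice is irrelevant), with the default 0 for impossible counts.
  set h : (Fin I → ℕ) → ℝ := fun k =>
    open Classical in
    if H : ∃ b : Fin n → Fin I → Bool, (fun j => ones fun u => b u j) = k then
      (v H.choose).toReal else 0 with hh
  have hhv : ∀ b : Fin n → Fin I → Bool, h (fun j => ones fun u => b u j) = (v b).toReal := by
    intro b
    have H : ∃ b' : Fin n → Fin I → Bool,
      (fun j => ones fun u => b' u j) = fun j => ones fun u => b u j := ⟨b, rfl⟩
    simp only [hh]
    rw [dif_pos H, hvinv _ b fun j => congrFun H.choose_spec j]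
  have hh₀ : ∀ k, 0 ≤ h k := fun k => by
    simp only [hh]; split_ifs <;> simp
  have hh₁ : ∀ k, h k ≤ 1 := fun k => by
    simp only [hh]
    split_ifs
    · exact ENNReal.toReal_le_of_le_ofReal zero_le_one (by simpa using hv₁ _)
    · exact zero_le_one
  have hlo : ∀ {q : Fin n → Fin I → ℝ}, (∀ u j, |q u j - 1 / 2| ≤ η) → ∀ u j, 0 ≤ q u j :=
    fun hq u j => by have := abs_le.1 (hq u j); linarith
  have hhi : ∀ {q : Fin n → Fin I → ℝ}, (∀ u j, |q u j - 1 / 2| ≤ η) → ∀ u j, q u j ≤ 1 :=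
    fun hq u j => by have := abs_le.1 (hq u j); linarith
  have hint : ∀ q : Fin n → Fin I → ℝ, (∀ u j, |q u j - 1 / 2| ≤ η) →
      ∫⁻ r, v (fun u j => decide ((r u j : ℝ) < q u j)) ∂(Measure.pi fun _ : Fin n => tapeLaw) =
        ENNReal.ofReal (∑ b : Fin I → Fin n → Bool, (∏ j, colWeight (fun u => q u j) (b j)) *
          h (fun j => ones (b j))) := by
    intro q hq
    rw [lintegral_bits (hlo hq) (hhi hq) v, ENNReal.ofReal_sum_of_nonneg]
    · refine Fintype.sum_equiv (Equiv.piComm fun _ _ => Bool) _ _ fun b => ?_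
      have : h (fun j => ones ((Equiv.piComm fun _ _ => Bool) b j)) = (v b).toReal := hhv b
      rw [this, ENNReal.ofReal_mul', ENNReal.ofReal_toReal (hvtop b), mul_comm, Finset.prod_comm]
      · rfl
      · exact ENNReal.toReal_nonneg
    · exact fun b _ => mul_nonneg (Finset.prod_nonneg fun j _ => Finset.prod_nonneg fun u _ =>
        bern_nonneg (hlo hq u j) (hhi hq u j) _) (hh₀ _)
  have key := sum_colWeight_le (κ := Fin I) (ι := Fin n) (p := fun j u => p u j)
    (p' := fun j u => p' u j) (η := η) (by simpa using hη) hη₀ hη₁ (fun j u => hp u j)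
    (fun j u => hp' u j) u₀ (fun j u hu => by rw [heq u hu]) h hh₀ hh₁ hs ε
  rw [Fintype.card_fin, Fintype.card_fin] at key
  refine ((hint p hp).le.trans (ENNReal.ofReal_le_ofReal key)).trans ?_
  refine ENNReal.ofReal_add_le.trans (add_le_add (le_of_eq ?_) le_rfl)
  rw [ENNReal.ofReal_mul (Real.exp_pos _).le, ← hint p' hp']

/-! ### Biases, messages and number of instances of the protocol -/

theorem abs_featureAt_le_one {d : ℕ} (α : ℝ) (pub : Tape) (x : Point d) (j : ℕ) :
    |featureAt α pub x j| ≤ 1 :=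
  Real.abs_cos_le_one _

theorem abs_responseProb_sub_le (n : ℕ) {c : ℝ} (hc : |c| ≤ 1) :
    |responseProb n c - 1 / 2| ≤ 1 / (4 * √n) := by
  rw [responseProb, add_sub_cancel_left, abs_div, abs_of_nonneg (by positivity : 0 ≤ 4 * √(n : ℝ))]
  exact div_le_div_of_nonneg_right hc (by positivity)

theorem allMessages_of_lt {n d : ℕ} {θ : Params} (h : θ.alpha < 1) (pub : Tape)
    (r : Fin n → Tape) (X : Fin n → Point d) :
    kdeProtocol.allMessages θ pub r X =
      messagesOf (instances θ.alpha) fun u j => bitOf n θ.alpha pub (r u) (X u) j := by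
  simp only [Protocol.allMessages, messagesOf, (userRun_of_lt h _ _ _).1]

theorem allMessages_of_le {n d : ℕ} {θ : Params} (h : 1 ≤ θ.alpha) (pub : Tape)
    (r : Fin n → Tape) (X : Fin n → Point d) : kdeProtocol.allMessages θ pub r X = [] := by
  simp [Protocol.allMessages, (userRun_of_le h _ _ _).1]

theorem instances_pos (α : ℝ) : 0 < instances α := by simp [instances]

theorem le_instances (α : ℝ) : 100 / (α * α) ≤ instances α := by
  refine (Nat.le_ceil _).trans ?_
  rw [instances]
  exact_mod_cast Nat.le_pow_clog (by norm_num) _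

theorem ceil_le {α : ℝ} (h₀ : 0 < α) (h₁ : α < 1) : (⌈100 / (α * α)⌉₊ : ℝ) ≤ 101 / α ^ 2 := by
  have h := (Nat.ceil_lt_add_one (by positivity : 0 ≤ 100 / (α * α))).le
  have h1 : 1 ≤ 1 / α ^ 2 := by
    rw [le_div_iff₀ (by positivity)]; nlinarith
  have e : 100 / (α * α) = 100 * (1 / α ^ 2) := by rw [pow_two]; ring
  rw [e] at h ⊢
  have e' : 101 / α ^ 2 = 101 * (1 / α ^ 2) := by ring
  linarith

/-- Rounding up to a power of two at most doubles `⌈100/α²⌉ ≤ 101/α²`. -/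
theorem instances_le {α : ℝ} (h₀ : 0 < α) (h₁ : α < 1) : (instances α : ℝ) ≤ 202 / α ^ 2 := by
  have hm : 1 < ⌈100 / (α * α)⌉₊ := by
    rw [Nat.lt_ceil, Nat.cast_one, lt_div_iff₀ (by positivity)]
    nlinarith
  have h := (Nat.pow_pred_clog_lt_self (b := 2) (by norm_num) hm).le
  have hc : 0 < Nat.clog 2 ⌈100 / (α * α)⌉₊ := Nat.clog_pos (by norm_num) hm
  have h2 : instances α ≤ 2 * ⌈100 / (α * α)⌉₊ := by
    rw [instances, levels, ← Nat.succ_pred_eq_of_pos hc, pow_succ]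
    omega
  have h3 : (instances α : ℝ) ≤ 2 * ⌈100 / (α * α)⌉₊ := by exact_mod_cast h2
  have := ceil_le h₀ h₁
  have e : 202 / α ^ 2 = 2 * (101 / α ^ 2) := by ring
  linarith

theorem isShuffledDP_kdeProtocol {n d : ℕ} {ε δ α : ℝ} (hn : 1 ≤ n) (hδ : 0 < δ) (hδ₁ : δ < 1)
    (hε : 0 < ε) (hεδ : ε ≤ Real.log (1 / δ))
    (hα : 200 * Real.sqrt (Real.log (1 / δ)) / (ε * n) ≤ α) :
    kdeProtocol.IsShuffledDP n d ⟨ε, δ, α⟩ := by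
  intro X X' hX T _
  obtain ⟨u₀, hu₀⟩ := hX
  rcases le_or_gt 1 α with h₁ | h₁
  -- For `α ≥ 1` no messages are sent, so the view does not depend on the data.
  · have : ∀ Y : Fin n → Point d, kdeProtocol.viewProb ⟨ε, δ, α⟩ Y T =
        kdeProtocol.viewProb ⟨ε, δ, α⟩ X T := fun Y => by
      simp only [Protocol.viewProb, Protocol.viewMean, allMessages_of_le (θ := ⟨ε, δ, α⟩) h₁]
    rw [this X']
    refine le_add_right ?_
    nth_rewrite 1 [← one_mul (kdeProtocol.viewProb ⟨ε, δ, α⟩ X T)]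
    gcongr
    rw [← ENNReal.ofReal_one]
    exact ENNReal.ofReal_le_ofReal (Real.one_le_exp hε.le)
  have hn₀ : (1 : ℝ) ≤ n := by exact_mod_cast hn
  set L := Real.log (1 / δ) with hL
  have hL₀ : 0 < L := Real.log_pos (by rw [lt_div_iff₀ hδ]; linarith)
  have hα₀ : 0 < α := lt_of_lt_of_le (by positivity) hα
  set I := instances α with hI
  have hI₀ : (0 : ℝ) < I := by exact_mod_cast instances_pos α
  -- the Chernoff parameter
  set s : ℝ := ε * n ^ 2 / (16 * I) with hs
  -- The constant 200 of the theorem is chosen for this inequality: `64 · 202 ≤ 200²`.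
  have hmain : 64 * L * I ≤ ε ^ 2 * n ^ 2 := by
    have h2 : 200 * √L ≤ α * (ε * n) := (div_le_iff₀ (by positivity)).1 hα
    have h3 : (200 * √L) ^ 2 ≤ (α * (ε * n)) ^ 2 := pow_le_pow_left₀ (by positivity) h2 2
    rw [mul_pow, Real.sq_sqrt hL₀.le] at h3
    have h4 : (I : ℝ) * α ^ 2 ≤ 202 := (le_div_iff₀ (by positivity)).1 (instances_le hα₀ h₁)
    have h5 : α ^ 2 * (64 * L * I) ≤ α ^ 2 * (ε ^ 2 * n ^ 2) := by
      calc α ^ 2 * (64 * L * I) = 64 * L * (I * α ^ 2) := by ring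
        _ ≤ 64 * L * 202 := by gcongr
        _ ≤ 200 ^ 2 * L := by nlinarith
        _ ≤ _ := by rw [mul_pow, mul_pow] at h3; exact h3
    exact le_of_mul_le_mul_left h5 (by positivity)
  -- Here `ε ≤ L` enters: it allows one factor `ε` to be cancelled in `hmain`.
  have hs₁ : 1 ≤ s := by
    rw [hs, le_div_iff₀ (by positivity)]
    have : ε * (64 * I) ≤ ε * (ε * n ^ 2) := by nlinarith
    have := le_of_mul_le_mul_left this hε
    linarith
  -- The choice of `s` minimizes the exponent, whose value is at most `ε - 2L ≤ -L = log δ`.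
  have hexp : Real.exp (-((s - 1) * ε) + 8 * s ^ 2 * I / (n : ℝ) ^ 2) ≤ δ := by
    have e : -((s - 1) * ε) + 8 * s ^ 2 * I / (n : ℝ) ^ 2 = ε - ε ^ 2 * n ^ 2 / (32 * I) := by
      rw [hs]; field_simp; ring
    have h2 : 2 * L ≤ ε ^ 2 * n ^ 2 / (32 * I) := by
      rw [le_div_iff₀ (by positivity)]; linarith
    rw [e, ← Real.le_log_iff_exp_le hδ]
    have : Real.log δ = -L := by rw [hL, one_div, Real.log_inv, neg_neg]
    linarith
  set F : Tape → List Message → ℝ≥0∞ := fun pub l => T.indicator 1 (pub, l) with hF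
  have hF₁ : ∀ pub l, F pub l ≤ 1 := fun pub l => Set.indicator_le_self' (by simp) _
  have hpoint : ∀ pub, ∫⁻ r, shuffleMean (kdeProtocol.allMessages ⟨ε, δ, α⟩ pub r X) (F pub)
        ∂(Measure.pi fun _ : Fin n => tapeLaw) ≤
      ENNReal.ofReal (Real.exp ε) *
        ∫⁻ r, shuffleMean (kdeProtocol.allMessages ⟨ε, δ, α⟩ pub r X') (F pub)
        ∂(Measure.pi fun _ : Fin n => tapeLaw) + ENNReal.ofReal δ := by
    intro pub
    -- Bits beyond the `I` instances are a default that `messagesOf I` never reads.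
    set ext : (Fin n → Fin I → Bool) → Fin n → ℕ → Bool := fun b u j =>
      if h : j < I then b u ⟨j, h⟩ else false with hext
    have hmsg : ∀ (Y : Fin n → Point d) (r : Fin n → Tape),
        kdeProtocol.allMessages ⟨ε, δ, α⟩ pub r Y = messagesOf I (ext fun u j =>
          decide ((r u j : ℝ) < responseProb n (featureAt α pub (Y u) j))) := by
      intro Y r
      rw [allMessages_of_lt (θ := ⟨ε, δ, α⟩) h₁, messagesOf, messagesOf]
      congr 2
      funext u
      refine List.map_congr_left fun j hj => ?_
      have hjI : j < I := List.mem_range.1 hj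
      simp only [hext, bitOf]
      rw [dif_pos hjI]
    simp only [hmsg]
    refine (lintegral_shuffleMean_le (η := 1 / (4 * √n)) ?_ (by positivity) ?_
      (fun u j => abs_responseProb_sub_le n (abs_featureAt_le_one _ _ _ _))
      (fun u j => abs_responseProb_sub_le n (abs_featureAt_le_one _ _ _ _)) u₀
      (fun u hu => by rw [hu₀ u hu]) ext (fun b u j => by simp [hext]) (F pub) (hF₁ pub)
      hs₁ ε).trans ?_
    · rw [div_pow, mul_pow, Real.sq_sqrt (by positivity)]
      refine le_of_eq ?_
      field_simp
      norm_num
    · rw [div_le_div_iff₀ (by positivity) (by norm_num)]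
      have : 1 ≤ √(n : ℝ) := Real.one_le_sqrt.2 hn₀
      linarith
    · exact add_le_add le_rfl (ENNReal.ofReal_le_ofReal hexp)
  rw [Protocol.viewProb, Protocol.viewProb, Protocol.viewMean, Protocol.viewMean]
  refine (lintegral_mono hpoint).trans ?_
  rw [lintegral_add_right _ measurable_const, lintegral_const_mul' _ _ ENNReal.ofReal_ne_top]
  refine add_le_add le_rfl (le_of_eq ?_)
  simp

/-! ### The Box–Muller transform -/

/-- The real part of the Fourier transform of the Gaussian, multiplied by `exp(iC)`. -/
theorem integral_cos_mul_gaussian (C z : ℝ) :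
    ∫ x : ℝ, Real.cos (C + 2 * z * x) * Real.exp (-x ^ 2)
      = Real.cos C * Real.exp (-z ^ 2) * √Real.pi := by
  have h := fourierIntegral_gaussian (b := 1) (by simp) (2 * z)
  have hint : Integrable fun x : ℝ =>
      Complex.exp (Complex.I * C) *
        (Complex.exp (Complex.I * (2 * z) * x) * Complex.exp (-1 * (x : ℂ) ^ 2)) := by
    refine Integrable.const_mul ?_ _
    have h2 := integrable_cexp_quadratic (b := 1) (by simp) (Complex.I * (2 * z)) 0
    refine h2.congr (Filter.Eventually.of_forall fun x => ?_)
    simp only [← Complex.exp_add]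
    congr 1; ring
  have hre : ∀ x : ℝ, (Complex.exp (Complex.I * C) *
        (Complex.exp (Complex.I * (2 * z) * x) * Complex.exp (-1 * (x : ℂ) ^ 2))).re =
      Real.cos (C + 2 * z * x) * Real.exp (-x ^ 2) := fun x => by
    have e1 : Complex.exp (-1 * (x : ℂ) ^ 2) = ((Real.exp (-x ^ 2) : ℝ) : ℂ) := by
      push_cast; congr 1; ring
    have e2 : Complex.exp (Complex.I * C) * Complex.exp (Complex.I * (2 * z) * x) =
        Complex.exp (((C + 2 * z * x : ℝ) : ℂ) * Complex.I) := by
      rw [← Complex.exp_add]; push_cast; congr 1; ring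
    rw [← mul_assoc, e2, e1, Complex.re_mul_ofReal, Complex.exp_ofReal_mul_I_re]
  calc ∫ x : ℝ, Real.cos (C + 2 * z * x) * Real.exp (-x ^ 2)
      = (∫ x : ℝ, Complex.exp (Complex.I * C) *
        (Complex.exp (Complex.I * (2 * z) * x) * Complex.exp (-1 * (x : ℂ) ^ 2))).re := by
        rw [← Complex.reCLM_apply, ← ContinuousLinearMap.integral_comp_comm _ hint]
        exact integral_congr_ae (Filter.Eventually.of_forall fun x => (hre x).symm)
    _ = _ := by
        rw [integral_const_mul, h]
        have e1 : ((Real.pi : ℂ) / 1) ^ (1 / 2 : ℂ) = ((√Real.pi : ℝ) : ℂ) := by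
          rw [Real.sqrt_eq_rpow, Complex.ofReal_cpow Real.pi_pos.le]; simp
        have e2 : Complex.exp (-(2 * (z : ℂ)) ^ 2 / (4 * 1)) = ((Real.exp (-z ^ 2) : ℝ) : ℂ) := by
          push_cast; congr 1; ring
        rw [e1, e2, mul_comm Complex.I, ← Complex.ofReal_mul, Complex.re_mul_ofReal,
          Complex.exp_ofReal_mul_I_re]
        ring

theorem integral_gaussian_plane (C z : ℝ) :
    ∫ p : ℝ × ℝ, Real.cos (C + 2 * z * p.1) * Real.exp (-p.1 ^ 2) * Real.exp (-p.2 ^ 2)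
      = Real.pi * (Real.cos C * Real.exp (-z ^ 2)) := by
  have h2 : ∫ y : ℝ, Real.exp (-y ^ 2) = √Real.pi := by
    have := integral_gaussian 1
    simpa using this
  rw [Measure.volume_eq_prod, integral_prod_mul (fun x : ℝ => Real.cos (C + 2 * z * x) *
    Real.exp (-x ^ 2)) fun y => Real.exp (-y ^ 2), integral_cos_mul_gaussian, h2]
  linear_combination (Real.cos C * Real.exp (-z ^ 2)) * Real.mul_self_sqrt Real.pi_pos.le

/-- The integrand is periodic, so the interval of angles may be moved to start at 0 and then
rescaled to length 1. -/
theorem integral_circle (C w : ℝ) :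
    ∫ θ in Set.Ioo (-Real.pi) Real.pi, Real.cos (C + w * Real.cos θ) =
      2 * Real.pi * ∫ v in Set.Ioc (0 : ℝ) 1, Real.cos (C + w * Real.cos (2 * Real.pi * v)) := by
  have hper : Function.Periodic (fun θ => Real.cos (C + w * Real.cos θ)) (2 * Real.pi) :=
    fun θ => by simp [Real.cos_add_two_pi]
  rw [← integral_Ioc_eq_integral_Ioo, ← intervalIntegral.integral_of_le (by linarith [Real.pi_pos]),
    ← intervalIntegral.integral_of_le zero_le_one]
  have h1 := hper.intervalIntegral_add_eq (-Real.pi) 0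
  rw [show -Real.pi + 2 * Real.pi = Real.pi by ring, zero_add] at h1
  rw [h1]
  have h2 := intervalIntegral.mul_integral_comp_mul_left (a := 0) (b := 1)
    (f := fun θ => Real.cos (C + w * Real.cos θ)) (2 * Real.pi)
  rw [h2]; simp

/-- The substitution `u = exp(-r²)`: the squared radius of a planar Gaussian is exponentially
distributed. -/
theorem integral_radial (H : ℝ → ℝ) :
    ∫ r in Set.Ioi (0 : ℝ), 2 * (r * Real.exp (-r ^ 2)) * H r =
      ∫ u in Set.Ioc (0 : ℝ) 1, H (√(-Real.log u)) := by
  have himg : (fun r : ℝ => Real.exp (-r ^ 2)) '' Set.Ioi 0 = Set.Ioo 0 1 := by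
    ext u
    simp only [Set.mem_image, Set.mem_Ioi, Set.mem_Ioo]
    constructor
    · rintro ⟨r, hr, rfl⟩
      exact ⟨Real.exp_pos _, (Real.exp_lt_exp.2 (by nlinarith : -r ^ 2 < 0)).trans_eq Real.exp_zero⟩
    · rintro ⟨h0, h1⟩
      have hl : 0 < -Real.log u := by linarith [Real.log_neg h0 h1]
      exact ⟨√(-Real.log u), Real.sqrt_pos.2 hl, by
        rw [Real.sq_sqrt hl.le, neg_neg, Real.exp_log h0]⟩
  rw [integral_Ioc_eq_integral_Ioo, ← himg,
    integral_image_eq_integral_abs_deriv_smul measurableSet_Ioi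
      (f' := fun r => Real.exp (-r ^ 2) * (-(2 * r)))]
  · refine setIntegral_congr_fun measurableSet_Ioi fun r (hr : 0 < r) => ?_
    rw [Real.log_exp, neg_neg, Real.sqrt_sq hr.le, smul_eq_mul, abs_mul, abs_neg,
      abs_of_pos (Real.exp_pos _), abs_of_pos (by linarith)]
    ring
  · intro r _
    have := ((hasDerivAt_pow 2 r).neg).exp
    refine HasDerivAt.hasDerivWithinAt ?_
    simpa using this
  · intro a (ha : 0 < a) b (hb : 0 < b) hab
    have := Real.exp_injective hab
    exact (pow_left_inj₀ ha.le hb.le two_ne_zero).1 (neg_injective this)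

/-- The planar Gaussian integral `integral_gaussian_plane`, written in polar coordinates:
`integral_radial` converts the radius and `integral_circle` the angle into uniform variables. The
scaling to variance 2 makes the characteristic function exactly `exp(-z²)`. -/
theorem integral_boxMuller (C z : ℝ) :
    ∫ x : unitInterval, ∫ y : unitInterval, Real.cos (C + boxMuller x y * z)
      = Real.cos C * Real.exp (-z ^ 2) := by
  have hsub : ∀ f : ℝ → ℝ, ∫ x : unitInterval, f x = ∫ x in Set.Ioc (0 : ℝ) 1, f x := fun f => by
    rw [← integral_Icc_eq_integral_Ioc]
    exact integral_subtype measurableSet_Icc f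
  have hcont : Continuous fun p : ℝ × ℝ =>
      Real.cos (C + 2 * z * (p.1 * Real.cos p.2)) := by fun_prop
  have hpolar := integral_comp_polarCoord_symm fun p : ℝ × ℝ =>
    Real.cos (C + 2 * z * p.1) * Real.exp (-p.1 ^ 2) * Real.exp (-p.2 ^ 2)
  rw [integral_gaussian_plane] at hpolar
  have hpt : ∀ p : ℝ × ℝ, p.1 • (Real.cos (C + 2 * z * (polarCoord.symm p).1) *
      Real.exp (-(polarCoord.symm p).1 ^ 2) * Real.exp (-(polarCoord.symm p).2 ^ 2)) =
      (p.1 * Real.exp (-p.1 ^ 2)) * Real.cos (C + 2 * z * (p.1 * Real.cos p.2)) := fun p => by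
    rw [polarCoord_symm_apply, mul_assoc (Real.cos _), ← Real.exp_add, smul_eq_mul]
    have : -(p.1 * Real.cos p.2) ^ 2 + -(p.1 * Real.sin p.2) ^ 2 = -p.1 ^ 2 := by
      linear_combination (-p.1 ^ 2) * Real.sin_sq_add_cos_sq p.2
    simp only [this]
    ring
  simp only [hpt] at hpolar
  have hrad : Integrable (fun r : ℝ => r * Real.exp (-r ^ 2)) (volume.restrict (Set.Ioi 0)) := by
    have := integrable_mul_exp_neg_mul_sq (b := 1) one_pos
    simpa using this.restrict
  have hInt : IntegrableOn (fun p : ℝ × ℝ =>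
      (p.1 * Real.exp (-p.1 ^ 2)) * Real.cos (C + 2 * z * (p.1 * Real.cos p.2)))
      (Set.Ioi 0 ×ˢ Set.Ioo (-Real.pi) Real.pi) (volume.prod volume) := by
    rw [IntegrableOn, ← Measure.prod_restrict]
    refine Integrable.mul_bdd (c := 1) ?_ hcont.aestronglyMeasurable
      (Filter.Eventually.of_forall fun p => Real.abs_cos_le_one _)
    exact hrad.comp_fst _
  rw [polarCoord_target, Measure.volume_eq_prod, setIntegral_prod _ hInt] at hpolar
  have hin : ∀ r : ℝ, ∫ θ in Set.Ioo (-Real.pi) Real.pi, (r * Real.exp (-r ^ 2)) *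
      Real.cos (C + 2 * z * (r * Real.cos θ)) = Real.pi * (2 * (r * Real.exp (-r ^ 2)) *
        ∫ v in Set.Ioc (0 : ℝ) 1, Real.cos (C + 2 * z * r * Real.cos (2 * Real.pi * v))) := by
    intro r
    rw [integral_const_mul]
    simp only [← mul_assoc]
    rw [integral_circle]
    ring
  simp only [hin] at hpolar
  rw [integral_const_mul, integral_radial fun r =>
    ∫ v in Set.Ioc (0 : ℝ) 1, Real.cos (C + 2 * z * r * Real.cos (2 * Real.pi * v))] at hpolar
  rw [← mul_left_cancel₀ Real.pi_ne_zero hpolar,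
    hsub fun u => ∫ y : unitInterval, Real.cos (C + boxMuller u y * z)]
  refine integral_congr_ae (Filter.Eventually.of_forall fun u => ?_)
  simp only
  rw [hsub fun v => Real.cos (C + boxMuller u v * z)]
  refine integral_congr_ae (Filter.Eventually.of_forall fun v => ?_)
  simp only [boxMuller]
  congr 1; ring

/-! ### Resampling a part of the tape -/

/-- The tape that agrees with `t'` on `A` and with `t` elsewhere. -/
def merge (A : Set ℕ) (t t' : Tape) : Tape := open Classical in fun i => if i ∈ A then t' i else t i

theorem merge_of_mem {A : Set ℕ} {i : ℕ} (h : i ∈ A) (t t' : Tape) : merge A t t' i = t' i :=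
  if_pos h

theorem merge_of_notMem {A : Set ℕ} {i : ℕ} (h : i ∉ A) (t t' : Tape) : merge A t t' i = t i :=
  if_neg h

theorem measurable_merge (A : Set ℕ) : Measurable fun q : Tape × Tape => merge A q.1 q.2 := by
  refine measurable_pi_lambda _ fun i => ?_
  by_cases h : i ∈ A
  · simp only [merge_of_mem h]; fun_prop
  · simp only [merge_of_notMem h]; fun_prop

/-- Replacing some cells by those of an independent tape leaves the law unchanged. This is the form
in which independence and conditioning on part of the public tape are used throughout. -/
theorem measurePreserving_merge (A : Set ℕ) :
    MeasurePreserving (fun q : Tape × Tape => merge A q.1 q.2) (tapeLaw.prod tapeLaw) tapeLaw := by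
  classical
  refine ⟨measurable_merge A, ?_⟩
  refine Measure.eq_infinitePi _ fun s B hB => ?_
  have hpre : (fun q : Tape × Tape => merge A q.1 q.2) ⁻¹' (Set.pi s B) =
      (Set.pi ((s.filter (· ∉ A) : Finset ℕ) : Set ℕ) B) ×ˢ
        (Set.pi ((s.filter (· ∈ A) : Finset ℕ) : Set ℕ) B) := by
    ext ⟨t, t'⟩
    simp only [Set.mem_preimage, Set.mem_pi, Set.mem_prod, Finset.coe_filter, Set.mem_ofPred_eq,
      Finset.mem_coe]
    constructor
    · intro h
      exact ⟨fun i hi => by simpa [merge_of_notMem hi.2] using h i hi.1,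
        fun i hi => by simpa [merge_of_mem hi.2] using h i hi.1⟩
    · rintro ⟨h1, h2⟩ i hi
      by_cases hA : i ∈ A
      · rw [merge_of_mem hA]; exact h2 i ⟨hi, hA⟩
      · rw [merge_of_notMem hA]; exact h1 i ⟨hi, hA⟩
  rw [Measure.map_apply (measurable_merge A)
    (MeasurableSet.pi s.countable_toSet fun i _ => hB i), hpre, Measure.prod_prod, tapeLaw,
    Measure.infinitePi_pi _ fun i _ => hB i, Measure.infinitePi_pi _ fun i _ => hB i, mul_comm,
    Finset.prod_filter_mul_prod_filter_not]

/-- Bounded measurable functions of a tape. -/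
def BddMeas (f : Tape → ℝ) : Prop := Measurable f ∧ ∃ C, ∀ t, |f t| ≤ C

namespace BddMeas

variable {f g : Tape → ℝ}

theorem integrable (hf : BddMeas f) : Integrable f tapeLaw := by
  obtain ⟨hm, C, hC⟩ := hf
  exact Integrable.of_bound hm.aestronglyMeasurable C (Filter.Eventually.of_forall hC)

theorem const (c : ℝ) : BddMeas fun _ => c := ⟨measurable_const, |c|, fun _ => le_rfl⟩

theorem add (hf : BddMeas f) (hg : BddMeas g) : BddMeas fun t => f t + g t := by
  obtain ⟨hf, C, hC⟩ := hf
  obtain ⟨hg, D, hD⟩ := hg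
  exact ⟨hf.add hg, C + D, fun t => (abs_add_le _ _).trans (add_le_add (hC t) (hD t))⟩

theorem mul (hf : BddMeas f) (hg : BddMeas g) : BddMeas fun t => f t * g t := by
  obtain ⟨hf, C, hC⟩ := hf
  obtain ⟨hg, D, hD⟩ := hg
  refine ⟨hf.mul hg, C * D, fun t => ?_⟩
  rw [abs_mul]
  exact mul_le_mul (hC t) (hD t) (abs_nonneg _) ((abs_nonneg _).trans (hC t))

theorem const_mul (hf : BddMeas f) (c : ℝ) : BddMeas fun t => c * f t := (const c).mul hf

theorem sub (hf : BddMeas f) (hg : BddMeas g) : BddMeas fun t => f t - g t := by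
  simpa [sub_eq_add_neg] using hf.add (hg.const_mul (-1))

theorem pow_two (hf : BddMeas f) : BddMeas fun t => f t ^ 2 := by
  simpa [_root_.pow_two] using hf.mul hf

theorem sum {κ : Type*} (s : Finset κ) {F : κ → Tape → ℝ} (hF : ∀ i, BddMeas (F i)) :
    BddMeas fun t => ∑ i ∈ s, F i t := by
  classical
  induction s using Finset.induction_on with
  | empty => simpa using const 0
  | insert a s ha ih => simpa [Finset.sum_insert ha] using (hF a).add ih

theorem cos (hf : Measurable f) : BddMeas fun t => Real.cos (f t) :=
  ⟨Real.measurable_cos.comp hf, 1, fun _ => Real.abs_cos_le_one _⟩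

theorem ite {p : Tape → Prop} [DecidablePred p] (hp : MeasurableSet {t | p t}) (a b : ℝ) :
    BddMeas fun t => if p t then a else b := by
  refine ⟨Measurable.ite hp measurable_const measurable_const, max |a| |b|, fun t => ?_⟩
  show |if p t then a else b| ≤ _
  split_ifs
  · exact le_max_left _ _
  · exact le_max_right _ _

theorem integral_merge (hf : BddMeas f) (A : Set ℕ) :
    ∫ t, f t ∂tapeLaw = ∫ t, ∫ t', f (merge A t t') ∂tapeLaw ∂tapeLaw := by
  obtain ⟨hm, C, hC⟩ := hf
  nth_rewrite 1 [← (measurePreserving_merge A).map_eq]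
  rw [integral_map (measurable_merge A).aemeasurable hm.aestronglyMeasurable]
  exact integral_prod (fun q : Tape × Tape => f (merge A q.1 q.2))
    (Integrable.of_bound (hm.comp (measurable_merge A)).aestronglyMeasurable C
      (Filter.Eventually.of_forall fun q => hC _))

end BddMeas

/-- The cells outside `A` determine `f`, and `g` has conditional mean 0 given them. -/
theorem integral_mul_eq_zero {f g : Tape → ℝ} (A : Set ℕ) (hf : BddMeas f) (hg : BddMeas g)
    (hfA : ∀ t t', f (merge A t t') = f t)
    (hgA : ∀ t, ∫ t', g (merge A t t') ∂tapeLaw = 0) : ∫ t, f t * g t ∂tapeLaw = 0 := by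
  rw [(hf.mul hg).integral_merge A]
  simp only [hfA, integral_const_mul, hgA, mul_zero, integral_zero]

theorem integral_cell (a : ℕ) {f : unitInterval → ℝ} (hf : Measurable f) :
    ∫ t, f (t a) ∂tapeLaw = ∫ x, f x := by
  have h : tapeLaw.map (fun t => t a) = (volume : Measure unitInterval) := by
    rw [tapeLaw]
    exact Measure.infinitePi_map_eval _ a
  rw [← integral_map (μ := tapeLaw) (φ := fun t => t a) (measurable_pi_apply a).aemeasurable
    hf.aestronglyMeasurable, h]

theorem integral_two_cells {a b : ℕ} (hab : a ≠ b) {f : unitInterval → unitInterval → ℝ}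
    (hf : Measurable fun q : unitInterval × unitInterval => f q.1 q.2) {C : ℝ}
    (hC : ∀ x y, |f x y| ≤ C) :
    ∫ t, f (t a) (t b) ∂tapeLaw = ∫ x, ∫ y, f x y := by
  have h : BddMeas fun t => f (t a) (t b) :=
    ⟨hf.comp (f := fun t : Tape => (t a, t b)) (by fun_prop), C, fun t => hC _ _⟩
  rw [h.integral_merge {b}]
  have h1 : ∀ t t' : Tape, f (merge {b} t t' a) (merge {b} t t' b) = f (t a) (t' b) := fun t t' => by
    rw [merge_of_notMem (by simpa using hab), merge_of_mem (Set.mem_singleton b)]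
  simp only [h1]
  have h2 : ∀ x, ∫ t' : Tape, f x (t' b) ∂tapeLaw = ∫ y, f x y := fun x =>
    integral_cell b (hf.comp (f := fun y => (x, y)) (by fun_prop))
  simp only [h2]
  exact integral_cell a (f := fun x => ∫ y, f x y)
    (hf.stronglyMeasurable.integral_prod_right (ν := volume)).measurable

/-! ### Expectations of the Fourier features -/

/-- The phase of a Fourier feature of the vector `w`, with randomness from cell `s` on. -/
def phase (M s : ℕ) (w : ℕ → ℝ) (t : Tape) : ℝ :=
  ∑ i ∈ Finset.range M, boxMuller (t (s + 2 * i)) (t (s + 2 * i + 1)) * w i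
    + 2 * Real.pi * t (s + 2 * M)

theorem measurable_boxMuller (a b : ℕ) : Measurable fun t : Tape => boxMuller (t a) (t b) := by
  unfold boxMuller
  fun_prop

/-- Resample the two cells of the last Gaussian and absorb the rest of the sum into the constant;
the arbitrary `C` makes the induction work. -/
theorem integral_cos_sum (s : ℕ) (z : ℕ → ℝ) (m : ℕ) (C : ℝ) :
    ∫ t : Tape, Real.cos (C + ∑ i ∈ Finset.range m,
        boxMuller (t (s + 2 * i)) (t (s + 2 * i + 1)) * z i) ∂tapeLaw =
      Real.cos C * Real.exp (-∑ i ∈ Finset.range m, z i ^ 2) := by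
  have hmeas : ∀ m, Measurable fun t : Tape => C + ∑ i ∈ Finset.range m,
        boxMuller (t (s + 2 * i)) (t (s + 2 * i + 1)) * z i := fun m =>
    measurable_const.add (Finset.measurable_fun_sum _ fun i _ =>
      (measurable_boxMuller _ _).mul_const _)
  induction m with
  | zero => simp
  | succ m ih =>
    rw [(BddMeas.cos (hmeas (m + 1))).integral_merge {s + 2 * m, s + 2 * m + 1}]
    have h1 : ∀ t t' : Tape, ∑ i ∈ Finset.range (m + 1),
        boxMuller (merge {s + 2 * m, s + 2 * m + 1} t t' (s + 2 * i))
          (merge {s + 2 * m, s + 2 * m + 1} t t' (s + 2 * i + 1)) * z i =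
        ∑ i ∈ Finset.range m, boxMuller (t (s + 2 * i)) (t (s + 2 * i + 1)) * z i +
          boxMuller (t' (s + 2 * m)) (t' (s + 2 * m + 1)) * z m := fun t t' => by
      rw [Finset.sum_range_succ, merge_of_mem (by simp), merge_of_mem (by simp)]
      congr 1
      refine Finset.sum_congr rfl fun i hi => ?_
      have := Finset.mem_range.1 hi
      rw [merge_of_notMem (by simp; omega), merge_of_notMem (by simp; omega)]
    simp only [h1, ← add_assoc]
    have h2 : ∀ D : ℝ, ∫ t' : Tape,
        Real.cos (D + boxMuller (t' (s + 2 * m)) (t' (s + 2 * m + 1)) * z m) ∂tapeLaw =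
        Real.cos D * Real.exp (-z m ^ 2) := fun D => by
      rw [integral_two_cells (by omega) (f := fun x y => Real.cos (D + boxMuller x y * z m))
        (by unfold boxMuller; fun_prop) (C := 1) fun x y => Real.abs_cos_le_one _]
      exact integral_boxMuller D (z m)
    simp only [h2, integral_mul_const, ih]
    rw [mul_assoc, ← Real.exp_add, Finset.sum_range_succ]
    congr 2; ring

theorem integral_cos_add_four_pi (D : ℝ) :
    ∫ x : unitInterval, Real.cos (D + 4 * Real.pi * x) = 0 := by
  have h1 : ∫ x : unitInterval, Real.cos (D + 4 * Real.pi * x) =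
      ∫ x in (0 : ℝ)..1, Real.cos (D + 4 * Real.pi * x) := by
    rw [intervalIntegral.integral_of_le zero_le_one, ← integral_Icc_eq_integral_Ioc]
    exact integral_subtype measurableSet_Icc fun x => Real.cos (D + 4 * Real.pi * x)
  rw [h1, intervalIntegral.integral_comp_add_mul (f := Real.cos) (by positivity), integral_cos]
  have : Real.sin (D + 4 * Real.pi * 1) = Real.sin (D + 4 * Real.pi * 0) := by
    rw [mul_zero, add_zero, show D + 4 * Real.pi * 1 = D + 2 * Real.pi + 2 * Real.pi by ring,
      Real.sin_add_two_pi, Real.sin_add_two_pi]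
  rw [this, sub_self, smul_zero]

theorem measurable_phase (M s : ℕ) (w : ℕ → ℝ) : Measurable (phase M s w) := by
  unfold phase
  refine Measurable.add (Finset.measurable_fun_sum _ fun i _ =>
    (measurable_boxMuller _ _).mul_const _) (by fun_prop)

/-- The random Fourier features represent the Gaussian kernel. -/
theorem integral_cos_phase_mul (M s : ℕ) (w w' : ℕ → ℝ) :
    ∫ t, 2 * (Real.cos (phase M s w t) * Real.cos (phase M s w' t)) ∂tapeLaw =
      Real.exp (-∑ i ∈ Finset.range M, (w i - w' i) ^ 2) := by
  set S : (ℕ → ℝ) → Tape → ℝ := fun z t => ∑ i ∈ Finset.range M,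
    boxMuller (t (s + 2 * i)) (t (s + 2 * i + 1)) * z i with hS
  have hSm : ∀ z, Measurable (S z) := fun z =>
    Finset.measurable_fun_sum _ fun i _ => (measurable_boxMuller _ _).mul_const _
  -- Product to sum: in the difference the uniform shift cancels and leaves the kernel; in the sum
  -- it appears doubled, as `4π` times a uniform variable, and averages to 0.
  have hpt : ∀ t, 2 * (Real.cos (phase M s w t) * Real.cos (phase M s w' t)) =
      Real.cos (0 + S (fun i => w i - w' i) t) +
        Real.cos (S (fun i => w i + w' i) t + 4 * Real.pi * t (s + 2 * M)) := fun t => by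
    have e1 : 0 + S (fun i => w i - w' i) t = phase M s w t - phase M s w' t := by
      simp only [hS, phase, mul_sub, Finset.sum_sub_distrib]; ring
    have e2 : S (fun i => w i + w' i) t + 4 * Real.pi * t (s + 2 * M) =
        phase M s w t + phase M s w' t := by
      simp only [hS, phase, mul_add, Finset.sum_add_distrib]; ring
    rw [e1, e2, Real.cos_sub, Real.cos_add]; ring
  simp only [hpt]
  have hb : BddMeas fun t : Tape =>
      Real.cos (S (fun i => w i + w' i) t + 4 * Real.pi * t (s + 2 * M)) :=
    BddMeas.cos ((hSm _).add (by fun_prop))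
  have hb' : BddMeas fun t : Tape => Real.cos (0 + S (fun i => w i - w' i) t) :=
    BddMeas.cos (measurable_const.add (hSm _))
  have h₀ : ∫ t : Tape, Real.cos (0 + S (fun i => w i - w' i) t) ∂tapeLaw = _ :=
    integral_cos_sum s (fun i => w i - w' i) M 0
  rw [integral_add hb'.integrable hb.integrable, h₀, Real.cos_zero, one_mul, hb.integral_merge {s + 2 * M}]
  have h1 : ∀ t t' : Tape, Real.cos (S (fun i => w i + w' i) (merge {s + 2 * M} t t') +
      4 * Real.pi * merge {s + 2 * M} t t' (s + 2 * M)) =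
      Real.cos (S (fun i => w i + w' i) t + 4 * Real.pi * t' (s + 2 * M)) := fun t t' => by
    rw [merge_of_mem (Set.mem_singleton _)]
    congr 2
    refine Finset.sum_congr rfl fun i hi => ?_
    have := Finset.mem_range.1 hi
    rw [merge_of_notMem (by simp; omega), merge_of_notMem (by simp; omega)]
  have h2 : ∀ D : ℝ, ∫ t' : Tape, Real.cos (D + 4 * Real.pi * t' (s + 2 * M)) ∂tapeLaw = 0 :=
    fun D => by
      rw [integral_cell (s + 2 * M) (f := fun x => Real.cos (D + 4 * Real.pi * x)) (by fun_prop),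
        integral_cos_add_four_pi]
  simp only [h1, h2, integral_zero, add_zero]

/-! ### The second moment of the count sketch -/

/-- The first component is the remainder of the binary expansion. It is bounded by 1 non-strictly so
that `u = 1` is included, which lands in the last bucket. -/
theorem hashStep_iterate (l : ℕ) {u : ℝ} (h₀ : 0 ≤ u) (h₁ : u ≤ 1) :
    (hashStep^[l] (u, 0)).1 = 2 ^ l * u - (hashStep^[l] (u, 0)).2 ∧
      0 ≤ (hashStep^[l] (u, 0)).1 ∧ (hashStep^[l] (u, 0)).1 ≤ 1 ∧
      (hashStep^[l] (u, 0)).2 + 1 ≤ 2 ^ l := by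
  induction l with
  | zero => simp [h₀, h₁]
  | succ l ih =>
    obtain ⟨e, g₀, g₁, g₂⟩ := ih
    rw [Function.iterate_succ_apply']
    generalize hashStep^[l] (u, 0) = p at *
    by_cases h : p.1 + p.1 < 1
    · simp only [hashStep, if_pos h]
      refine ⟨?_, by linarith, by linarith, by rw [pow_succ]; omega⟩
      push_cast; rw [pow_succ]; linarith
    · simp only [hashStep, if_neg h]
      refine ⟨?_, by linarith, by linarith, by rw [pow_succ]; omega⟩
      push_cast; rw [pow_succ]; linarith

theorem bucket_lt (l : ℕ) (u : unitInterval) : bucket l u < 2 ^ l :=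
  (hashStep_iterate l u.2.1 u.2.2).2.2.2

theorem measurable_bucket (l : ℕ) : Measurable (bucket l) := by
  have h : Measurable hashStep := by
    unfold hashStep
    refine Measurable.ite (measurableSet_lt (by fun_prop) measurable_const) ?_ ?_
    · exact Measurable.prodMk (by fun_prop) (by fun_prop)
    · exact Measurable.prodMk (by fun_prop) (by fun_prop)
  exact measurable_snd.comp ((h.iterate l).comp (by fun_prop : Measurable fun u : ℝ => (u, (0 : ℕ))))

/-- A bucket is contained in a closed dyadic interval; the upper bound on its measure is all that
the collision estimate needs. -/
theorem volume_bucket_le (l b : ℕ) :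
    volume.real {u : unitInterval | bucket l u = b} ≤ 1 / 2 ^ l := by
  have hsub : {u : unitInterval | bucket l u = b} ⊆
      ((↑) : unitInterval → ℝ) ⁻¹' (Set.Icc ((b : ℝ) / 2 ^ l) ((b + 1) / 2 ^ l)) := by
    intro u (hu : bucket l u = b)
    obtain ⟨e, g₀, g₁, -⟩ := hashStep_iterate l u.2.1 u.2.2
    rw [bucket] at hu
    rw [hu] at e
    simp only [Set.mem_preimage, Set.mem_Icc]
    rw [div_le_iff₀ (by positivity), le_div_iff₀ (by positivity)]
    constructor <;> linarith
  have hvol : volume {u : unitInterval | bucket l u = b} ≤ ENNReal.ofReal (1 / 2 ^ l) := by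
    refine (measure_mono hsub).trans ?_
    rw [unitInterval.volume_apply]
    refine (measure_mono (Set.image_preimage_subset _ _)).trans ?_
    rw [Real.volume_Icc]
    exact ENNReal.ofReal_le_ofReal (le_of_eq (by ring))
  exact ENNReal.toReal_le_of_le_ofReal (by positivity) hvol

/-- The cell of coordinate `k` of a point, as a function of the tape. -/
def cellAt (l d : ℕ) (t : Tape) (k : ℕ) : ℕ := sketchCell (2 ^ l) l d k (t (2 * k))

/-- The sign of coordinate `k` of a point, as a function of the tape. -/
def signAt (t : Tape) (k : ℕ) : ℝ := signed (t (2 * k + 1)) 1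

theorem signed_eq_mul (v x : ℝ) : signed v x = signed v 1 * x := by
  unfold signed; split_ifs <;> ring

theorem signAt_sq (t : Tape) (k : ℕ) : signAt t k ^ 2 = 1 := by
  unfold signAt signed; split_ifs <;> norm_num

theorem measurable_cellAt (l d k : ℕ) : Measurable fun t => cellAt l d t k := by
  unfold cellAt sketchCell
  split_ifs
  · exact (measurable_bucket l).comp
      (by fun_prop : Measurable fun t : Tape => ((t (2 * k) : unitInterval) : ℝ))
  · exact measurable_const

theorem cellAt_lt {l d k : ℕ} (hk : k < d) (t : Tape) : cellAt l d t k < sketchDim (2 ^ l) d := by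
  unfold cellAt sketchCell sketchDim
  split_ifs
  · exact bucket_lt l _
  · exact hk

theorem bddMeas_signAt (k : ℕ) : BddMeas fun t => signAt t k := by
  unfold signAt signed
  exact BddMeas.ite (measurableSet_lt (by fun_prop) measurable_const) _ _

theorem integral_signAt (k : ℕ) : ∫ t, signAt t k ∂tapeLaw = 0 := by
  have hm : MeasurableSet {x : unitInterval | (x : ℝ) < 1 / 2} :=
    measurableSet_lt (by fun_prop) measurable_const
  have hs : ∀ x : unitInterval,
      signed x 1 = 2 * {x : unitInterval | (x : ℝ) < 1 / 2}.indicator 1 x - 1 := fun x => by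
    by_cases h : (x : ℝ) < 1 / 2
    · rw [Set.indicator_of_mem (by exact h), signed, if_pos h]; norm_num
    · rw [Set.indicator_of_notMem (by exact h), signed, if_neg h]; norm_num
  have hv : volume.real {x : unitInterval | (x : ℝ) < 1 / 2} = 1 / 2 := by
    have := volume_lt_eq_bern (p := 1 / 2) (by norm_num) (by norm_num) true
    simp only [decide_eq_true_eq] at this
    rw [Measure.real, this, ENNReal.toReal_ofReal (by norm_num)]
    rfl
  have hmeas : Measurable fun x : unitInterval => signed x 1 := by
    simp only [hs]
    exact ((measurable_one.indicator hm).const_mul 2).sub_const 1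
  unfold signAt
  rw [integral_cell (2 * k + 1) (f := fun x => signed x 1) hmeas]
  simp only [hs]
  rw [integral_sub, integral_const_mul, integral_indicator_one hm, hv]
  · simp
  · exact ((integrable_const (1 : ℝ)).indicator hm).const_mul 2
  · exact integrable_const _

theorem integral_mul_signAt {f : Tape → ℝ} (hf : BddMeas f) (k : ℕ)
    (h : ∀ t t', f (merge {2 * k + 1} t t') = f t) : ∫ t, f t * signAt t k ∂tapeLaw = 0 := by
  refine integral_mul_eq_zero {2 * k + 1} hf (bddMeas_signAt k) h fun t => ?_
  have : ∀ t' : Tape, signAt (merge {2 * k + 1} t t') k = signAt t' k := fun t' => by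
    unfold signAt
    rw [merge_of_mem (Set.mem_singleton _)]
  simp only [this, integral_signAt]

theorem cellAt_merge_odd (l d j k : ℕ) (t t' : Tape) :
    cellAt l d (merge {2 * k + 1} t t') j = cellAt l d t j := by
  unfold cellAt
  rw [merge_of_notMem (by simp; omega)]

theorem signAt_merge_odd {j k : ℕ} (h : j ≠ k) (t t' : Tape) :
    signAt (merge {2 * k + 1} t t') j = signAt t j := by
  unfold signAt
  rw [merge_of_notMem (by simp; omega)]

/-- The indicator of a collision. -/
def collision (l d i k : ℕ) (t : Tape) : ℝ := if cellAt l d t i = cellAt l d t k then 1 else 0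

theorem bddMeas_collision (l d i k : ℕ) : BddMeas (collision l d i k) :=
  BddMeas.ite (measurableSet_eq_fun (measurable_cellAt l d i) (measurable_cellAt l d k)) _ _

theorem collision_sq (l d i k : ℕ) (t : Tape) : collision l d i k t ^ 2 = collision l d i k t := by
  unfold collision; split_ifs <;> norm_num

/-- Resampling the hash value of `k` alone makes it hit the fixed bucket of `i` with probability at
most `2^{-l}`. Without hashing, distinct coordinates never collide. -/
theorem integral_collision_le {l d i k : ℕ} (h : i ≠ k) :
    ∫ t, collision l d i k t ∂tapeLaw ≤ 1 / 2 ^ l := by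
  by_cases hd : 2 ^ l < d
  · rw [(bddMeas_collision l d i k).integral_merge {2 * k}]
    have h1 : ∀ t t' : Tape, collision l d i k (merge {2 * k} t t') =
        {u : unitInterval | bucket l u = bucket l (t (2 * i))}.indicator 1 (t' (2 * k)) :=
      fun t t' => by
        unfold collision cellAt sketchCell
        rw [merge_of_mem (Set.mem_singleton _), merge_of_notMem (by simp; omega), if_pos hd]
        by_cases hb : bucket l (t (2 * i)) = bucket l (t' (2 * k))
        · simp [hd, hb]
        · simp [hd, hb, Ne.symm hb]
    have hm : ∀ b, MeasurableSet {u : unitInterval | bucket l u = b} := fun b =>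
      ((measurable_bucket l).comp measurable_subtype_coe) (measurableSet_singleton b)
    have h2 : ∀ t : Tape, ∫ t', collision l d i k (merge {2 * k} t t') ∂tapeLaw ≤ 1 / 2 ^ l :=
      fun t => by
        simp only [h1]
        rw [integral_cell (2 * k) (measurable_one.indicator (hm _)),
          integral_indicator_one (hm _)]
        exact volume_bucket_le l _
    calc _ ≤ ∫ t : Tape, (1 / 2 ^ l : ℝ) ∂tapeLaw :=
          integral_mono_of_nonneg (Filter.Eventually.of_forall fun t => integral_nonneg fun t' => by
            simp only [collision]; split_ifs <;> norm_num) (integrable_const _)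
            (Filter.Eventually.of_forall h2)
      _ = _ := by simp
  · have : ∀ t, collision l d i k t = 0 := fun t => by
      simp [collision, cellAt, sketchCell, hd, h]
    simp only [this, integral_zero]
    positivity

theorem sketch_eq_sum (l d : ℕ) (t : Tape) (x : ℕ → ℝ) (k b : ℕ) :
    sketch (2 ^ l) l d (tapeArray t) x k b =
      ∑ i ∈ Finset.range k, if cellAt l d t i = b then signAt t i * x i else 0 := by
  induction k with
  | zero => rfl
  | succ k ih =>
    rw [sketch, Finset.sum_range_succ, ← ih, Function.update_apply]
    have e : sketchCell (2 ^ l) l d k (tapeArray t (2 * k)) = cellAt l d t k := rfl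
    rw [e, signed_eq_mul]
    by_cases h : b = cellAt l d t k
    · subst h; simp only [if_true]; rfl
    · rw [if_neg h, if_neg (Ne.symm h), add_zero]

/-- The part of the cell of coordinate `k` that comes from the first `m` coordinates. -/
def load (l d : ℕ) (z : ℕ → ℝ) (k m : ℕ) (t : Tape) : ℝ :=
  ∑ i ∈ Finset.range m, collision l d i k t * (signAt t i * z i)

theorem sketch_cellAt (l d : ℕ) (z : ℕ → ℝ) (k m : ℕ) (t : Tape) :
    sketch (2 ^ l) l d (tapeArray t) z m (cellAt l d t k) = load l d z k m t := by
  rw [sketch_eq_sum, load]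
  exact Finset.sum_congr rfl fun i _ => by rw [collision, ite_mul, one_mul, zero_mul]

theorem bddMeas_load (l d : ℕ) (z : ℕ → ℝ) (k m : ℕ) : BddMeas (load l d z k m) :=
  BddMeas.sum _ fun i =>
    (bddMeas_collision l d i k).mul ((bddMeas_signAt i).mul (BddMeas.const _))

theorem collision_merge_odd (l d i k m : ℕ) (t t' : Tape) :
    collision l d i k (merge {2 * m + 1} t t') = collision l d i k t := by
  simp only [collision, cellAt_merge_odd]

theorem load_merge_odd (l d : ℕ) (z : ℕ → ℝ) (k : ℕ) {m m' : ℕ} (h : m ≤ m') (t t' : Tape) :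
    load l d z k m (merge {2 * m' + 1} t t') = load l d z k m t := by
  simp only [load]
  refine Finset.sum_congr rfl fun i hi => ?_
  have := Finset.mem_range.1 hi
  rw [collision_merge_odd, signAt_merge_odd (by omega)]

/-- Add coordinates one at a time: the sign of the new one is independent of everything else, so the
cross term vanishes and only its collision probability remains. The bound `m ≤ k` keeps coordinate
`k` itself out of the sum. -/
theorem integral_load_sq_le (l d : ℕ) (z : ℕ → ℝ) {k m : ℕ} (h : m ≤ k) :
    ∫ t, load l d z k m t ^ 2 ∂tapeLaw ≤ (∑ i ∈ Finset.range m, z i ^ 2) / 2 ^ l := by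
  induction m with
  | zero => simp [load]
  | succ m ih =>
    have hpt : ∀ t, load l d z k (m + 1) t ^ 2 = load l d z k m t ^ 2 +
        (2 * z m * (load l d z k m t * collision l d m k t * signAt t m) +
          z m ^ 2 * collision l d m k t) := fun t => by
      have e : load l d z k (m + 1) t = load l d z k m t + collision l d m k t * (signAt t m * z m) :=
        Finset.sum_range_succ _ _
      rw [e]
      linear_combination (collision l d m k t) ^ 2 * z m ^ 2 * signAt_sq t m +
        z m ^ 2 * collision_sq l d m k t
    have hL := bddMeas_load l d z k m
    have hC := bddMeas_collision l d m k
    have hLC := hL.mul hC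
    have hA := (hLC.mul (bddMeas_signAt m)).const_mul (2 * z m)
    have hB := hC.const_mul (z m ^ 2)
    simp only [hpt]
    rw [integral_add hL.pow_two.integrable (hA.add hB).integrable,
      integral_add hA.integrable hB.integrable, integral_const_mul, integral_const_mul,
      integral_mul_signAt hLC m fun t t' => by rw [load_merge_odd _ _ _ _ le_rfl,
        collision_merge_odd], mul_zero, zero_add, Finset.sum_range_succ, add_div]
    refine add_le_add (ih (by omega)) ?_
    rw [div_eq_mul_one_div]
    exact mul_le_mul_of_nonneg_left (integral_collision_le (by omega)) (sq_nonneg _)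

/-- The squared norm of the sketch of the first `m` coordinates. -/
def sketchNorm (l d : ℕ) (z : ℕ → ℝ) (m : ℕ) (t : Tape) : ℝ :=
  ∑ b ∈ Finset.range (sketchDim (2 ^ l) d), sketch (2 ^ l) l d (tapeArray t) z m b ^ 2

theorem bddMeas_sketch (l d : ℕ) (z : ℕ → ℝ) (m b : ℕ) :
    BddMeas fun t => sketch (2 ^ l) l d (tapeArray t) z m b := by
  simp only [sketch_eq_sum]
  refine BddMeas.sum _ fun i => ?_
  have e : ∀ t, (if cellAt l d t i = b then signAt t i * z i else 0) =
      (if cellAt l d t i = b then 1 else 0) * (signAt t i * z i) := fun t => by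
    rw [ite_mul, one_mul, zero_mul]
  simp only [e]
  exact (BddMeas.ite (measurable_cellAt l d i (measurableSet_singleton b)) _ _).mul
    ((bddMeas_signAt i).mul (BddMeas.const _))

theorem bddMeas_sketchNorm (l d : ℕ) (z : ℕ → ℝ) (m : ℕ) : BddMeas (sketchNorm l d z m) :=
  BddMeas.sum _ fun b => (bddMeas_sketch l d z m b).pow_two

theorem sketchNorm_succ (l d : ℕ) (z : ℕ → ℝ) {m : ℕ} (h : m < d) (t : Tape) :
    sketchNorm l d z (m + 1) t =
      sketchNorm l d z m t + 2 * z m * (load l d z m m t * signAt t m) + z m ^ 2 := by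
  have hc := Finset.mem_range.2 (cellAt_lt (l := l) h t)
  have hpt : ∀ b, sketch (2 ^ l) l d (tapeArray t) z (m + 1) b ^ 2 =
      sketch (2 ^ l) l d (tapeArray t) z m b ^ 2 + if cellAt l d t m = b then
        2 * z m * (load l d z m m t * signAt t m) + z m ^ 2 else 0 := fun b => by
    rw [sketch_eq_sum l d t z (m + 1), Finset.sum_range_succ, ← sketch_eq_sum]
    split_ifs with hb
    · subst hb
      rw [sketch_cellAt]
      linear_combination z m ^ 2 * signAt_sq t m
    · ring
  rw [sketchNorm, Finset.sum_congr rfl fun b _ => hpt b, Finset.sum_add_distrib,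
    Finset.sum_ite_eq, if_pos hc, sketchNorm]
  ring

theorem sketchNorm_merge_odd (l d : ℕ) (z : ℕ → ℝ) (m : ℕ) (t t' : Tape) :
    sketchNorm l d z m (merge {2 * m + 1} t t') = sketchNorm l d z m t := by
  simp only [sketchNorm, sketch_eq_sum, cellAt_merge_odd]
  refine Finset.sum_congr rfl fun b _ => ?_
  congr 1
  refine Finset.sum_congr rfl fun i hi => ?_
  rw [signAt_merge_odd (Finset.mem_range.1 hi).ne]

/-- By `sketchNorm_succ` the centred squared norm is a martingale with increments `2 z_m σ_m` times
the load of the cell. The fresh sign removes the cross term, the squared increment has mean at most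
`4 z_m² μ / 2^l`, and this fits into `2(μ + z_m²)² - 2μ²`. -/
theorem integral_sketchNorm_sub_sq_le (l d : ℕ) (z : ℕ → ℝ) {m : ℕ} (h : m ≤ d) :
    ∫ t, (sketchNorm l d z m t - ∑ i ∈ Finset.range m, z i ^ 2) ^ 2 ∂tapeLaw ≤
      2 * (∑ i ∈ Finset.range m, z i ^ 2) ^ 2 / 2 ^ l := by
  induction m with
  | zero => simp [sketchNorm, sketch]
  | succ m ih =>
    rw [Finset.sum_range_succ]
    set μ := ∑ i ∈ Finset.range m, z i ^ 2 with hμ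
    have hμ₀ : 0 ≤ μ := Finset.sum_nonneg fun _ _ => sq_nonneg _
    have hpt : ∀ t, (sketchNorm l d z (m + 1) t - (μ + z m ^ 2)) ^ 2 =
        (sketchNorm l d z m t - μ) ^ 2 +
          (4 * z m * ((sketchNorm l d z m t - μ) * load l d z m m t * signAt t m) +
            4 * z m ^ 2 * load l d z m m t ^ 2) := fun t => by
      rw [sketchNorm_succ l d z (by omega) t]
      linear_combination 4 * z m ^ 2 * load l d z m m t ^ 2 * signAt_sq t m
    have hQ := (bddMeas_sketchNorm l d z m).sub (BddMeas.const μ)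
    have hL := bddMeas_load l d z m m
    have hA := ((hQ.mul hL).mul (bddMeas_signAt m)).const_mul (4 * z m)
    have hB := hL.pow_two.const_mul (4 * z m ^ 2)
    simp only [hpt]
    rw [integral_add hQ.pow_two.integrable (hA.add hB).integrable,
      integral_add hA.integrable hB.integrable, integral_const_mul, integral_const_mul,
      integral_mul_signAt (hQ.mul hL) m fun t t' => by rw [load_merge_odd _ _ _ _ le_rfl,
        sketchNorm_merge_odd], mul_zero, zero_add]
    have h1 := ih (by omega)
    have h2 := mul_le_mul_of_nonneg_left (integral_load_sq_le l d z (le_refl m))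
      (by positivity : 0 ≤ 4 * z m ^ 2)
    rw [← hμ] at h2
    refine (add_le_add h1 h2).trans ?_
    rw [← mul_div_assoc, ← add_div]
    refine div_le_div_of_nonneg_right ?_ (by positivity)
    nlinarith [sq_nonneg (z m ^ 2)]

/-! ### From the squared norm to the Gaussian kernel -/

theorem abs_exp_neg_sub_le {X μ : ℝ} (hX : 0 ≤ X) (hμ : 0 ≤ μ) :
    |Real.exp (-X) - Real.exp (-μ)| ≤ |X - μ| := by
  rcases le_total X μ with h | h
  · rw [abs_of_nonneg (sub_nonneg.2 (Real.exp_le_exp.2 (by linarith))), abs_of_nonpos (by linarith)]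
    have h1 : Real.exp (-μ) = Real.exp (-X) * Real.exp (X - μ) := by rw [← Real.exp_add]; ring_nf
    have h2 := Real.add_one_le_exp (X - μ)
    have h3 : Real.exp (-X) ≤ 1 := Real.exp_le_one_iff.2 (by linarith)
    have h4 := Real.exp_pos (-X)
    rw [h1]
    nlinarith
  · rw [abs_of_nonpos (sub_nonpos.2 (Real.exp_le_exp.2 (by linarith))), abs_of_nonneg (by linarith)]
    have h1 : Real.exp (-X) = Real.exp (-μ) * Real.exp (μ - X) := by rw [← Real.exp_add]; ring_nf
    have h2 := Real.add_one_le_exp (μ - X)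
    have h3 : Real.exp (-μ) ≤ 1 := Real.exp_le_one_iff.2 (by linarith)
    have h4 := Real.exp_pos (-μ)
    rw [h1]
    nlinarith

/-- If `X ≤ μ/2`, then `|X - μ| ≥ μ/2` while the exponentials differ by at most 1. Otherwise both
contain the factor `exp(-μ/2)`, and `μ exp(-μ/2) ≤ 2`. -/
theorem mul_abs_exp_neg_sub_le {X μ : ℝ} (hX : 0 ≤ X) (hμ : 0 ≤ μ) :
    μ * |Real.exp (-X) - Real.exp (-μ)| ≤ 2 * |X - μ| := by
  rcases le_total X (μ / 2) with h | h
  · rw [abs_of_nonpos (by linarith : X - μ ≤ 0)]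
    have h1 : |Real.exp (-X) - Real.exp (-μ)| ≤ 1 := by
      rw [abs_of_nonneg (sub_nonneg.2 (Real.exp_le_exp.2 (by linarith)))]
      have h3 : Real.exp (-X) ≤ 1 := Real.exp_le_one_iff.2 (by linarith)
      have h4 := Real.exp_pos (-μ)
      linarith
    nlinarith
  · have h1 := abs_exp_neg_sub_le (sub_nonneg.2 h) (by linarith : 0 ≤ μ - μ / 2)
    have e : Real.exp (-X) - Real.exp (-μ) =
        Real.exp (-(μ / 2)) * (Real.exp (-(X - μ / 2)) - Real.exp (-(μ - μ / 2))) := by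
      rw [mul_sub, ← Real.exp_add, ← Real.exp_add]; ring_nf
    rw [e, abs_mul, abs_of_pos (Real.exp_pos _)]
    rw [sub_sub_sub_cancel_right] at h1
    have h2 : μ * Real.exp (-(μ / 2)) ≤ 2 := by
      rw [Real.exp_neg, ← div_eq_mul_inv, div_le_iff₀ (Real.exp_pos _)]
      linarith [Real.add_one_le_exp (μ / 2)]
    rw [← mul_assoc]
    exact mul_le_mul h2 h1 (abs_nonneg _) (by norm_num)

theorem sketchNorm_nonneg (l d : ℕ) (z : ℕ → ℝ) (m : ℕ) (t : Tape) : 0 ≤ sketchNorm l d z m t :=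
  Finset.sum_nonneg fun _ _ => sq_nonneg _

theorem bddMeas_exp_sketchNorm (l d : ℕ) (z : ℕ → ℝ) (m : ℕ) :
    BddMeas fun t => Real.exp (-sketchNorm l d z m t) := by
  refine ⟨((bddMeas_sketchNorm l d z m).1.neg).exp, 1, fun t => ?_⟩
  rw [abs_of_pos (Real.exp_pos _)]
  exact Real.exp_le_one_iff.2 (neg_nonpos.2 (sketchNorm_nonneg l d z m t))

/-- The count sketch preserves the Gaussian kernel on average. -/
theorem integral_exp_sketchNorm_sub_sq_le (l d : ℕ) (z : ℕ → ℝ) :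
    ∫ t, (Real.exp (-sketchNorm l d z d t) - Real.exp (-∑ i ∈ Finset.range d, z i ^ 2)) ^ 2
      ∂tapeLaw ≤ 8 / 2 ^ l := by
  set μ := ∑ i ∈ Finset.range d, z i ^ 2 with hμ
  have hμ₀ : 0 ≤ μ := Finset.sum_nonneg fun _ _ => sq_nonneg _
  have hV : ∫ t, (sketchNorm l d z d t - μ) ^ 2 ∂tapeLaw ≤ 2 * μ ^ 2 / 2 ^ l :=
    integral_sketchNorm_sub_sq_le l d z le_rfl
  have hE := ((bddMeas_exp_sketchNorm l d z d).sub (BddMeas.const (Real.exp (-μ)))).pow_two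
  have hQ := ((bddMeas_sketchNorm l d z d).sub (BddMeas.const μ)).pow_two
  -- The variance grows like `2μ²`. For `μ ≤ 2` the Lipschitz bound gives `2μ² ≤ 8`; for larger `μ`
  -- the Lipschitz constant `2/μ` cancels `μ²` and again leaves `4 · 2 = 8`.
  rcases le_or_gt μ 2 with h | h
  · refine (integral_mono hE.integrable hQ.integrable fun t => ?_).trans (hV.trans ?_)
    · exact sq_le_sq.2 (abs_exp_neg_sub_le (sketchNorm_nonneg l d z d t) hμ₀)
    · refine div_le_div_of_nonneg_right ?_ (by positivity)
      nlinarith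
  · have h1 : ∫ t, μ ^ 2 * (Real.exp (-sketchNorm l d z d t) - Real.exp (-μ)) ^ 2 ∂tapeLaw ≤
        ∫ t, 4 * (sketchNorm l d z d t - μ) ^ 2 ∂tapeLaw :=
      integral_mono (hE.const_mul _).integrable (hQ.const_mul _).integrable fun t => by
        have := mul_abs_exp_neg_sub_le (sketchNorm_nonneg l d z d t) hμ₀
        have := pow_le_pow_left₀ (mul_nonneg hμ₀ (abs_nonneg _)) this 2
        rw [mul_pow, mul_pow, sq_abs, sq_abs] at this
        norm_num at this
        exact this
    rw [integral_const_mul, integral_const_mul] at h1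
    have h2 : μ ^ 2 * ∫ t, (Real.exp (-sketchNorm l d z d t) - Real.exp (-μ)) ^ 2 ∂tapeLaw ≤
        μ ^ 2 * (8 / 2 ^ l) := by
      refine h1.trans ((mul_le_mul_of_nonneg_left hV (by norm_num)).trans (le_of_eq ?_))
      ring
    exact le_of_mul_le_mul_left h2 (by positivity)

/-! ### The error of the random features -/

/-- The part of the public tape that instance `j` alone uses. -/
def block (I d j : ℕ) : Set ℕ :=
  Set.Ico (blockStart I d j) (blockStart I d j + (2 * sketchDim I d + 1))

theorem mem_block {I d j i : ℕ} : i ∈ block I d j ↔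
    blockStart I d j ≤ i ∧ i < blockStart I d j + (2 * sketchDim I d + 1) := Iff.rfl

theorem blockStart_add_le (I d : ℕ) {j j' : ℕ} (h : j < j') :
    blockStart I d j + (2 * sketchDim I d + 1) ≤ blockStart I d j' := by
  have := Nat.mul_le_mul_right (2 * sketchDim I d + 1) (Nat.succ_le_of_lt h)
  rw [Nat.succ_mul] at this
  unfold blockStart
  omega

theorem phase_merge_block (I d j : ℕ) (w : ℕ → ℝ) (t t' : Tape) :
    phase (sketchDim I d) (blockStart I d j) w (merge (block I d j) t t') =
      phase (sketchDim I d) (blockStart I d j) w t' := by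
  unfold phase
  congr 1
  · refine Finset.sum_congr rfl fun i hi => ?_
    have := Finset.mem_range.1 hi
    rw [merge_of_mem (mem_block.2 (by omega)), merge_of_mem (mem_block.2 (by omega))]
  · rw [merge_of_mem (mem_block.2 (by omega))]

theorem phase_merge_block_of_lt (I d : ℕ) {j j' : ℕ} (h : j < j') (w : ℕ → ℝ) (t t' : Tape) :
    phase (sketchDim I d) (blockStart I d j) w (merge (block I d j') t t') =
      phase (sketchDim I d) (blockStart I d j) w t := by
  have := blockStart_add_le I d h
  unfold phase
  congr 1
  · refine Finset.sum_congr rfl fun i hi => ?_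
    have := Finset.mem_range.1 hi
    rw [merge_of_notMem (mt mem_block.1 (by omega)), merge_of_notMem (mt mem_block.1 (by omega))]
  · rw [merge_of_notMem (mt mem_block.1 (by omega))]

theorem sketch_merge_block (l d j : ℕ) (x : ℕ → ℝ) (t t' : Tape) :
    sketch (2 ^ l) l d (tapeArray (merge (block (2 ^ l) d j) t t')) x d =
      sketch (2 ^ l) l d (tapeArray t) x d := by
  have hs : 2 * d ≤ blockStart (2 ^ l) d j := Nat.le_add_right _ _
  funext b
  rw [sketch_eq_sum, sketch_eq_sum]
  refine Finset.sum_congr rfl fun i hi => ?_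
  have := Finset.mem_range.1 hi
  unfold cellAt signAt
  rw [merge_of_notMem (mt mem_block.1 (by omega)), merge_of_notMem (mt mem_block.1 (by omega))]

theorem feature_eq_cos_phase (l d : ℕ) (t : Tape) (x : ℕ → ℝ) (j : ℕ) :
    feature (2 ^ l) l d (tapeArray t) x j = Real.cos (phase (sketchDim (2 ^ l) d)
      (blockStart (2 ^ l) d j) (sketch (2 ^ l) l d (tapeArray t) x d) t) := rfl

theorem bddMeas_feature (l d : ℕ) (x : ℕ → ℝ) (j : ℕ) :
    BddMeas fun t => feature (2 ^ l) l d (tapeArray t) x j := by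
  simp only [feature_eq_cos_phase]
  refine BddMeas.cos ?_
  unfold phase
  refine Measurable.add (Finset.measurable_fun_sum _ fun i _ =>
    (measurable_boxMuller _ _).mul (bddMeas_sketch l d x d i).1) (by fun_prop)

/-- The deviation of the product of two features from the kernel of the sketches. -/
def deviation (l d : ℕ) (x y : ℕ → ℝ) (j : ℕ) (t : Tape) : ℝ :=
  2 * (feature (2 ^ l) l d (tapeArray t) x j * feature (2 ^ l) l d (tapeArray t) y j) -
    Real.exp (-sketchNorm l d (fun i => x i - y i) d t)

theorem bddMeas_deviation (l d : ℕ) (x y : ℕ → ℝ) (j : ℕ) : BddMeas (deviation l d x y j) :=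
  (((bddMeas_feature l d x j).mul (bddMeas_feature l d y j)).const_mul 2).sub
    (bddMeas_exp_sketchNorm l d _ d)

theorem abs_deviation_le (l d : ℕ) (x y : ℕ → ℝ) (j : ℕ) (t : Tape) :
    |deviation l d x y j t| ≤ 3 := by
  have h1 : |feature (2 ^ l) l d (tapeArray t) x j * feature (2 ^ l) l d (tapeArray t) y j| ≤ 1 := by
    rw [abs_mul]
    exact mul_le_one₀ (Real.abs_cos_le_one _) (abs_nonneg _) (Real.abs_cos_le_one _)
  have h2 : Real.exp (-sketchNorm l d (fun i => x i - y i) d t) ≤ 1 :=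
    Real.exp_le_one_iff.2 (neg_nonpos.2 (sketchNorm_nonneg l d _ d t))
  have h3 := Real.exp_pos (-sketchNorm l d (fun i => x i - y i) d t)
  have := abs_le.1 h1
  rw [deviation, abs_le]
  constructor <;> linarith

theorem sketchNorm_sub (l d : ℕ) (x y : ℕ → ℝ) (m : ℕ) (t : Tape) :
    sketchNorm l d (fun i => x i - y i) m t = ∑ b ∈ Finset.range (sketchDim (2 ^ l) d),
      (sketch (2 ^ l) l d (tapeArray t) x m b - sketch (2 ^ l) l d (tapeArray t) y m b) ^ 2 := by
  rw [sketchNorm]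
  refine Finset.sum_congr rfl fun b _ => ?_
  rw [sketch_eq_sum, sketch_eq_sum, sketch_eq_sum, ← Finset.sum_sub_distrib]
  congr 1
  refine Finset.sum_congr rfl fun i _ => ?_
  split_ifs <;> ring

theorem sketchNorm_merge_block (l d j : ℕ) (z : ℕ → ℝ) (t t' : Tape) :
    sketchNorm l d z d (merge (block (2 ^ l) d j) t t') = sketchNorm l d z d t := by
  simp only [sketchNorm, sketch_merge_block]

/-- Resampling the block of instance `j` leaves the sketch fixed, and given the sketch the features
are unbiased for its kernel. -/
theorem integral_deviation_merge (l d : ℕ) (x y : ℕ → ℝ) (j : ℕ) (t : Tape) :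
    ∫ t', deviation l d x y j (merge (block (2 ^ l) d j) t t') ∂tapeLaw = 0 := by
  simp only [deviation, feature_eq_cos_phase, sketch_merge_block, phase_merge_block,
    sketchNorm_merge_block]
  have hb : BddMeas fun t' => 2 * (Real.cos (phase (sketchDim (2 ^ l) d) (blockStart (2 ^ l) d j)
        (sketch (2 ^ l) l d (tapeArray t) x d) t') *
      Real.cos (phase (sketchDim (2 ^ l) d) (blockStart (2 ^ l) d j)
        (sketch (2 ^ l) l d (tapeArray t) y d) t')) :=
    ((BddMeas.cos (measurable_phase _ _ _)).mul (BddMeas.cos (measurable_phase _ _ _))).const_mul 2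
  rw [integral_sub hb.integrable (integrable_const _), integral_cos_phase_mul, sketchNorm_sub]
  simp

theorem deviation_merge_of_lt (l d : ℕ) (x y : ℕ → ℝ) {j j' : ℕ} (h : j < j') (t t' : Tape) :
    deviation l d x y j (merge (block (2 ^ l) d j') t t') = deviation l d x y j t := by
  simp only [deviation, feature_eq_cos_phase, sketch_merge_block, phase_merge_block_of_lt _ _ h,
    sketchNorm_merge_block]

/-- The deviations of different instances share the sketch but are uncorrelated, since each has
conditional mean 0 over its own block. Each is at most 3 in absolute value. -/
theorem integral_sum_deviation_sq_le (l d : ℕ) (x y : ℕ → ℝ) (m : ℕ) :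
    ∫ t, (∑ j ∈ Finset.range m, deviation l d x y j t) ^ 2 ∂tapeLaw ≤ 9 * m := by
  induction m with
  | zero => simp
  | succ m ih =>
    have hS : BddMeas fun t => ∑ j ∈ Finset.range m, deviation l d x y j t :=
      BddMeas.sum _ fun j => bddMeas_deviation l d x y j
    have hD := bddMeas_deviation l d x y m
    have hpt : ∀ t, (∑ j ∈ Finset.range (m + 1), deviation l d x y j t) ^ 2 =
        (∑ j ∈ Finset.range m, deviation l d x y j t) ^ 2 +
          (2 * ((∑ j ∈ Finset.range m, deviation l d x y j t) * deviation l d x y m t) +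
            deviation l d x y m t ^ 2) := fun t => by
      rw [Finset.sum_range_succ]; ring
    have h0 : ∫ t, (∑ j ∈ Finset.range m, deviation l d x y j t) * deviation l d x y m t ∂tapeLaw =
        0 := by
      refine integral_mul_eq_zero (block (2 ^ l) d m) hS hD (fun t t' => ?_)
        (integral_deviation_merge l d x y m)
      exact Finset.sum_congr rfl fun j hj =>
        deviation_merge_of_lt l d x y (Finset.mem_range.1 hj) t t'
    have h1 : ∫ t, deviation l d x y m t ^ 2 ∂tapeLaw ≤ 9 := by
      calc _ ≤ ∫ t : Tape, (9 : ℝ) ∂tapeLaw :=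
            integral_mono hD.pow_two.integrable (integrable_const _) fun t => by
              have := pow_le_pow_left₀ (abs_nonneg _) (abs_deviation_le l d x y m t) 2
              rw [sq_abs] at this
              norm_num at this
              exact this
        _ = 9 := by simp
    simp only [hpt]
    rw [integral_add hS.pow_two.integrable ((hS.mul hD).const_mul 2 |>.add hD.pow_two).integrable,
      integral_add ((hS.mul hD).const_mul 2).integrable hD.pow_two.integrable, integral_const_mul,
      h0]
    push_cast
    linarith

/-- Random Fourier features of the count sketch estimate the Gaussian kernel. -/
theorem integral_kernel_sub_sq_le (l d : ℕ) (x y : ℕ → ℝ) :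
    ∫ t, ((∑ j ∈ Finset.range (2 ^ l), 2 * (feature (2 ^ l) l d (tapeArray t) x j *
        feature (2 ^ l) l d (tapeArray t) y j)) / 2 ^ l -
      Real.exp (-∑ i ∈ Finset.range d, (x i - y i) ^ 2)) ^ 2 ∂tapeLaw ≤ 34 / 2 ^ l := by
  set κ := Real.exp (-∑ i ∈ Finset.range d, (x i - y i) ^ 2) with hκ
  set E : Tape → ℝ := fun t => Real.exp (-sketchNorm l d (fun i => x i - y i) d t) with hE
  have hS : BddMeas fun t => ∑ j ∈ Finset.range (2 ^ l), deviation l d x y j t :=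
    BddMeas.sum _ fun j => bddMeas_deviation l d x y j
  have hE' : BddMeas fun t => E t - κ := (bddMeas_exp_sketchNorm l d _ d).sub (BddMeas.const κ)
  have hF : BddMeas fun t => (∑ j ∈ Finset.range (2 ^ l), 2 * (feature (2 ^ l) l d (tapeArray t) x j *
        feature (2 ^ l) l d (tapeArray t) y j)) / 2 ^ l - κ := by
    simp only [div_eq_inv_mul]
    exact ((BddMeas.sum _ fun j => ((bddMeas_feature l d x j).mul
      (bddMeas_feature l d y j)).const_mul 2).const_mul _).sub (BddMeas.const κ)
  -- By `(a + b)² ≤ 2a² + 2b²`, feature error and sketch error give `2 · 9 + 2 · 8 = 34`.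
  have hB := (hS.pow_two.const_mul (2 / (2 ^ l) ^ 2)).add (hE'.pow_two.const_mul 2)
  refine (integral_mono hF.pow_two.integrable hB.integrable fun t => ?_).trans ?_
  · have e : (∑ j ∈ Finset.range (2 ^ l), 2 * (feature (2 ^ l) l d (tapeArray t) x j *
        feature (2 ^ l) l d (tapeArray t) y j)) / 2 ^ l =
        (∑ j ∈ Finset.range (2 ^ l), deviation l d x y j t) / 2 ^ l + E t := by
      simp only [deviation, Finset.sum_sub_distrib, Finset.sum_const, Finset.card_range, nsmul_eq_mul,
        hE]
      field_simp
      push_cast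
      ring
    have e2 : 2 / ((2 : ℝ) ^ l) ^ 2 * (∑ j ∈ Finset.range (2 ^ l), deviation l d x y j t) ^ 2 =
        2 * ((∑ j ∈ Finset.range (2 ^ l), deviation l d x y j t) / 2 ^ l) ^ 2 := by
      rw [div_pow]; ring
    show _ ^ 2 ≤ _
    rw [e, e2]
    nlinarith [sq_nonneg ((∑ j ∈ Finset.range (2 ^ l), deviation l d x y j t) / 2 ^ l - (E t - κ))]
  · rw [integral_add (hS.pow_two.const_mul _).integrable (hE'.pow_two.const_mul _).integrable,
      integral_const_mul, integral_const_mul]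
    have h1 := integral_sum_deviation_sq_le l d x y (2 ^ l)
    have h2 : ∫ t, (E t - κ) ^ 2 ∂tapeLaw ≤ 8 / 2 ^ l :=
      integral_exp_sketchNorm_sub_sq_le l d fun i => x i - y i
    have h3 := mul_le_mul_of_nonneg_left h1 (by positivity : (0 : ℝ) ≤ 2 / (2 ^ l) ^ 2)
    refine (add_le_add h3 (mul_le_mul_of_nonneg_left h2 zero_le_two)).trans (le_of_eq ?_)
    push_cast
    field_simp
    norm_num

/-! ### Kernel estimates for points and for datasets -/

theorem norm_sub_sq_eq_sum {d : ℕ} (x y : Point d) :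
    ‖x - y‖ ^ 2 = ∑ i ∈ Finset.range d, (pointArray x i - pointArray y i) ^ 2 := by
  rw [EuclideanSpace.norm_sq_eq, Finset.sum_range]
  refine Finset.sum_congr rfl fun i _ => ?_
  simp [pointArray]

theorem bddMeas_featureAt {d : ℕ} (α : ℝ) (x : Point d) (j : ℕ) :
    BddMeas fun t => featureAt α t x j :=
  bddMeas_feature (levels α) d (pointArray x) j

/-- The estimate of the kernel at `x` and `y` from the features of `x` and `y`. -/
def kernelEstimate {d : ℕ} (α : ℝ) (t : Tape) (x y : Point d) : ℝ :=
  (∑ j ∈ Finset.range (instances α), 2 * (featureAt α t x j * featureAt α t y j)) / instances α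

theorem bddMeas_kernelEstimate {d : ℕ} (α : ℝ) (x y : Point d) :
    BddMeas fun t => kernelEstimate α t x y := by
  simp only [kernelEstimate, div_eq_inv_mul]
  exact (BddMeas.sum _ fun j =>
    ((bddMeas_featureAt α x j).mul (bddMeas_featureAt α y j)).const_mul 2).const_mul _

theorem integral_kernelEstimate_sub_sq_le {d : ℕ} (α : ℝ) (x y : Point d) :
    ∫ t, (kernelEstimate α t x y - Real.exp (-‖x - y‖ ^ 2)) ^ 2 ∂tapeLaw ≤ 34 / instances α := by
  rw [norm_sub_sq_eq_sum]
  have := integral_kernel_sub_sq_le (levels α) d (pointArray x) (pointArray y)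
  have e : (instances α : ℝ) = 2 ^ levels α := by simp [instances]
  simp only [kernelEstimate, e]
  exact this

/-- All users share the public randomness, so their errors are correlated and averaging gains
nothing; Cauchy–Schwarz shows that it loses nothing. -/
theorem integral_mean_kernelEstimate_sub_sq_le {n d : ℕ} (hn : 0 < n) (α : ℝ)
    (X : Fin n → Point d) (y : Point d) :
    ∫ t, ((∑ u, kernelEstimate α t (X u) y) / n - gaussianKDE X y) ^ 2 ∂tapeLaw ≤
      34 / instances α := by
  have hn' : (0 : ℝ) < n := by exact_mod_cast hn
  have hD : ∀ u, BddMeas fun t => kernelEstimate α t (X u) y - Real.exp (-‖X u - y‖ ^ 2) := fun u =>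
    (bddMeas_kernelEstimate α (X u) y).sub (BddMeas.const _)
  have hpt : ∀ t, ((∑ u, kernelEstimate α t (X u) y) / n - gaussianKDE X y) ^ 2 ≤
      1 / n * ∑ u, (kernelEstimate α t (X u) y - Real.exp (-‖X u - y‖ ^ 2)) ^ 2 := fun t => by
    rw [gaussianKDE, ← sub_div, ← Finset.sum_sub_distrib, div_pow]
    have := sq_sum_le_card_mul_sum_sq (s := Finset.univ)
      (f := fun u => kernelEstimate α t (X u) y - Real.exp (-‖X u - y‖ ^ 2))
    rw [Finset.card_univ, Fintype.card_fin] at this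
    refine (div_le_div_of_nonneg_right this (by positivity)).trans (le_of_eq ?_)
    field_simp
  have hI : ∀ u, Integrable (fun t =>
      (kernelEstimate α t (X u) y - Real.exp (-‖X u - y‖ ^ 2)) ^ 2) tapeLaw :=
    fun u => (hD u).pow_two.integrable
  refine (integral_mono_of_nonneg (Filter.Eventually.of_forall fun t => sq_nonneg _)
    ((integrable_finsetSum _ fun u _ => hI u).const_mul _)
    (Filter.Eventually.of_forall hpt)).trans ?_
  rw [integral_const_mul, integral_finsetSum _ fun u _ => hI u]
  refine (mul_le_mul_of_nonneg_left (Finset.sum_le_sum fun u _ =>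
    integral_kernelEstimate_sub_sq_le α (X u) y) (by positivity)).trans (le_of_eq ?_)
  rw [Finset.sum_const, Finset.card_univ, Fintype.card_fin, nsmul_eq_mul]
  field_simp

/-! ### The error of randomized response -/

theorem sum_colWeight_mul_prod {ι : Type*} [Fintype ι] [DecidableEq ι] (p : ι → ℝ)
    (g : ι → Bool → ℝ) :
    ∑ c, colWeight p c * ∏ u, g u (c u) = ∏ u, ∑ b, bern (p u) b * g u b := by
  rw [← sum_prod_bool]
  simp only [colWeight, Finset.prod_mul_distrib]

theorem sum_colWeight {ι : Type*} [Fintype ι] [DecidableEq ι] (p : ι → ℝ) :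
    ∑ c, colWeight p c = 1 := by
  have := sum_colWeight_mul_prod p fun _ _ => 1
  simpa using this

theorem sum_colWeight_mul_sub {ι : Type*} [Fintype ι] [DecidableEq ι] (p : ι → ℝ) (i : ι) :
    ∑ c, colWeight p c * (bitVal (c i) - p i) = 0 := by
  have := sum_colWeight_mul_prod p fun u b => if u = i then bitVal b - p u else 1
  simp only [Finset.prod_ite_eq', Finset.mem_univ, if_true] at this
  rw [this]
  refine Finset.prod_eq_zero (Finset.mem_univ i) ?_
  simp; ring

theorem sum_colWeight_mul_sub_mul_sub {ι : Type*} [Fintype ι] [DecidableEq ι] (p : ι → ℝ)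
    (i j : ι) :
    ∑ c, colWeight p c * ((bitVal (c i) - p i) * (bitVal (c j) - p j)) =
      if i = j then p i * (1 - p i) else 0 := by
  have := sum_colWeight_mul_prod p fun u b =>
    (if u = i then bitVal b - p u else 1) * (if u = j then bitVal b - p u else 1)
  simp only [Finset.prod_mul_distrib, Finset.prod_ite_eq', Finset.mem_univ, if_true] at this
  rw [this]
  split_ifs with h
  · subst h
    rw [Finset.prod_eq_single i]
    · simp; ring
    · intro u _ hu
      simp [hu]
    · simp
  · refine Finset.prod_eq_zero (Finset.mem_univ i) ?_
    simp [h]; ring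

/-- Decomposition of the mean squared error into variance and squared bias. -/
theorem sum_colWeight_mul_sq_le {ι : Type*} [Fintype ι] [DecidableEq ι] (p a : ι → ℝ) (τ : ℝ) :
    ∑ c, colWeight p c * (∑ i, a i * (bitVal (c i) - p i) + τ) ^ 2 ≤ ∑ i, a i ^ 2 / 4 + τ ^ 2 := by
  have hpt : ∀ c, colWeight p c * (∑ i, a i * (bitVal (c i) - p i) + τ) ^ 2 =
      ∑ i, ∑ j, a i * a j * (colWeight p c * ((bitVal (c i) - p i) * (bitVal (c j) - p j))) +
        (∑ i, 2 * τ * a i * (colWeight p c * (bitVal (c i) - p i)) + τ ^ 2 * colWeight p c) := by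
    intro c
    have h1 : ∑ i, ∑ j, a i * a j * (colWeight p c * ((bitVal (c i) - p i) * (bitVal (c j) - p j))) =
        colWeight p c * ((∑ i, a i * (bitVal (c i) - p i)) * ∑ i, a i * (bitVal (c i) - p i)) := by
      rw [Finset.sum_mul_sum, Finset.mul_sum]
      refine Finset.sum_congr rfl fun i _ => ?_
      rw [Finset.mul_sum]
      exact Finset.sum_congr rfl fun j _ => by ring
    have h2 : ∑ i, 2 * τ * a i * (colWeight p c * (bitVal (c i) - p i)) =
        2 * τ * colWeight p c * ∑ i, a i * (bitVal (c i) - p i) := by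
      rw [Finset.mul_sum]
      exact Finset.sum_congr rfl fun i _ => by ring
    rw [h1, h2]
    ring
  have e1 : ∑ c : ι → Bool, ∑ i, ∑ j,
      a i * a j * (colWeight p c * ((bitVal (c i) - p i) * (bitVal (c j) - p j))) =
      ∑ i, a i ^ 2 * (p i * (1 - p i)) := by
    rw [Finset.sum_comm]
    refine Finset.sum_congr rfl fun i _ => ?_
    rw [Finset.sum_comm]
    simp only [← Finset.mul_sum, sum_colWeight_mul_sub_mul_sub, mul_ite, mul_zero, Finset.sum_ite_eq,
      Finset.mem_univ, if_true]
    ring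
  have e2 : ∑ c : ι → Bool, ∑ i, 2 * τ * a i * (colWeight p c * (bitVal (c i) - p i)) = 0 := by
    rw [Finset.sum_comm]
    simp only [← Finset.mul_sum, sum_colWeight_mul_sub, mul_zero, Finset.sum_const_zero]
  simp only [hpt, Finset.sum_add_distrib]
  rw [e1, e2, ← Finset.mul_sum, sum_colWeight, zero_add, mul_one]
  refine add_le_add (Finset.sum_le_sum fun i _ => ?_) le_rfl
  have : p i * (1 - p i) ≤ 1 / 4 := by nlinarith [sq_nonneg (p i - 1 / 2)]
  have := mul_le_mul_of_nonneg_left this (sq_nonneg (a i))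
  linarith

theorem lintegral_bits_sq_le {n I : ℕ} {p : Fin n → Fin I → ℝ} (h₀ : ∀ u j, 0 ≤ p u j)
    (h₁ : ∀ u j, p u j ≤ 1) (a : Fin n → Fin I → ℝ) (τ : ℝ) :
    ∫⁻ r, ENNReal.ofReal ((∑ u, ∑ j, a u j *
        (bitVal (decide ((r u j : ℝ) < p u j)) - p u j) + τ) ^ 2)
        ∂(Measure.pi fun _ : Fin n => tapeLaw) ≤
      ENNReal.ofReal (∑ u, ∑ j, a u j ^ 2 / 4 + τ ^ 2) := by
  rw [lintegral_bits h₀ h₁ fun b => ENNReal.ofReal ((∑ u, ∑ j, a u j *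
        (bitVal (b u j) - p u j) + τ) ^ 2)]
  -- All bits of all users and instances form one independent family, indexed by pairs.
  have key := sum_colWeight_mul_sq_le (fun i : Fin n × Fin I => p i.1 i.2) (fun i => a i.1 i.2) τ
  simp only [Fintype.sum_prod_type] at key
  refine (le_of_eq ?_).trans (ENNReal.ofReal_le_ofReal key)
  have hw : ∀ c ∈ Finset.univ, 0 ≤ colWeight (fun i : Fin n × Fin I => p i.1 i.2) c *
      (∑ u, ∑ j, a u j * (bitVal (c (u, j)) - p u j) + τ) ^ 2 := fun c _ => mul_nonneg
    (Finset.prod_nonneg fun i _ => bern_nonneg (h₀ _ _) (h₁ _ _) _) (sq_nonneg _)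
  rw [ENNReal.ofReal_sum_of_nonneg hw]
  refine (Fintype.sum_equiv (Equiv.curry (Fin n) (Fin I) Bool) _ _ fun c => ?_).symm
  rw [mul_comm, ENNReal.ofReal_mul (sq_nonneg _), colWeight, Fintype.prod_prod_type]
  rfl

theorem sum_voteOf_map_range (β : ℕ → Bool) (j m : ℕ) :
    (((List.range m).map fun i => (⟨i, (β i).toNat⟩ : Message)).map (voteOf j)).sum =
      if j < m then 2 * bitVal (β j) - 1 else 0 := by
  induction m with
  | zero => simp
  | succ m ih =>
    rw [List.range_succ, List.map_append, List.map_append, List.sum_append, ih]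
    rcases lt_trichotomy j m with h | h | h
    · simp [voteOf, h, h.ne', Nat.lt_succ_of_lt h]
    · subst h
      cases hb : β j <;> simp [voteOf, hb] <;> norm_num
    · simp [voteOf, h.ne, h.not_gt, show ¬ j < m + 1 by omega]

theorem sum_voteOf_messagesOf {n I : ℕ} (β : Fin n → ℕ → Bool) {j : ℕ} (hj : j < I) :
    ((messagesOf I β).map (voteOf j)).sum = ∑ u, (2 * bitVal (β u j) - 1) := by
  rw [messagesOf, List.map_flatten, List.sum_flatten, List.map_ofFn, List.map_ofFn, List.sum_ofFn]
  refine Finset.sum_congr rfl fun u _ => ?_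
  simp only [Function.comp_apply]
  rw [sum_voteOf_map_range, if_pos hj]

/-! ### The error of the protocol -/

/-- The value that the protocol returns at `y`, as a function of the bits of the users. -/
theorem queryRun_messagesOf {n d : ℕ} (hn : 0 < n) {θ : Params} (h : θ.alpha < 1) (pub r : Tape)
    (X : Fin n → Point d) (y : Point d) (β : Fin n → ℕ → Bool) {l : List Message}
    (hl : l.Perm (messagesOf (instances θ.alpha) β)) :
    (kdeProtocol.queryRun n θ pub (kdeProtocol.analyzerRun n d θ pub r l).published y).rreg 0 =
      ∑ u, ∑ j : Fin (instances θ.alpha),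
        8 * featureAt θ.alpha pub y j / (instances θ.alpha * √n) *
          (bitVal (β u j) - responseProb n (featureAt θ.alpha pub (X u) j)) +
        (∑ u, kernelEstimate θ.alpha pub (X u) y) / n := by
  have hn₀ : (0 : ℝ) < n := by exact_mod_cast hn
  have hI₀ : (0 : ℝ) < instances θ.alpha := by exact_mod_cast instances_pos θ.alpha
  rw [(queryRun_of_lt h _ _ _).1, (analyzerRun_of_lt h _ _ _).1, Finset.sum_range]
  have h1 : ∀ j : Fin (instances θ.alpha), featureAt θ.alpha pub y j *
      ((List.range (instances θ.alpha)).map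
        fun j => (l.map (voteOf j)).sum * (2 * √(n : ℝ) / n)).getD j 0 =
      ∑ u, featureAt θ.alpha pub y j * ((2 * bitVal (β u j) - 1) * (2 * √(n : ℝ) / n)) := fun j => by
    rw [List.getD_eq_getElem _ _ (by simp), List.getElem_map, List.getElem_range,
      (hl.map _).sum_eq, sum_voteOf_messagesOf β j.2, Finset.sum_mul, Finset.mul_sum]
  rw [Finset.sum_congr rfl fun j _ => h1 j, Finset.sum_comm, Finset.sum_div, Finset.mul_sum,
    Finset.sum_div, ← Finset.sum_add_distrib]
  refine Finset.sum_congr rfl fun u _ => ?_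
  rw [kernelEstimate, Finset.sum_range, Finset.sum_div, Finset.sum_div, Finset.mul_sum,
    Finset.sum_div, ← Finset.sum_add_distrib]
  refine Finset.sum_congr rfl fun j _ => ?_
  have hs : √(n : ℝ) ≠ 0 := (Real.sqrt_pos.2 hn₀).ne'
  have hs2 : (n : ℝ) = √n * √n := (Real.mul_self_sqrt hn₀.le).symm
  rw [responseProb]
  generalize √(n : ℝ) = q at hs hs2 ⊢
  rw [hs2]
  field_simp
  ring

theorem gaussianKDE_mem {n d : ℕ} (X : Fin n → Point d) (y : Point d) :
    0 ≤ gaussianKDE X y ∧ gaussianKDE X y ≤ 1 := by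
  rw [gaussianKDE]
  refine ⟨div_nonneg (Finset.sum_nonneg fun _ _ => (Real.exp_pos _).le) n.cast_nonneg,
    div_le_one_of_le₀ ?_ n.cast_nonneg⟩
  calc _ ≤ ∑ _u : Fin n, (1 : ℝ) := Finset.sum_le_sum fun u _ =>
        Real.exp_le_one_iff.2 (neg_nonpos.2 (sq_nonneg _))
    _ = n := by simp

/-- The mean squared error given the public randomness. -/
theorem lintegral_error_le {n d : ℕ} (hn : 0 < n) {θ : Params} (h : θ.alpha < 1) (pub : Tape)
    (X : Fin n → Point d) (y : Point d) :
    ∫⁻ r, shuffleMean (kdeProtocol.allMessages θ pub r X) (fun l => ∫⁻ r', ENNReal.ofReal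
        (((kdeProtocol.queryRun n θ pub (kdeProtocol.analyzerRun n d θ pub r' l).published y).rreg 0
          - gaussianKDE X y) ^ 2) ∂tapeLaw) ∂(Measure.pi fun _ : Fin n => tapeLaw) ≤
      ENNReal.ofReal (16 / instances θ.alpha +
        ((∑ u, kernelEstimate θ.alpha pub (X u) y) / n - gaussianKDE X y) ^ 2) := by
  have hn₀ : (0 : ℝ) < n := by exact_mod_cast hn
  have hI₀ : (0 : ℝ) < instances θ.alpha := by exact_mod_cast instances_pos θ.alpha
  set τ := (∑ u, kernelEstimate θ.alpha pub (X u) y) / n - gaussianKDE X y with hτ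
  have hp : ∀ (u : Fin n) (j : Fin (instances θ.alpha)),
      |responseProb n (featureAt θ.alpha pub (X u) j) - 1 / 2| ≤ 1 / 2 := fun u j => by
    refine (abs_responseProb_sub_le n (abs_featureAt_le_one _ _ _ _)).trans ?_
    rw [div_le_div_iff₀ (by positivity) (by norm_num)]
    have : 1 ≤ √(n : ℝ) := Real.one_le_sqrt.2 (by exact_mod_cast hn)
    linarith
  have key := lintegral_bits_sq_le
    (p := fun u (j : Fin (instances θ.alpha)) => responseProb n (featureAt θ.alpha pub (X u) j))
    (fun u j => by have := abs_le.1 (hp u j); linarith)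
    (fun u j => by have := abs_le.1 (hp u j); linarith)
    (fun _ j => 8 * featureAt θ.alpha pub y j / (instances θ.alpha * √n)) τ
  refine (lintegral_mono fun r => ?_).trans (key.trans (ENNReal.ofReal_le_ofReal ?_))
  · refine shuffleMean_le fun l hl => ?_
    rw [allMessages_of_lt h] at hl
    simp only [queryRun_messagesOf hn h pub _ X y _ hl, lintegral_const, measure_univ, mul_one]
    rw [hτ, ← add_sub_assoc]
    rfl
  · refine add_le_add ?_ le_rfl
    -- `8²/4 = 16`; summing over `nI` bits then gives `16/I`, without `n`.
    have hb : ∀ (u : Fin n) (j : Fin (instances θ.alpha)),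
        (8 * featureAt θ.alpha pub y j / (instances θ.alpha * √n)) ^ 2 / 4 ≤
          16 / (instances θ.alpha ^ 2 * n) := fun u j => by
      have h2 := pow_le_pow_left₀ (abs_nonneg _) (abs_featureAt_le_one θ.alpha pub y j) 2
      rw [sq_abs, one_pow] at h2
      rw [div_pow, mul_pow, mul_pow, Real.sq_sqrt hn₀.le, div_div, div_le_div_iff₀ (by positivity)
        (by positivity)]
      have : (0 : ℝ) ≤ instances θ.alpha ^ 2 * n := by positivity
      nlinarith
    refine (Finset.sum_le_sum fun u _ => Finset.sum_le_sum fun j _ => hb u j).trans (le_of_eq ?_)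
    simp only [Finset.sum_const, Finset.card_univ, Fintype.card_fin, nsmul_eq_mul]
    field_simp

theorem supRMSE_kdeProtocol_le {n d : ℕ} (hn : 1 ≤ n) {θ : Params} (hα : 0 < θ.alpha)
    (X : Fin n → Point d) : kdeProtocol.supRMSE θ X ≤ ENNReal.ofReal θ.alpha := by
  refine iSup_le fun y => ?_
  have hroot : ENNReal.ofReal θ.alpha = ENNReal.ofReal (θ.alpha ^ 2) ^ (1 / 2 : ℝ) := by
    rw [ENNReal.ofReal_rpow_of_nonneg (sq_nonneg _) (by norm_num), ← Real.sqrt_eq_rpow,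
      Real.sqrt_sq hα.le]
  rw [hroot]
  refine ENNReal.rpow_le_rpow ?_ (by norm_num)
  rw [Protocol.viewMean]
  -- For `α ≥ 1` the answer is 0, and the density estimate lies in `[0, 1]`.
  rcases le_or_gt 1 θ.alpha with h | h
  · have hb := gaussianKDE_mem X y
    calc _ ≤ ∫⁻ _ : Tape, ∫⁻ _ : Fin n → Tape, ENNReal.ofReal (θ.alpha ^ 2)
          ∂(Measure.pi fun _ : Fin n => tapeLaw) ∂tapeLaw := by
          refine lintegral_mono fun pub => lintegral_mono fun r => shuffleMean_le fun l _ => ?_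
          simp only [(queryRun_of_le h _ _ _).1, lintegral_const, measure_univ, mul_one]
          exact ENNReal.ofReal_le_ofReal (by nlinarith)
      _ = _ := by simp
  · have hI₀ : (0 : ℝ) < instances θ.alpha := by exact_mod_cast instances_pos θ.alpha
    refine (lintegral_mono fun pub => lintegral_error_le hn h pub X y).trans ?_
    have hB : BddMeas fun t =>
        ((∑ u, kernelEstimate θ.alpha t (X u) y) / n - gaussianKDE X y) ^ 2 := by
      simp only [div_eq_inv_mul]
      exact (((BddMeas.sum _ fun u => bddMeas_kernelEstimate θ.alpha (X u) y).const_mul _).sub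
        (BddMeas.const _)).pow_two
    rw [← ofReal_integral_eq_lintegral_ofReal ((BddMeas.const _).add hB).integrable
      (Filter.Eventually.of_forall fun t => by positivity)]
    refine ENNReal.ofReal_le_ofReal ?_
    rw [integral_add (integrable_const _) hB.integrable]
    have h1 := integral_mean_kernelEstimate_sub_sq_le hn θ.alpha X y
    have h2 : 100 / instances θ.alpha ≤ θ.alpha ^ 2 := by
      have := le_instances θ.alpha
      rw [div_le_iff₀ (by positivity)] at this
      rw [div_le_iff₀ hI₀]
      nlinarith
    -- Bits, then features with sketch; the last term is slack.
    have h3 : (100 : ℝ) / instances θ.alpha = 16 / instances θ.alpha + 34 / instances θ.alpha +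
      50 / instances θ.alpha := by ring
    have h4 : (0 : ℝ) ≤ 50 / instances θ.alpha := by positivity
    simp only [integral_const, probReal_univ, one_smul]
    linarith

/-! ### Running times and communication -/

/-- Take logarithms in `2 ^ levels α ≤ 2 ^ 8 (1 + f)`, where `202 ≤ 2 ^ 8`. -/
theorem levels_le {α f : ℝ} (h₀ : 0 < α) (h₁ : α < 1) (hf : 1 / α ^ 2 ≤ f) :
    (levels α : ℝ) ≤ 8 * (1 + Real.log (1 + f)) := by
  have hq : 0 < 1 / α ^ 2 := by positivity
  have hI : (2 : ℝ) ^ levels α ≤ 2 ^ 8 * (1 + f) := by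
    have := instances_le h₀ h₁
    rw [instances] at this
    push_cast at this
    have e : 202 / α ^ 2 = 202 * (1 / α ^ 2) := by ring
    linarith
  have h2 := Real.log_le_log (by positivity) hI
  rw [Real.log_mul (by norm_num) (by linarith), Real.log_pow, Real.log_pow] at h2
  have h3 : 0 ≤ Real.log (1 + f) := Real.log_nonneg (by linarith)
  have h4 := Real.log_two_gt_d9
  push_cast at h2
  by_contra! h
  have : (8 * (1 + Real.log (1 + f))) * Real.log 2 < levels α * Real.log 2 :=
    mul_lt_mul_of_pos_right h (by linarith)
  nlinarith

theorem one_le_one_div_sq {α : ℝ} (h₀ : 0 < α) (h₁ : α < 1) : 1 ≤ 1 / α ^ 2 := by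
  rw [le_div_iff₀ (by positivity)]; nlinarith

/-- The sketch dimension is at most `d`, and when hashing occurs its logarithmic cost per coordinate
is below the number of instances. -/
theorem runTime_le_stepsO {α : ℝ} {d : ℕ} (hd : 1 ≤ d) (h₀ : 0 < α) (h₁ : α < 1) :
    (runTime α d : ℝ) ≤ stepsO 1000000 (d / α ^ 2) := by
  have hq := one_le_one_div_sq h₀ h₁
  have hd' : (1 : ℝ) ≤ d := by exact_mod_cast hd
  have hI := instances_le h₀ h₁
  have hc := ceil_le h₀ h₁
  have hl : levels α ≤ instances α := Nat.lt_two_pow_self.le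
  have hM : sketchDim (instances α) d ≤ d := by unfold sketchDim; split_ifs <;> omega
  have hif : (if instances α < d then levels α * 6 else 0) ≤ instances α * 6 := by
    split_ifs <;> omega
  have hT : runTime α d ≤ 27 + 5 * ⌈100 / (α * α)⌉₊ + 14 * d + 20 * instances α +
      22 * (d * instances α) := by
    have a := Nat.mul_le_mul_left d hif
    have b := Nat.mul_le_mul_left (instances α) hM
    unfold runTime featureTime
    nlinarith
  have hT' : (runTime α d : ℝ) ≤ 27 + 5 * ⌈100 / (α * α)⌉₊ + 14 * d + 20 * instances α +
      22 * (d * instances α) := by exact_mod_cast hT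
  rw [stepsO]
  have e1 : 202 / α ^ 2 = 202 * (1 / α ^ 2) := by ring
  have e2 : 101 / α ^ 2 = 101 * (1 / α ^ 2) := by ring
  have e3 : (d : ℝ) / α ^ 2 = d * (1 / α ^ 2) := by ring
  rw [e1] at hI
  rw [e2] at hc
  rw [e3]
  generalize 1 / α ^ 2 = q at *
  have a := mul_le_mul_of_nonneg_left hI (by positivity : (0 : ℝ) ≤ d)
  nlinarith

/-- The sketch dimension is also at most the number of instances: sketching costs `d` times a
logarithm, and the features `1/α⁴`. -/
theorem runTime_le_softO {α : ℝ} {d : ℕ} (hd : 1 ≤ d) (h₀ : 0 < α) (h₁ : α < 1) :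
    (runTime α d : ℝ) ≤ softO 1000000 1 (d + 1 / α ^ 4) := by
  have hq := one_le_one_div_sq h₀ h₁
  have hd' : (1 : ℝ) ≤ d := by exact_mod_cast hd
  have hI := instances_le h₀ h₁
  have hc := ceil_le h₀ h₁
  have e4 : 1 / α ^ 4 = (1 / α ^ 2) ^ 2 := by rw [div_pow, one_pow, ← pow_mul]
  have hl := levels_le (f := d + 1 / α ^ 4) h₀ h₁ (by rw [e4]; nlinarith)
  have hM : sketchDim (instances α) d ≤ instances α := by unfold sketchDim; split_ifs <;> omega
  have hif : (if instances α < d then levels α * 6 else 0) ≤ levels α * 6 := by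
    split_ifs <;> omega
  have hT : runTime α d ≤ 27 + 5 * ⌈100 / (α * α)⌉₊ + 14 * d + 20 * instances α +
      6 * (d * levels α) + 16 * (instances α * instances α) := by
    have a := Nat.mul_le_mul_left d hif
    have b := Nat.mul_le_mul_left (instances α) hM
    unfold runTime featureTime
    nlinarith
  have hT' : (runTime α d : ℝ) ≤ 27 + 5 * ⌈100 / (α * α)⌉₊ + 14 * d + 20 * instances α +
      6 * (d * levels α) + 16 * (instances α * instances α) := by exact_mod_cast hT
  rw [softO, pow_one]
  have hΛ : 0 ≤ Real.log (1 + (d + 1 / α ^ 4)) := Real.log_nonneg (by rw [e4]; nlinarith)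
  have e1 : 202 / α ^ 2 = 202 * (1 / α ^ 2) := by ring
  have e2 : 101 / α ^ 2 = 101 * (1 / α ^ 2) := by ring
  rw [e1] at hI
  rw [e2] at hc
  generalize Real.log (1 + (d + 1 / α ^ 4)) = L at *
  rw [e4]
  generalize 1 / α ^ 2 = q at *
  have a := mul_le_mul_of_nonneg_left hl (by positivity : (0 : ℝ) ≤ d)
  have b := mul_le_mul hI hI (by positivity) (by linarith : (0 : ℝ) ≤ 202 * q)
  have c : (d : ℝ) ≤ d * (1 + L) := by nlinarith
  have e : q ^ 2 ≤ q ^ 2 * (1 + L) := by nlinarith [sq_nonneg q]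
  nlinarith

theorem three_le_min {α : ℝ} {d : ℕ} (hd : 1 ≤ d) (h₀ : 0 < α) :
    (3 : ℝ) ≤ min (stepsO 1000000 (d / α ^ 2)) (softO 1000000 1 (d + 1 / α ^ 4)) := by
  have hd' : (1 : ℝ) ≤ d := by exact_mod_cast hd
  refine le_min ?_ ?_
  · have : 0 ≤ d / α ^ 2 := by positivity
    rw [stepsO]; linarith
  · have h1 : 0 ≤ 1 / α ^ 4 := by positivity
    have h2 : 0 ≤ Real.log (1 + (d + 1 / α ^ 4)) := Real.log_nonneg (by linarith)
    rw [softO, pow_one]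
    nlinarith

theorem userRun_time_le {n d : ℕ} {θ : Params} (hd : 1 ≤ d) (h₀ : 0 < θ.alpha) (pub r : Tape)
    (x : Point d) : ((kdeProtocol.userRun n θ pub r x).time : ℝ) ≤
      min (stepsO 1000000 (d / θ.alpha ^ 2)) (softO 1000000 1 (d + 1 / θ.alpha ^ 4)) := by
  rcases le_or_gt 1 θ.alpha with h | h
  · rw [(userRun_of_le h _ _ _).2]
    exact three_le_min hd h₀
  · exact (Nat.cast_le.2 (userRun_of_lt h pub r x).2).trans
      (le_min (runTime_le_stepsO hd h₀ h) (runTime_le_softO hd h₀ h))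

theorem queryRun_time_le {n d : ℕ} {θ : Params} (hd : 1 ≤ d) (h₀ : 0 < θ.alpha) (pub : Tape)
    (desc : List ℝ) (y : Point d) : ((kdeProtocol.queryRun n θ pub desc y).time : ℝ) ≤
      min (stepsO 1000000 (d / θ.alpha ^ 2)) (softO 1000000 1 (d + 1 / θ.alpha ^ 4)) := by
  rcases le_or_gt 1 θ.alpha with h | h
  · rw [(queryRun_of_le h _ _ _).2]
    exact three_le_min hd h₀
  · exact (Nat.cast_le.2 (queryRun_of_lt h pub desc y).2).trans
      (le_min (runTime_le_stepsO hd h₀ h) (runTime_le_softO hd h₀ h))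

/-- The number of labels that are in use. -/
def labelCount (α : ℝ) : ℕ := open Classical in if α < 1 then instances α else 0

theorem labelCount_le {α : ℝ} (h₀ : 0 < α) : (labelCount α : ℝ) ≤ 1000000 / α ^ 2 := by
  unfold labelCount
  split_ifs with h
  · exact (instances_le h₀ h).trans (div_le_div_of_nonneg_right (by norm_num) (by positivity))
  -- The value 0 matters here: for large `α` the bound `1000000 / α²` is below 1.
  · rw [Nat.cast_zero]; positivity

theorem hasMessageFormat_kdeProtocol (n d : ℕ) (θ : Params) :
    kdeProtocol.HasMessageFormat n d θ (labelCount θ.alpha) 1 := by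
  intro pub r x m hm
  rcases le_or_gt 1 θ.alpha with h | h
  · rw [(userRun_of_le h _ _ _).1] at hm
    simp at hm
  · rw [(userRun_of_lt h _ _ _).1] at hm
    obtain ⟨j, hj, rfl⟩ := List.mem_map.1 hm
    rw [labelCount, if_pos h]
    refine ⟨List.mem_range.1 hj, ?_⟩
    cases bitOf n θ.alpha pub r x j <;> simp

theorem meanUserBits_kdeProtocol_le (n : ℕ) {d : ℕ} {θ : Params} (h₀ : 0 < θ.alpha) (x : Point d) :
    kdeProtocol.meanUserBits n θ (labelCount θ.alpha) 1 x ≤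
      ENNReal.ofReal (softO 1000000 1 (1 / θ.alpha ^ 2)) := by
  rw [Protocol.meanUserBits]
  rcases le_or_gt 1 θ.alpha with h | h
  · simp [(userRun_of_le h _ _ _).1]
  · simp only [(userRun_of_lt h _ _ _).1, List.length_map, List.length_range, lintegral_const,
      measure_univ, mul_one]
    rw [← ENNReal.ofReal_natCast]
    refine ENNReal.ofReal_le_ofReal ?_
    rw [labelCount, if_pos h, softO, pow_one]
    -- The number of labels is a power of two, so the length of a label is exactly `levels`.
    have e : Nat.clog 2 (instances θ.alpha) = levels θ.alpha := Nat.clog_pow 2 _ (by norm_num)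
    have hl := levels_le h₀ h le_rfl
    have hI := instances_le h₀ h
    have hq := one_le_one_div_sq h₀ h
    have hL : 0 ≤ Real.log (1 + 1 / θ.alpha ^ 2) := Real.log_nonneg (by linarith)
    rw [e]
    push_cast
    rw [show 202 / θ.alpha ^ 2 = 202 * (1 / θ.alpha ^ 2) by ring] at hI
    generalize Real.log (1 + 1 / θ.alpha ^ 2) = L at *
    generalize 1 / θ.alpha ^ 2 = q at *
    calc (instances θ.alpha : ℝ) * (levels θ.alpha + 1) ≤ (202 * q) * (9 * (1 + L)) :=
          mul_le_mul hI (by linarith) (by positivity) (by linarith)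
      _ ≤ 1000000 * q * (1 + L) := by nlinarith [mul_nonneg (zero_le_one.trans hq) hL]

theorem meanAnalyzerTime_kdeProtocol_le {n d : ℕ} (hn : 1 ≤ n) {θ : Params} (h₀ : 0 < θ.alpha)
    (X : Fin n → Point d) : kdeProtocol.meanAnalyzerTime θ X ≤
      ENNReal.ofReal (stepsO 1000000 (n / θ.alpha ^ 2)) := by
  have hn' : (1 : ℝ) ≤ n := by exact_mod_cast hn
  suffices H : ∀ pub r l, l.Perm (kdeProtocol.allMessages θ pub r X) → ∀ r' : Tape,
      ((kdeProtocol.analyzerRun n d θ pub r' l).time : ℝ) ≤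
        stepsO 1000000 (n / θ.alpha ^ 2) by
    calc _ ≤ ∫⁻ _ : Tape, ∫⁻ _ : Fin n → Tape,
          ENNReal.ofReal (stepsO 1000000 (n / θ.alpha ^ 2))
          ∂(Measure.pi fun _ : Fin n => tapeLaw) ∂tapeLaw := by
          refine lintegral_mono fun pub => lintegral_mono fun r => shuffleMean_le fun l hl => ?_
          calc _ ≤ ∫⁻ _ : Tape, ENNReal.ofReal (stepsO 1000000 (n / θ.alpha ^ 2)) ∂tapeLaw := by
                refine lintegral_mono fun r' => ?_
                rw [← ENNReal.ofReal_natCast]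
                exact ENNReal.ofReal_le_ofReal (H pub r l hl r')
            _ = _ := by simp
      _ = _ := by simp
  intro pub r l hl r'
  rcases le_or_gt 1 θ.alpha with h | h
  · rw [analyzerRun_of_le h, stepsO]
    have : 0 ≤ n / θ.alpha ^ 2 := by positivity
    push_cast
    linarith
  · have hT := (analyzerRun_of_lt (n := n) (d := d) h pub r' l).2
    rw [hl.length_eq, allMessages_of_lt h, length_messagesOf] at hT
    have hT' : ((kdeProtocol.analyzerRun n d θ pub r' l).time : ℝ) ≤
        19 + 5 * ⌈100 / (θ.alpha * θ.alpha)⌉₊ + n * instances θ.alpha * 8 +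
          instances θ.alpha * 5 := by exact_mod_cast hT
    have hI := instances_le h₀ h
    have hc := ceil_le h₀ h
    have hq := one_le_one_div_sq h₀ h
    rw [show 202 / θ.alpha ^ 2 = 202 * (1 / θ.alpha ^ 2) by ring] at hI
    rw [show 101 / θ.alpha ^ 2 = 101 * (1 / θ.alpha ^ 2) by ring] at hc
    rw [stepsO, show (n : ℝ) / θ.alpha ^ 2 = n * (1 / θ.alpha ^ 2) by ring]
    generalize 1 / θ.alpha ^ 2 = q at *
    have a := mul_le_mul_of_nonneg_left hI (by positivity : (0 : ℝ) ≤ n)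
    nlinarith

end ShuffledKDE

end

/-! ### The theorem, with its constants -/

theorem theorem2 :
    ∃ (C C' K : ℝ) (p : ℕ) (P : ShuffledKDE.Protocol), 0 < C ∧ 0 < C' ∧ 0 < K ∧
      ∀ (n d : ℕ) (ε δ α : ℝ), 1 ≤ n → 1 ≤ d → 0 < δ → δ < 1 → 0 < ε →
        ε ≤ C * Real.log (1 / δ) →
        C' * Real.sqrt (Real.log (1 / δ)) / (ε * n) ≤ α →
        -- privacy
        P.IsShuffledDP n d ⟨ε, δ, α⟩ ∧
        -- accuracy
        (∀ X : Fin n → ShuffledKDE.Point d, P.supRMSE ⟨ε, δ, α⟩ X ≤ ENNReal.ofReal α) ∧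
        -- user running time
        (∀ (pub r : ShuffledKDE.Tape) (x : ShuffledKDE.Point d),
          ((P.userRun n ⟨ε, δ, α⟩ pub r x).time : ℝ)
            ≤ min (ShuffledKDE.stepsO K (d / α ^ 2))
                (ShuffledKDE.softO K p (d + 1 / α ^ 4))) ∧
        -- bit-width 1 and expected communication per user
        (∃ I : ℕ, (I : ℝ) ≤ K / α ^ 2 ∧ P.HasMessageFormat n d ⟨ε, δ, α⟩ I 1 ∧
          ∀ x : ShuffledKDE.Point d, P.meanUserBits n ⟨ε, δ, α⟩ I 1 x
            ≤ ENNReal.ofReal (ShuffledKDE.softO K p (1 / α ^ 2))) ∧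
        -- expected analyzer running time
        (∀ X : Fin n → ShuffledKDE.Point d, P.meanAnalyzerTime ⟨ε, δ, α⟩ X
          ≤ ENNReal.ofReal (ShuffledKDE.stepsO K (n / α ^ 2))) ∧
        -- query time
        (∀ (pub r : ShuffledKDE.Tape) (msgs : List ShuffledKDE.Message)
            (y : ShuffledKDE.Point d),
          ((P.queryRun n ⟨ε, δ, α⟩ pub
              (P.analyzerRun n d ⟨ε, δ, α⟩ pub r msgs).published y).time : ℝ)
            ≤ min (ShuffledKDE.stepsO K (d / α ^ 2))
                (ShuffledKDE.softO K p (d + 1 / α ^ 4))) := by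
  refine ⟨1, 200, 1000000, 1, ShuffledKDE.kdeProtocol, by norm_num, by norm_num, by norm_num, ?_⟩
  intro n d ε δ α hn hd hδ hδ₁ hε hεδ hα
  rw [one_mul] at hεδ
  have hn' : (0 : ℝ) < n := by exact_mod_cast hn
  -- Positivity of `log (1/δ)` makes the lower bound on `α` strictly positive.
  have hα₀ : 0 < α := by
    have : 0 < Real.log (1 / δ) := hε.trans_le hεδ
    exact lt_of_lt_of_le (by positivity) hα
  exact ⟨ShuffledKDE.isShuffledDP_kdeProtocol hn hδ hδ₁ hε hεδ hα,
    ShuffledKDE.supRMSE_kdeProtocol_le (θ := ⟨ε, δ, α⟩) hn hα₀,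
    ShuffledKDE.userRun_time_le (θ := ⟨ε, δ, α⟩) hd hα₀,
    ⟨ShuffledKDE.labelCount α, ShuffledKDE.labelCount_le hα₀,
      ShuffledKDE.hasMessageFormat_kdeProtocol n d ⟨ε, δ, α⟩,
      ShuffledKDE.meanUserBits_kdeProtocol_le (θ := ⟨ε, δ, α⟩) n hα₀⟩,
    ShuffledKDE.meanAnalyzerTime_kdeProtocol_le (θ := ⟨ε, δ, α⟩) hn hα₀,
    fun pub _ _ y => ShuffledKDE.queryRun_time_le (θ := ⟨ε, δ, α⟩) hd hα₀ pub _ y⟩
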